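/- Let $d,N\ge 1$. For $1\le k\le N$ let $\mathcal S_s(\mathbb R^{dk})$ be the space of complex Schwartz functions of $(x_1,\dots,x_k)\in(\mathbb R^d)^k$ invariant under permutations of the particles, and let $\mathcal S_s'(\mathbb R^{dk})$ be the space of permutation invariant tempered distributions with the strong dual topology; functions are viewed as distributions through $\varphi\mapsto\int f\varphi$. **Observables.** $\mathfrak g_k$ is the real vector space of continuous linear operators $A$ on $\mathcal S_s(\mathbb R^{dk})$ that are skew-adjoint, $\langle f,Ag\rangle_{L^2}=-\langle Af,g\rangle_{L^2}$, with Lie bracket $[A,B]_{\mathfrak g_k}=k(AB-BA)$. For $1\le k\le N$, the injective map $\varepsilon_{k,N}:\mathfrak g_k\to\mathfrak g_N$ is $$\varepsilon_{k,N}(A)=\frac{1}{N(N-1)\cdots(N-k+1)}\sum_{(j_1,\dots,j_k)}A_{(j_1,\dots,j_k)},$$ where the sum is over $k$-tuples of distinct elements of $\{1,\dots,N\}$ and $A_{(j_1,\dots,j_k)}$ is $A$ acting on the variables $x_{j_1},\dots,x_{j_k}$. Let $\mathfrak G_N=\bigoplus_{k=1}^N\mathfrak g_k$ with the bracket $$[A,B]_{\mathfrak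 G_N}^{(k)}=\sum_{\substack{1\le \ell,j\le N\\ \min(\ell+j-1,N)=k}}\varepsilon_{k,N}^{-1}\Big(\big[\varepsilon_{\ell,N}(A^{(\ell)}),\varepsilon_{j,N}(B^{(j)})\big]_{\mathfrak g_N}\Big),$$ and let $\iota_{\varepsilon,N}:\mathfrak G_N\to\mathfrak g_N$, $\iota_{\varepsilon,N}(A)=\sum_{k=1}^N\varepsilon_{k,N}(A^{(k)})$. **Density matrices.** $\mathfrak g_k^*$ is the real topological vector space of self-adjoint elements of $\mathcal L(\mathcal S_s'(\mathbb R^{dk}),\mathcal S_s(\mathbb R^{dk}))$, with the topology of bounded convergence (self-adjoint: $\langle f,\gamma g\rangle_{L^2}=\langle\gamma f,g\rangle_{L^2}$ for $f,g\in\mathcal S_s(\mathbb R^{dk})$), and $\mathfrak G_N^*=\prod_{k=1}^N\mathfrak g_k^*$. The trace of an operator in $\mathcal L(\mathcal S_s',\mathcal S_s)$ is the integral of its Schwartz kernel over the diagonal. The pairings are the real numbers $i\,\mathrm{Tr}(A\Psi)$ for $A\in\mathfrak g_N$, $\Psi\in\mathfrak g_N^*$, and $i\,\mathrm{Tr}(A\cdot\Gamma)=\sum_{k=1}^N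 i\,\mathrm{Tr}(A^{(k)}\gamma^{(k)})$ for $A\in\mathfrak G_N$, $\Gamma=(\gamma^{(k)})_{k\le N}\in\mathfrak G_N^*$. **Poisson structures.** A map between topological vector spaces is *smooth* if its iterated Gâteaux directional derivatives of all orders exist and are jointly continuous in the base point and the directions. Let $\mathcal A_{DM,N}$, respectively $\mathcal A_{H,N}$, be the unital algebra of functionals on $\mathfrak g_N^*$, respectively $\mathfrak G_N^*$, generated by the constants and the smooth functionals $i\,\mathrm{Tr}(A\,\cdot\,)$ with $A\in\mathfrak g_N$, respectively $A\in\mathfrak G_N$. For $F,G$ in this algebra set $\{F,G\}(m)=i\,\mathrm{Tr}\big([dF[m],dG[m]]\,m\big)$, with the bracket of $\mathfrak g_N$, respectively $\mathfrak G_N$, where the Gâteaux derivative $dF[m]$ is identified through the pairing with an element of $\mathfrak g_N$, respectively $\mathfrak G_N$. A *Poisson map* from $(M_1,\mathcal A_1,\{\cdot,\cdot\}_1)$ to $(M_2,\mathcal A_2,\{\cdot,\cdot\}_2)$ is a smooth map $\phi:M_1\to M_2$ with $F\circ\phi\in\mathcal A_1$ and $\{F,G\}_2\circ\phi=\{F\circ\phi,G\circ\phi\}_1$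 for all $F,G\in\mathcal A_2$. **Proposition.** There is a unique map $$\iota_{RDM,N}:\mathfrak g_N^*\to\mathfrak G_N^*,\qquad \Psi\mapsto\big(\mathrm{Tr}_{k+1,\dots,N}\Psi\big)_{1\le k\le N},$$ where the operator $\mathrm{Tr}_{k+1,\dots,N}\Psi$ has the kernel $\int\Psi(x,y;x',y)\,dy$ for $x,x'\in(\mathbb R^d)^k$, $y\in(\mathbb R^d)^{N-k}$. It is a Poisson map from $(\mathfrak g_N^*,\mathcal A_{DM,N},\{\cdot,\cdot\})$ to $(\mathfrak G_N^*,\mathcal A_{H,N},\{\cdot,\cdot\})$, and it is dual to $\iota_{\varepsilon,N}$: for all $A\in\mathfrak G_N$ and $\Psi\in\mathfrak g_N^*$, $$i\,\mathrm{Tr}\big(\iota_{\varepsilon,N}(A)\,\Psi\big)=i\,\mathrm{Tr}\big(A\cdot\iota_{RDM,N}(\Psi)\big).$$ -/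

import Mathlib

open SchwartzMap MeasureTheory Filter Topology

namespace BosonicRDM

noncomputable section

/-! ### Calculus on locally convex spaces -/

section Calculus

variable {X Y : Type*} [AddCommGroup X] [Module ℝ X] [TopologicalSpace X]
  [AddCommGroup Y] [Module ℝ Y] [TopologicalSpace Y]

/-- `y` is the Gâteaux derivative of `f` at `x` in the direction `v`. -/
def HasGateauxDerivAt (f : X → Y) (x v : X) (y : Y) : Prop :=
  Tendsto (fun t : ℝ => t⁻¹ • (f (x + t • v) - f x)) (𝓝[≠] (0 : ℝ)) (𝓝 y)

/-- `f` is smooth (`C^∞` in the sense of Gâteaux, as in Milnor and Hamilton): all iterated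
directional derivatives `D r x v = f⁽ʳ⁾(x; v₁, …, vᵣ)` exist and are jointly continuous in
`(x; v₁, …, vᵣ)`.  For `r = 0` this is the continuity of `f`. -/
def GateauxSmooth (f : X → Y) : Prop :=
  ∃ D : (r : ℕ) → X → (Fin r → X) → Y,
    (∀ x v, D 0 x v = f x) ∧
    (∀ r, Continuous fun p : X × (Fin r → X) => D r p.1 p.2) ∧
    ∀ (r : ℕ) (x : X) (v : Fin r → X) (w : X),
      HasGateauxDerivAt (fun y => D r y v) x w (D (r + 1) x (Fin.snoc v w))

end Calculus

/-! ### Poisson maps and Lie-Poisson structures -/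

/-- The data of a Poisson structure on `M`: an algebra of admissible functionals, and a bracket
(only its values on admissible functionals are used). -/
structure PoissonData (M : Type*) where
  functionals : Subalgebra ℝ (M → ℝ)
  bracket : (M → ℝ) → (M → ℝ) → (M → ℝ)

/-- Poisson maps: smooth maps that pull admissible functionals back to admissible functionals and
intertwine the brackets. -/
def IsPoissonMap {M₁ M₂ : Type*}
    [AddCommGroup M₁] [Module ℝ M₁] [TopologicalSpace M₁]
    [AddCommGroup M₂] [Module ℝ M₂] [TopologicalSpace M₂]
    (P₁ : PoissonData M₁) (P₂ : PoissonData M₂) (φ : M₁ → M₂) : Prop :=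
  GateauxSmooth φ ∧
  (∀ F ∈ P₂.functionals, F ∘ φ ∈ P₁.functionals) ∧
  ∀ F ∈ P₂.functionals, ∀ G ∈ P₂.functionals,
    P₂.bracket F G ∘ φ = P₁.bracket (F ∘ φ) (G ∘ φ)

section LiePoisson

variable {L M : Type*} [Zero L] [AddCommGroup M] [Module ℝ M] [TopologicalSpace M]

/-- `A : L` represents the Gâteaux derivative `dF[m]` through the pairing of `L` with `M`. -/
def IsFunctionalDeriv (pair : L → M → ℝ) (F : M → ℝ) (m : M) (A : L) : Prop :=
  ∀ v, HasGateauxDerivAt F m v (pair A v)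

open Classical in
/-- The element of `L` identified with `dF[m]`. For the pairings and the admissible functionals
used below there is exactly one such element (the value `0` is irrelevant). -/
def functionalDeriv (pair : L → M → ℝ) (F : M → ℝ) (m : M) : L :=
  if h : ∃ A, IsFunctionalDeriv pair F m A then h.choose else 0

/-- The Lie-Poisson structure on `M` defined by a pairing with `L` and a Lie bracket on `L`:
the admissible functionals form the unital algebra generated by the smooth functionals
`⟨A, ·⟩`, `A ∈ L` (and the constants), and `{F, G}(m) = ⟨[dF[m], dG[m]], m⟩`. -/
def liePoisson (pair : L → M → ℝ) (br : L → L → L) : PoissonData M where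
  functionals := Algebra.adjoin ℝ
    ({F | GateauxSmooth F ∧ ∃ A, ∀ m, F m = pair A m} ∪ {F | ∃ c : ℝ, ∀ m, F m = c})
  bracket F G := fun m => pair (br (functionalDeriv pair F m) (functionalDeriv pair G m)) m

end LiePoisson

/-! ### Bosonic test functions and distributions -/

/-- Configurations of `k` particles in `ℝᵈ`. -/
abbrev Conf (d k : ℕ) : Type := Fin k → EuclideanSpace ℝ (Fin d)

instance instTemperateConf (d k : ℕ) : (volume : Measure (Conf d k)).HasTemperateGrowth :=
  Measure.IsAddHaarMeasure.instHasTemperateGrowth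

/-- The map `(x₁, …, x_k) ↦ (x_{π(1)}, …, x_{π(k)})`. -/
def permConf (d : ℕ) {k : ℕ} (π : Equiv.Perm (Fin k)) : Conf d k ≃L[ℝ] Conf d k :=
  (LinearEquiv.funCongrLeft ℝ (EuclideanSpace ℝ (Fin d)) π).toContinuousLinearEquiv

@[simp] theorem permConf_apply (d : ℕ) {k : ℕ} (π : Equiv.Perm (Fin k)) (x : Conf d k) :
    permConf d π x = x ∘ π := rfl

/-- The action `(π f)(x) = f(x_{π(1)}, …, x_{π(k)})` on Schwartz functions. -/
def permSchwartz (d : ℕ) {k : ℕ} (π : Equiv.Perm (Fin k)) :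
    𝓢(Conf d k, ℂ) →L[ℂ] 𝓢(Conf d k, ℂ) :=
  SchwartzMap.compCLMOfContinuousLinearEquiv ℂ (permConf d π)

@[simp] theorem permSchwartz_apply (d : ℕ) {k : ℕ} (π : Equiv.Perm (Fin k))
    (f : 𝓢(Conf d k, ℂ)) (x : Conf d k) : permSchwartz d π f x = f (x ∘ π) := rfl

/-- The bosonic Schwartz space `𝓢_s(ℝ^{dk})`, with the subspace topology. -/
def SymSchwartz (d k : ℕ) : Submodule ℂ 𝓢(Conf d k, ℂ) where
  carrier := {f | ∀ (π : Equiv.Perm (Fin k)) (x : Conf d k), f (x ∘ π) = f x}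
  add_mem' hf hg π x := by simp [hf π x, hg π x]
  zero_mem' π x := by simp
  smul_mem' c f hf π x := by simp [hf π x]

/-- The bosonic tempered distributions `𝓢_s'(ℝ^{dk})`: the permutation invariant elements of the
strong dual of the Schwartz space, with the subspace topology. -/
def SymTempered (d k : ℕ) : Submodule ℂ (𝓢(Conf d k, ℂ) →L[ℂ] ℂ) where
  carrier := {u | ∀ (π : Equiv.Perm (Fin k)) (f : 𝓢(Conf d k, ℂ)), u (permSchwartz d π f) = u f}
  add_mem' hu hv π f := by simp [hu π f, hv π f]
  zero_mem' π f := by simp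
  smul_mem' c u hu π f := by simp [hu π f]

instance instContinuousConstSMulSymSchwartz (d k : ℕ) :
    ContinuousConstSMul ℝ (SymSchwartz d k) where
  continuous_const_smul r :=
    (continuous_const_smul (r : ℂ) : Continuous fun f : SymSchwartz d k => (r : ℂ) • f)

instance instIsTopologicalAddGroupSymSchwartz (d k : ℕ) :
    IsTopologicalAddGroup (SymSchwartz d k) :=
  inferInstanceAs (IsTopologicalAddGroup (SymSchwartz d k).toAddSubgroup)

instance instAddCommGroupSymTempered (d k : ℕ) : AddCommGroup (SymTempered d k) :=
  Submodule.addCommGroup _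

theorem measurePreserving_permConf (d : ℕ) {k : ℕ} (π : Equiv.Perm (Fin k)) :
    MeasurePreserving (fun x : Conf d k => x ∘ π) volume volume := by
  have h := (volume_measurePreserving_piCongrLeft
    (fun _ : Fin k => EuclideanSpace ℝ (Fin d)) π.symm)
  convert h using 1
  ext x i
  simp [MeasurableEquiv.piCongrLeft, Equiv.piCongrLeft, Equiv.piCongrLeft']

theorem integral_comp_perm (d : ℕ) {k : ℕ} (π : Equiv.Perm (Fin k)) (F : Conf d k → ℂ) :
    ∫ x, F (x ∘ π) = ∫ x, F x :=
  (measurePreserving_permConf d π).integral_comp'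
    (f := (permConf d π).toHomeomorph.toMeasurableEquiv) F

/-- The distribution `φ ↦ ∫ f φ` attached to a bosonic Schwartz function `f`; this is the
inclusion `𝓢_s ⊂ 𝓢_s'`. -/
def toTempered {d k : ℕ} (f : SymSchwartz d k) : SymTempered d k :=
  ⟨(SchwartzMap.integralCLM ℂ (volume : Measure (Conf d k))) ∘L
      (SchwartzMap.smulLeftCLM ℂ (fun x => f.1 x)), by
    intro π φ
    simp only [ContinuousLinearMap.comp_apply, SchwartzMap.integralCLM_apply,
      SchwartzMap.smulLeftCLM_apply_apply f.1.hasTemperateGrowth, permSchwartz_apply]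
    rw [← integral_comp_perm d π (fun x => f.1 x • φ x)]
    simp only [f.2 π]⟩

theorem toTempered_apply {d k : ℕ} (f : SymSchwartz d k) (φ : 𝓢(Conf d k, ℂ)) :
    (toTempered f).1 φ = ∫ x, f.1 x * φ x := by
  simp [toTempered, SchwartzMap.integralCLM_apply,
    SchwartzMap.smulLeftCLM_apply_apply f.1.hasTemperateGrowth]

/-- Evaluation at a point, as a continuous linear functional on the Schwartz space. -/
def evalAt {d k : ℕ} (x : Conf d k) : 𝓢(Conf d k, ℂ) →L[ℂ] ℂ :=
  (BoundedContinuousFunction.evalCLM ℂ x).comp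
    (SchwartzMap.toBoundedContinuousFunctionCLM ℂ (Conf d k) ℂ)

@[simp] theorem evalAt_apply {d k : ℕ} (x : Conf d k) (f : 𝓢(Conf d k, ℂ)) :
    evalAt x f = f x := rfl

/-- The symmetrized Dirac mass `(1/k!) ∑_π δ_{(x_{π(1)}, …, x_{π(k)})}`. -/
def symDelta {d k : ℕ} (x : Conf d k) : SymTempered d k :=
  ⟨(k.factorial : ℂ)⁻¹ • ∑ π : Equiv.Perm (Fin k), evalAt (x ∘ π), by
    intro σ f
    have h : ∑ π : Equiv.Perm (Fin k), f ((x ∘ π) ∘ σ) = ∑ π : Equiv.Perm (Fin k), f (x ∘ π) :=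
      Fintype.sum_equiv (Equiv.mulRight σ) _ _ (fun π => rfl)
    simp [h]⟩

/-- The `L²` inner product, linear in the second entry. -/
def ip {d k : ℕ} (f g : SymSchwartz d k) : ℂ :=
  ∫ x, (starRingEnd ℂ) (f.1 x) * g.1 x

/-! ### Observables and density matrices -/

theorem ip_integrable {d k : ℕ} (f g : SymSchwartz d k) :
    Integrable (fun x => (starRingEnd ℂ) (f.1 x) * g.1 x) := by
  obtain ⟨C, hC⟩ : ∃ C, ∀ x, ‖f.1 x‖ ≤ C :=
    ⟨_, fun x => f.1.norm_le_seminorm ℂ x⟩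
  refine (g.1.integrable (μ := volume)).bdd_mul (c := C) ?_ (Eventually.of_forall fun x => ?_)
  · exact (Complex.continuous_conj.comp f.1.continuous).aestronglyMeasurable
  · simpa using hC x

theorem ip_add_right {d k : ℕ} (f g h : SymSchwartz d k) : ip f (g + h) = ip f g + ip f h := by
  simp only [ip, ← integral_add (ip_integrable f g) (ip_integrable f h)]
  congr 1; ext x; simp [mul_add]

theorem ip_smul_right {d k : ℕ} (r : ℝ) (f g : SymSchwartz d k) : ip f (r • g) = r * ip f g := by
  simp only [ip, ← integral_const_mul]
  congr 1; ext x; simp; ring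

theorem ip_conj {d k : ℕ} (f g : SymSchwartz d k) : (starRingEnd ℂ) (ip f g) = ip g f := by
  simp only [ip, ← integral_conj]
  congr 1; ext x; simp [mul_comm]

theorem ip_add_left {d k : ℕ} (f g h : SymSchwartz d k) : ip (f + g) h = ip f h + ip g h := by
  rw [← ip_conj, ip_add_right, map_add, ip_conj, ip_conj]

theorem ip_smul_left {d k : ℕ} (r : ℝ) (f g : SymSchwartz d k) : ip (r • f) g = r * ip f g := by
  rw [← ip_conj, ip_smul_right, map_mul, ip_conj, Complex.conj_ofReal]

/-- The real vector space `𝔤_k` of `k`-body bosonic observables: the skew-adjoint continuous linear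
operators on the bosonic Schwartz space. (No topology on it is used.) -/
def Obs (d k : ℕ) : Submodule ℝ (SymSchwartz d k →L[ℂ] SymSchwartz d k) where
  carrier := {A | ∀ f g, ip f (A g) = -ip (A f) g}
  add_mem' {A B} hA hB f g := by
    have h1 := hA f g
    have h2 := hB f g
    simp only [add_apply, ip_add_left, ip_add_right, h1, h2]
    ring
  zero_mem' f g := by simp [ip]
  smul_mem' r A hA f g := by
    have h1 := hA f g
    simp only [smul_apply, ip_smul_left, ip_smul_right, h1]
    ring

/-- The real topological vector space `𝔤_k^*` of `k`-body density matrices: the self-adjoint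
elements of `𝓛(𝓢_s', 𝓢_s)`, with the subspace topology of the topology of bounded convergence. -/
def DM (d k : ℕ) : Submodule ℝ (SymTempered d k →L[ℂ] SymSchwartz d k) where
  carrier := {γ | ∀ f g, ip f (γ (toTempered g)) = ip (γ (toTempered f)) g}
  add_mem' {A B} hA hB f g := by
    have h1 := hA f g
    have h2 := hB f g
    simp only [add_apply, ip_add_left, ip_add_right, h1, h2]
  zero_mem' f g := by simp [ip]
  smul_mem' r A hA f g := by
    have h1 := hA f g
    simp only [smul_apply, ip_smul_left, ip_smul_right, h1]

/-- The Lie bracket `[A, B]_{𝔤_k} = k (AB - BA)`. -/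
def obsBracket {d k : ℕ} (A B : Obs d k) : Obs d k :=
  ⟨(k : ℝ) • (A.1 ∘L B.1 - B.1 ∘L A.1), by
    refine Submodule.smul_mem _ _ fun f g => ?_
    have hs : ∀ a b c : SymSchwartz d k, ip a (b - c) = ip a b - ip a c := fun a b c => by
      have := ip_add_right a (b - c) c
      rw [sub_add_cancel] at this
      rw [this, add_sub_cancel_right]
    have hs' : ∀ a b c : SymSchwartz d k, ip (a - b) c = ip a c - ip b c := fun a b c => by
      have := ip_add_left (a - b) b c
      rw [sub_add_cancel] at this
      rw [this, add_sub_cancel_right]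
    have hA := fun f g => A.2 f g
    have hB := fun f g => B.2 f g
    simp only [sub_apply, ContinuousLinearMap.comp_apply, hs, hs']
    rw [hA, hB, hB, hA]
    ring⟩

/-- The Schwartz kernel `γ(x; x')` of `γ ∈ 𝓛(𝓢_s', 𝓢_s)`. -/
def kernel {d k : ℕ} (γ : SymTempered d k →L[ℂ] SymSchwartz d k) (x x' : Conf d k) : ℂ :=
  (γ (symDelta x')).1 x

/-- The operator `γ` has the integral kernel `K`: each `K(x; ·)` is a Schwartz function, and
`(γ u)(x) = ⟨u, K(x; ·)⟩` for every bosonic tempered distribution `u`. -/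
def HasKernel {d k : ℕ} (γ : SymTempered d k →L[ℂ] SymSchwartz d k)
    (K : Conf d k → Conf d k → ℂ) : Prop :=
  ∀ x, ∃ κ : 𝓢(Conf d k, ℂ), (∀ x', κ x' = K x x') ∧
    ∀ u : SymTempered d k, (γ u).1 x = u.1 κ

/-- The trace of an operator in `𝓛(𝓢_s', 𝓢_s)`: the integral of its Schwartz kernel over the
diagonal. -/
def trace {d k : ℕ} (T : SymTempered d k →L[ℂ] SymSchwartz d k) : ℂ :=
  ∫ x, kernel T x x

/-- The pairing `⟨A, Ψ⟩ = i Tr(A Ψ)` of `𝔤_k` with `𝔤_k^*`. (This number is real, as `A` is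
skew-adjoint and `Ψ` is self-adjoint.) -/
def obsPairing {d k : ℕ} (A : Obs d k) (Ψ : DM d k) : ℝ :=
  (Complex.I * trace (A.1 ∘L Ψ.1)).re

/-- The Lie-Poisson structure of the `N`-body density matrices `𝔤_N^*`. -/
def dmPoisson (d N : ℕ) : PoissonData (DM d N) :=
  liePoisson obsPairing obsBracket

/-! ### Hierarchies -/

/-- The configuration `x` with the particles `j(1), …, j(k)` moved to `z₁, …, z_k`. -/
def moveTo {d k N : ℕ} (j : Fin k ↪ Fin N) (x : Conf d N) (z : Conf d k) : Conf d N :=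
  Function.extend j z x

theorem moveTo_self {d k N : ℕ} (j : Fin k ↪ Fin N) (x : Conf d N) (z : Conf d k) (a : Fin k) :
    moveTo j x z (j a) = z a := j.injective.extend_apply _ _ _

theorem moveTo_of_not {d k N : ℕ} (j : Fin k ↪ Fin N) (x : Conf d N) (z : Conf d k) (i : Fin N)
    (h : ¬ ∃ a, j a = i) : moveTo j x z i = x i := Function.extend_apply' _ _ _ h

theorem moveTo_hasTemperateGrowth {d k N : ℕ} (j : Fin k ↪ Fin N) (x : Conf d N) :
    (moveTo j x).HasTemperateGrowth := by
  classical
  let L : Conf d k →L[ℝ] Conf d N := ContinuousLinearMap.pi fun i =>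
    if h : ∃ a, j a = i then ContinuousLinearMap.proj h.choose else 0
  have : moveTo j x = (fun z => L z) + fun _ => moveTo j x 0 := by
    funext z i
    by_cases h : ∃ a, j a = i
    · have h' := h
      obtain ⟨a, rfl⟩ := h'
      have hc : h.choose = a := j.injective h.choose_spec
      simp only [Pi.add_apply, moveTo_self, L, ContinuousLinearMap.coe_pi', dif_pos h, hc]
      simp
    · simp [moveTo_of_not j x _ i h, L, dif_neg h]
  rw [this]
  exact (ContinuousLinearMap.hasTemperateGrowth L).add (Function.HasTemperateGrowth.const _)

theorem moveTo_antilipschitz {d k N : ℕ} (j : Fin k ↪ Fin N) (x : Conf d N) :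
    AntilipschitzWith 1 (moveTo j x) := by
  refine AntilipschitzWith.of_le_mul_dist fun z w => ?_
  rw [NNReal.coe_one, one_mul]
  refine (dist_pi_le_iff dist_nonneg).2 fun a => ?_
  have := dist_le_pi_dist (moveTo j x z) (moveTo j x w) (j a)
  rwa [moveTo_self, moveTo_self] at this

/-- The restriction `z ↦ f(x with the particles j(1), …, j(k) moved to z)` of a bosonic Schwartz
function of `N` particles, a bosonic Schwartz function of `k` particles. -/
def slice {d k N : ℕ} (j : Fin k ↪ Fin N) (x : Conf d N) (f : SymSchwartz d N) :
    SymSchwartz d k :=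
  ⟨SchwartzMap.compCLMOfAntilipschitz ℂ (moveTo_hasTemperateGrowth j x)
      (moveTo_antilipschitz j x) f.1, by
    intro π z
    have key : moveTo j x (z ∘ π) = moveTo j x z ∘ (π.viaFintypeEmbedding j) := by
      funext i
      by_cases h : ∃ a, j a = i
      · obtain ⟨a, rfl⟩ := h
        rw [Function.comp_apply, Equiv.Perm.viaFintypeEmbedding_apply_image, moveTo_self,
          moveTo_self, Function.comp_apply]
      · rw [Function.comp_apply, Equiv.Perm.viaFintypeEmbedding_apply_notMem_range _ _ h,
          moveTo_of_not j x _ i h, moveTo_of_not j x _ i h]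
    change f.1 (moveTo j x (z ∘ π)) = f.1 (moveTo j x z)
    rw [key, f.2]⟩

@[simp] theorem slice_apply {d k N : ℕ} (j : Fin k ↪ Fin N) (x : Conf d N) (f : SymSchwartz d N)
    (z : Conf d k) : (slice j x f).1 z = f.1 (moveTo j x z) := rfl

/-- `T = C_{k,N} ∑_{(j₁, …, j_k)} A_{(j₁, …, j_k)}` on `𝓢_s(ℝ^{dN})`, where `(j₁, …, j_k)` runs over
the tuples of distinct elements of `{1, …, N}`, the operator `A_{(j₁, …, j_k)}` is `A` acting on the
variables `x_{j₁}, …, x_{j_k}` only, and `C_{k,N} = 1/(N (N-1) ⋯ (N-k+1))`. -/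
def IsEmbedded {d k N : ℕ} (A : Obs d k) (T : Obs d N) : Prop :=
  ∀ (f : SymSchwartz d N) (x : Conf d N),
    (T.1 f).1 x = ((N.descFactorial k : ℕ) : ℂ)⁻¹ *
      ∑ j : Fin k ↪ Fin N, (A.1 (slice j x f)).1 (fun a => x (j a))

open Classical in
/-- The embedding `ε_{k,N} : 𝔤_k → 𝔤_N` for `1 ≤ k ≤ N`: the operator `ε_{k,N}(A)` is the unique
`T ∈ 𝔤_N` with `IsEmbedded A T` (the value `0` is irrelevant). -/
def embed {d k : ℕ} (N : ℕ) (A : Obs d k) : Obs d N :=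
  if h : ∃ T, IsEmbedded A T then h.choose else 0

/-- The space `𝔊_N = ⨁_{k=1}^N 𝔤_k` of observable `N`-hierarchies; the component with index
`k : Fin N` belongs to `k + 1` particles. -/
abbrev ObsHier (d N : ℕ) : Type := (k : Fin N) → Obs d (k.val + 1)

/-- The space `𝔊_N^*` of density matrix `N`-hierarchies, with the product topology; the component
with index `k : Fin N` belongs to `k + 1` particles. -/
abbrev DMHier (d N : ℕ) : Type := (k : Fin N) → DM d (k.val + 1)

/-- The Lie bracket of `𝔊_N`: with `ℓ = p.1 + 1` and `j = p.2 + 1`, the `k`-particle component is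
`∑_{min(ℓ + j - 1, N) = k} ε_{k,N}⁻¹ [ε_{ℓ,N}(A^{(ℓ)}), ε_{j,N}(B^{(j)})]_{𝔤_N}`. -/
def hierBracket {d N : ℕ} (A B : ObsHier d N) : ObsHier d N := fun k =>
  ∑ p : Fin N × Fin N with min ((p.1.val + 1) + (p.2.val + 1) - 1) N = k.val + 1,
    Function.invFun (embed (d := d) (k := k.val + 1) N)
      (obsBracket (embed N (A p.1)) (embed N (B p.2)))

/-- The pairing `i Tr(A · Γ) = ∑_k i Tr_{1,…,k}(A^{(k)} γ^{(k)})` of `𝔊_N` with `𝔊_N^*`. -/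
def hierPairing {d N : ℕ} (A : ObsHier d N) (Γ : DMHier d N) : ℝ :=
  ∑ k, obsPairing (A k) (Γ k)

/-- The Lie-Poisson structure of the density matrix `N`-hierarchies `𝔊_N^*`. -/
def hierPoisson (d N : ℕ) : PoissonData (DMHier d N) :=
  liePoisson hierPairing hierBracket

/-- The map `ι_{ε,N} : 𝔊_N → 𝔤_N`, `A ↦ ∑_k ε_{k,N}(A^{(k)})`. -/
def sumEmbed {d N : ℕ} (A : ObsHier d N) : Obs d N := ∑ k, embed N (A k)

/-! ### Reduced density matrices -/

/-- The configuration `(x₁, …, x_k, y₁, …, y_{N-k})`. -/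
def glue {d k N : ℕ} (x : Conf d k) (y : Conf d (N - k)) : Conf d N := fun i =>
  if h : i.val < k then x ⟨i.val, h⟩ else y ⟨i.val - k, by omega⟩

/-- The kernel `∫ Ψ(x, y; x', y) dy` of the partial trace `Tr_{k+1,…,N} Ψ`. -/
def partialTraceKernel {d N : ℕ} (k : ℕ) (Ψ : SymTempered d N →L[ℂ] SymSchwartz d N)
    (x x' : Conf d k) : ℂ :=
  ∫ y : Conf d (N - k), kernel Ψ (glue x y) (glue x' y)

/-- `ι` is the reduced density matrix map `Ψ ↦ (Tr_{k+1,…,N} Ψ)_{1 ≤ k ≤ N}`. -/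
def IsRDMMap {d N : ℕ} (ι : DM d N → DMHier d N) : Prop :=
  ∀ (Ψ : DM d N) (k : Fin N), HasKernel (ι Ψ k).1 (partialTraceKernel (k.val + 1) Ψ.1)

end

end BosonicRDM

open BosonicRDM

namespace BosonicRDM

noncomputable section

set_option linter.unusedSectionVars false

/-! ### Schwartz functions from families closed under directional derivatives -/

section Families

variable {E ι X : Type*} [NormedAddCommGroup E] [NormedSpace ℝ E]

/-! The reduced density matrix map is linear and is the transpose of `sumEmbed`, and the transpose
of a Lie algebra morphism is a Poisson map between Lie-Poisson structures: if ι is linear with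
adjoint ε, the derivative of F ∘ ι at m is ε applied to the derivative of F at ι(m), so the brackets
match as soon as ε preserves brackets (`isPoissonMap_of_dual`). Derivatives are identified with
elements of 𝔤_N without ambiguity because the pairing separates observables, which rank one density
matrices and polarization show (`obsPairing_injective`).

Duality (`trace_embed_comp`): in Tr(ε_{k,N}(A)Ψ) bosonic symmetry makes every tuple contribute as
much as the first k particles, which cancels the normalization. An operator on the first k particles
commutes with the integral over the others; this is checked weakly, by skew-adjointness and Fubini
(`slice_ptrace_lift`).

Morphism property (`sumEmbed_hierBracket`): a commutator of embedded observables is a sum of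
commutators over pairs of tuples. Disjoint tuples commute (`lift_commute`). Overlapping tuples of
lengths l and m occupy at most k = min(l+m-1, N) particles, so double counting turns the sum into an
average over k-tuples of a single k-particle operator (`exists_embed_eq_obsBracket`). Hence
ε_{k,N}⁻¹ is only applied on the range of ε_{k,N}, and summing the components restores the full
commutator.

Existence and continuity: the Schwartz kernel depends continuously on the operator (`kernelCLM`),
the partial trace is continuous on kernels (`ptrace`), and the operator depends continuously on its
kernel (`ofKernelCLM`). Self-adjointness passes through hermitian kernels (`kernel_conj`,
`HasKernel.mem_DM`), and a kernel determines its operator (`HasKernel.unique`).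

The Schwartz estimates rest on one device: if a class of functions is closed under derivatives along
a basis and its members decay rapidly, they are Schwartz functions, and smallness of weighted sup
norms throughout the class gives convergence in the Schwartz topology (`IsSchwartzFamily`). It
produces both the kernels and the operators acting on some of the variables only (`ampl`). -/

theorem hasDerivAt_line {g g' : E → ℂ} {v : E}
    (h : ∀ x, HasDerivAt (fun t : ℝ => g (x + t • v)) (g' x) 0) (x : E) (s : ℝ) :
    HasDerivAt (fun t : ℝ => g (x + t • v)) (g' (x + s • v)) s := by
  have h1 := h (x + s • v)
  have h3 : HasDerivAt (fun t : ℝ => g (x + s • v + t • v)) (g' (x + s • v)) (s - s) := by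
    simpa using h1
  have h4 := HasDerivAt.comp_sub_const s s h3
  refine h4.congr_of_eventuallyEq (Eventually.of_forall fun t => ?_)
  simp only [sub_smul]
  congr 1
  abel

theorem norm_line_sub_le {g g' : E → ℂ} {v : E}
    (h : ∀ x, HasDerivAt (fun t : ℝ => g (x + t • v)) (g' x) 0) {C : ℝ} (x : E) (t : ℝ)
    (hC : ∀ s : ℝ, |s| ≤ |t| → ‖g' (x + s • v)‖ ≤ C) :
    ‖g (x + t • v) - g x‖ ≤ C * |t| := by
  have := (convex_uIcc (0 : ℝ) t).norm_image_sub_le_of_norm_hasDerivWithin_le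
    (f := fun t : ℝ => g (x + t • v)) (f' := fun s => g' (x + s • v)) (C := C)
    (fun s _ => (hasDerivAt_line h x s).hasDerivWithinAt)
    (fun s hs => hC s (by simpa using Set.abs_sub_left_of_mem_uIcc hs))
    Set.left_mem_uIcc Set.right_mem_uIcc
  simpa using this

/-- The mean value inequality for g(x + tv) - t g'(x), whose derivative is itself at most C|t|. The
factor 1/2 of Taylor's formula is lost, which is harmless. -/
theorem norm_line_taylor_le {g g' g'' : E → ℂ} {v : E}
    (h : ∀ x, HasDerivAt (fun t : ℝ => g (x + t • v)) (g' x) 0)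
    (h' : ∀ x, HasDerivAt (fun t : ℝ => g' (x + t • v)) (g'' x) 0) {C : ℝ} (x : E) (t : ℝ)
    (hC : ∀ s : ℝ, |s| ≤ |t| → ‖g'' (x + s • v)‖ ≤ C) :
    ‖g (x + t • v) - g x - (t : ℂ) * g' x‖ ≤ C * |t| ^ 2 := by
  have hC0 : 0 ≤ C := (norm_nonneg _).trans (hC 0 (by simp))
  have := (convex_uIcc (0 : ℝ) t).norm_image_sub_le_of_norm_hasDerivWithin_le
    (f := fun t : ℝ => g (x + t • v) - t * g' x)
    (f' := fun s => g' (x + s • v) - g' x) (C := C * |t|)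
    (fun s _ => by
      have h1 : HasDerivAt (fun t : ℝ => (t : ℂ) * g' x) (g' x) s := by
        simpa using (Complex.ofRealCLM.hasDerivAt (x := s)).mul_const (g' x)
      exact ((hasDerivAt_line h x s).sub h1).hasDerivWithinAt)
    (fun s hs => by
      have hs' : |s| ≤ |t| := by simpa using Set.abs_sub_left_of_mem_uIcc hs
      refine (norm_line_sub_le h' x s fun r hr => hC r (hr.trans hs')).trans ?_
      gcongr)
    Set.left_mem_uIcc Set.right_mem_uIcc
  have h2 : C * |t| * ‖t - 0‖ = C * |t| ^ 2 := by rw [sub_zero, Real.norm_eq_abs]; ring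
  rw [h2] at this
  refine le_trans (le_of_eq ?_) this
  congr 1
  simp
  ring

/-- A set of parametrized functions that is closed under the derivatives in the directions of a
basis, and whose members decay faster than every polynomial. -/
structure IsSchwartzFamily (b : Module.Basis ι ℝ E) (P : Set (X → E → ℂ)) : Prop where
  deriv : ∀ G ∈ P, ∀ i, ∃ G' ∈ P, ∀ p x,
    HasDerivAt (fun t : ℝ => G p (x + t • b i)) (G' p x) 0
  decay : ∀ G ∈ P, ∀ p, ∀ k : ℕ, ∃ C, ∀ x, ‖x‖ ^ k * ‖G p x‖ ≤ C

namespace IsSchwartzFamily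

variable [Fintype ι] {b : Module.Basis ι ℝ E} {P : Set (X → E → ℂ)}

/-- Decay with exponent 0 bounds the partial derivatives, and the basis directions are added one at
a time. -/
theorem norm_sub_le (hP : IsSchwartzFamily b P) {G : X → E → ℂ} (hG : G ∈ P) (p : X) :
    ∃ C, 0 ≤ C ∧ ∀ x (c : ι → ℝ) (s : Finset ι),
      ‖G p (x + ∑ i ∈ s, c i • b i) - G p x‖ ≤ C * ∑ i ∈ s, |c i| := by
  classical
  choose G' hG' hd using hP.deriv G hG
  have hb : ∀ i, ∃ C, ∀ x, ‖G' i p x‖ ≤ C := fun i => by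
    simpa using hP.decay _ (hG' i) p 0
  choose C hC using hb
  have hC0 : ∀ i, 0 ≤ C i := fun i => (norm_nonneg _).trans (hC i 0)
  refine ⟨∑ i, C i, Finset.sum_nonneg fun i _ => hC0 i, fun x c s => ?_⟩
  induction s using Finset.induction_on with
  | empty => simp
  | insert j s hj ih =>
    rw [Finset.sum_insert hj, Finset.sum_insert hj, add_comm (c j • b j), ← add_assoc]
    have h1 := norm_line_sub_le (g := G p) (g' := G' j p) (fun x => hd j p x) (C := ∑ i, C i)
      (x + ∑ i ∈ s, c i • b i) (c j)
      (fun r _ => (hC j _).trans (Finset.single_le_sum (fun i _ => hC0 i) (Finset.mem_univ j)))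
    calc _ ≤ _ := norm_sub_le_norm_sub_add_norm_sub _ (G p (x + ∑ i ∈ s, c i • b i)) _
      _ ≤ _ := add_le_add h1 ih
      _ = _ := by ring

/-- Adding one basis direction splits the error into the Taylor remainder on a line, the change of a
partial derivative between two base points (`norm_sub_le`), and the error already accumulated. -/
theorem norm_taylor_le (hP : IsSchwartzFamily b P) {G : X → E → ℂ} {G' : ι → X → E → ℂ}
    (hG' : ∀ i, G' i ∈ P)
    (hd : ∀ i p x, HasDerivAt (fun t : ℝ => G p (x + t • b i)) (G' i p x) 0) (p : X) :
    ∃ C, 0 ≤ C ∧ ∀ x (c : ι → ℝ) (s : Finset ι),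
      ‖G p (x + ∑ i ∈ s, c i • b i) - G p x - ∑ i ∈ s, (c i : ℂ) * G' i p x‖
        ≤ C * (∑ i ∈ s, |c i|) ^ 2 := by
  classical
  choose G'' hG'' hd' using fun i => hP.deriv (G' i) (hG' i) i
  have hb : ∀ i, ∃ C, ∀ x, ‖G'' i p x‖ ≤ C := fun i => by
    simpa using hP.decay _ (hG'' i) p 0
  choose C hC using hb
  have hC0 : ∀ i, 0 ≤ C i := fun i => (norm_nonneg _).trans (hC i 0)
  choose D hD0 hD using fun i => hP.norm_sub_le (hG' i) p
  have hsum : ∀ i, C i ≤ ∑ i, C i + ∑ i, D i := fun i =>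
    (Finset.single_le_sum (fun i _ => hC0 i) (Finset.mem_univ i)).trans
      (le_add_of_nonneg_right (Finset.sum_nonneg fun i _ => hD0 i))
  have hsum' : ∀ i, D i ≤ ∑ i, C i + ∑ i, D i := fun i =>
    (Finset.single_le_sum (fun i _ => hD0 i) (Finset.mem_univ i)).trans
      (le_add_of_nonneg_left (Finset.sum_nonneg fun i _ => hC0 i))
  set M := ∑ i, C i + ∑ i, D i
  have hM : 0 ≤ M := add_nonneg (Finset.sum_nonneg fun i _ => hC0 i)
    (Finset.sum_nonneg fun i _ => hD0 i)
  refine ⟨M, hM, fun x c s => ?_⟩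
  induction s using Finset.induction_on with
  | empty => simp
  | insert j s hj ih =>
    rw [Finset.sum_insert hj, Finset.sum_insert hj, Finset.sum_insert hj, add_comm (c j • b j),
      ← add_assoc]
    set z := x + ∑ i ∈ s, c i • b i
    set S := ∑ i ∈ s, |c i|
    have hS : 0 ≤ S := Finset.sum_nonneg fun i _ => abs_nonneg _
    have h1 := norm_line_taylor_le (g := G p) (g' := G' j p) (g'' := G'' j p)
      (fun x => hd j p x) (fun x => hd' j p x) (C := M) z (c j)
      (fun r _ => (hC j _).trans (hsum j))
    have h2 : ‖(c j : ℂ) * (G' j p z - G' j p x)‖ ≤ |c j| * (M * S) := by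
      rw [norm_mul, Complex.norm_real, Real.norm_eq_abs]
      gcongr
      exact (hD j x c s).trans (by gcongr; exact hsum' j)
    have h3 : G p (z + c j • b j) - G p x - ((c j : ℂ) * G' j p x + ∑ i ∈ s, (c i : ℂ) * G' i p x)
        = (G p (z + c j • b j) - G p z - (c j : ℂ) * G' j p z)
          + (c j : ℂ) * (G' j p z - G' j p x)
          + (G p z - G p x - ∑ i ∈ s, (c i : ℂ) * G' i p x) := by ring
    rw [h3]
    refine (norm_add₃_le).trans ((add_le_add (add_le_add h1 h2) ih).trans ?_)
    -- The three bounds add up to M(|c j|² + |c j| S + S²), at most M(|c j| + S)².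
    have : 0 ≤ M * (|c j| * S) := by positivity
    nlinarith [this]

variable [FiniteDimensional ℝ E]

/-- The coordinates with respect to a basis, as continuous functionals. -/
def coordCLM (b : Module.Basis ι ℝ E) (i : ι) : E →L[ℝ] ℝ := (b.coord i).toContinuousLinearMap

/-- Only derivatives along basis vectors are assumed; the quadratic remainder upgrades them to a
Fréchet derivative. -/
theorem hasFDerivAt (hP : IsSchwartzFamily b P) {G : X → E → ℂ} {G' : ι → X → E → ℂ}
    (hG' : ∀ i, G' i ∈ P)
    (hd : ∀ i p x, HasDerivAt (fun t : ℝ => G p (x + t • b i)) (G' i p x) 0) (p : X) (x : E) :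
    HasFDerivAt (G p) (∑ i, (coordCLM b i).smulRight (G' i p x)) x := by
  obtain ⟨C, hC0, hC⟩ := hP.norm_taylor_le hG' hd p
  set M := ∑ i, ‖coordCLM b i‖
  have hM : 0 ≤ M := Finset.sum_nonneg fun i _ => norm_nonneg _
  refine .of_isLittleO ?_
  have key : ∀ y, ‖G p y - G p x - (∑ i, (coordCLM b i).smulRight (G' i p x)) (y - x)‖
      ≤ C * M ^ 2 * ‖‖y - x‖ ^ 2‖ := fun y => by
    have h1 := hC x (fun i => coordCLM b i (y - x)) Finset.univ
    have h2 : ∑ i, coordCLM b i (y - x) • b i = y - x := b.sum_repr (y - x)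
    rw [h2, add_sub_cancel] at h1
    have h3 : (∑ i, (coordCLM b i).smulRight (G' i p x)) (y - x)
        = ∑ i, (coordCLM b i (y - x) : ℂ) * G' i p x := by
      simp
    rw [h3]
    refine h1.trans ?_
    have h4 : ∑ i, |coordCLM b i (y - x)| ≤ M * ‖y - x‖ := by
      rw [Finset.sum_mul]
      exact Finset.sum_le_sum fun i _ => (coordCLM b i).le_opNorm _
    have h5 : 0 ≤ ∑ i, |coordCLM b i (y - x)| := Finset.sum_nonneg fun i _ => abs_nonneg _
    calc C * (∑ i, |coordCLM b i (y - x)|) ^ 2 ≤ C * (M * ‖y - x‖) ^ 2 := by gcongr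
      _ = _ := by rw [norm_pow, norm_norm]; ring
  refine (Asymptotics.isBigO_of_le' (l := 𝓝 x) (c := C * M ^ 2)
    (g := fun y => ‖y - x‖ ^ 2) (fun y => key y)).trans_isLittleO ?_
  exact (Asymptotics.isLittleO_pow_sub_sub x one_lt_two)

theorem contDiff (hP : IsSchwartzFamily b P) (n : ℕ) : ∀ {G : X → E → ℂ}, G ∈ P → ∀ p,
    ContDiff ℝ n (G p) := by
  induction n with
  | zero =>
    intro G hG p
    choose G' hG' hd using hP.deriv G hG
    exact contDiff_zero.2 (continuous_iff_continuousAt.2 fun x =>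
      (hP.hasFDerivAt hG' hd p x).continuousAt)
  | succ n ih =>
    intro G hG p
    choose G' hG' hd using hP.deriv G hG
    refine (contDiff_succ_iff_hasFDerivAt (n := n)).2
      ⟨_, ?_, fun x => hP.hasFDerivAt hG' hd p x⟩
    refine ContDiff.sum fun i _ => ?_
    exact ((ContinuousLinearMap.smulRightL ℝ E ℂ (coordCLM b i)).contDiff).comp (ih (hG' i) p)

/-- Each differentiation replaces a member by finitely many others. The finite set and the constant
do not depend on the parameter p, so estimates uniform in p pass from the members to all
derivatives. -/
theorem norm_iteratedFDeriv_le (hP : IsSchwartzFamily b P) (n : ℕ) :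
    ∀ {G : X → E → ℂ}, G ∈ P → ∃ s : Finset (X → E → ℂ), (↑s ⊆ P) ∧ ∃ c, 0 ≤ c ∧ ∀ p x,
      ‖iteratedFDeriv ℝ n (G p) x‖ ≤ c * ∑ H ∈ s, ‖H p x‖ := by
  classical
  induction n with
  | zero =>
    intro G hG
    exact ⟨{G}, by simpa using hG, 1, zero_le_one, fun p x => by simp⟩
  | succ n ih =>
    intro G hG
    choose G' hG' hd using hP.deriv G hG
    choose s hs c hc h using fun i => ih (hG' i)
    refine ⟨Finset.univ.biUnion s, by simpa using hs, ∑ i, ‖coordCLM b i‖ * c i,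
      Finset.sum_nonneg fun i _ => mul_nonneg (norm_nonneg _) (hc i), fun p x => ?_⟩
    have h1 : fderiv ℝ (G p) = fun x => ∑ i, (coordCLM b i).smulRight (G' i p x) :=
      funext fun x => (hP.hasFDerivAt hG' hd p x).fderiv
    rw [← norm_iteratedFDeriv_fderiv, h1, Finset.sum_mul]
    have hcd : ∀ i, ContDiff ℝ n (fun x => (coordCLM b i).smulRight (G' i p x)) := fun i =>
      ((ContinuousLinearMap.smulRightL ℝ E ℂ (coordCLM b i)).contDiff).comp
        (hP.contDiff n (hG' i) p)
    rw [iteratedFDeriv_fun_sum_apply (fun i _ => (hcd i).contDiffAt)]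
    refine norm_sum_le_of_le _ fun i _ => ?_
    have h2 := (ContinuousLinearMap.smulRightL ℝ E ℂ (coordCLM b i)).norm_iteratedFDeriv_comp_left
      (f := G' i p) (x := x) (hP.contDiff n (hG' i) p).contDiffAt le_rfl
    have h3 : ‖ContinuousLinearMap.smulRightL ℝ E ℂ (coordCLM b i)‖ ≤ ‖coordCLM b i‖ :=
      ContinuousLinearMap.opNorm_le_bound _ (norm_nonneg _) fun z => by
        simp [ContinuousLinearMap.norm_smulRight_apply]
    calc _ ≤ _ := h2
      _ ≤ ‖coordCLM b i‖ * (c i * ∑ H ∈ s i, ‖H p x‖) := by gcongr; exact h i p x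
      _ ≤ ‖coordCLM b i‖ * (c i * ∑ H ∈ Finset.univ.biUnion s, ‖H p x‖) := by
        gcongr
        · exact hc i
        · exact Finset.subset_biUnion_of_mem s (Finset.mem_univ i)
      _ = _ := by ring

theorem decay_iteratedFDeriv (hP : IsSchwartzFamily b P) {G : X → E → ℂ} (hG : G ∈ P) (p : X)
    (k n : ℕ) : ∃ C, ∀ x, ‖x‖ ^ k * ‖iteratedFDeriv ℝ n (G p) x‖ ≤ C := by
  obtain ⟨s, hs, c, hc, h⟩ := hP.norm_iteratedFDeriv_le n hG
  have h1 : ∀ H : s, ∃ C, ∀ x, ‖x‖ ^ k * ‖H.1 p x‖ ≤ C := fun H => hP.decay _ (hs H.2) p k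
  choose C hC using h1
  refine ⟨c * ∑ H : s, C H, fun x => ?_⟩
  calc _ ≤ ‖x‖ ^ k * (c * ∑ H ∈ s, ‖H p x‖) := by gcongr; exact h p x
    _ = c * ∑ H : s, ‖x‖ ^ k * ‖H.1 p x‖ := by
      rw [← Finset.sum_coe_sort s, ← Finset.mul_sum]; ring
    _ ≤ _ := by gcongr with H; exact hC H x

/-- The members of a Schwartz family, as Schwartz functions. -/
def toSchwartz (hP : IsSchwartzFamily b P) {G : X → E → ℂ} (hG : G ∈ P) (p : X) : 𝓢(E, ℂ) where
  toFun := G p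
  smooth' := contDiff_infty.2 fun n => hP.contDiff n hG p
  decay' k n := hP.decay_iteratedFDeriv hG p k n

@[simp] theorem toSchwartz_apply (hP : IsSchwartzFamily b P) {G : X → E → ℂ} (hG : G ∈ P) (p : X)
    (x : E) : hP.toSchwartz hG p x = G p x := rfl

theorem tendsto_toSchwartz (hP : IsSchwartzFamily b P) {G : X → E → ℂ} (hG : G ∈ P) {l : Filter X}
    (hl : ∀ H ∈ P, ∀ k : ℕ, ∀ ε > 0, ∀ᶠ p in l, ∀ x, ‖x‖ ^ k * ‖H p x‖ ≤ ε) :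
    Tendsto (fun p => hP.toSchwartz hG p) l (𝓝 0) := by
  rw [(schwartz_withSeminorms ℝ E ℂ).tendsto_nhds _ _]
  rintro ⟨k, n⟩ ε hε
  obtain ⟨s, hs, c, hc, h⟩ := hP.norm_iteratedFDeriv_le n hG
  -- The factor 2 makes the final inequality strict, and the summand 1 keeps the denominator
  -- positive.
  set δ := ε / (2 * (c * s.card + 1))
  have hδ : 0 < δ := by positivity
  have h1 : ∀ᶠ p in l, ∀ H ∈ s, ∀ x, ‖x‖ ^ k * ‖H p x‖ ≤ δ :=
    (Finset.eventually_all s).2 fun H hH => hl H (hs hH) k δ hδ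
  filter_upwards [h1] with p hp
  rw [sub_zero]
  refine lt_of_le_of_lt (SchwartzMap.seminorm_le_bound ℝ k n _ (M := ε / 2) (by positivity)
    fun x => ?_) (by linarith)
  calc _ ≤ ‖x‖ ^ k * (c * ∑ H ∈ s, ‖H p x‖) := by gcongr; exact h p x
    _ = c * ∑ H ∈ s, ‖x‖ ^ k * ‖H p x‖ := by rw [← Finset.mul_sum]; ring
    _ ≤ c * ∑ H ∈ s, δ := by gcongr with H hH; exact hp H hH x
    _ = c * s.card * δ := by simp; ring
    _ ≤ (c * s.card + 1) * δ := by gcongr; linarith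
    _ = ε / 2 := by simp only [δ]; field_simp

end IsSchwartzFamily

end Families

/-! ### Translations, derivatives and slices of Schwartz functions -/

section Translations

variable {E F F' : Type*} [NormedAddCommGroup E] [NormedSpace ℝ E]
  [NormedAddCommGroup F] [NormedSpace ℝ F] [NormedAddCommGroup F'] [NormedSpace ℝ F']

/-- The directional derivative on the Schwartz space. -/
def dir (v : E) : 𝓢(E, ℂ) →L[ℂ] 𝓢(E, ℂ) := LineDeriv.lineDerivOpCLM ℂ 𝓢(E, ℂ) v

theorem dir_apply (v : E) (f : 𝓢(E, ℂ)) (x : E) : dir v f x = fderiv ℝ f x v :=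
  SchwartzMap.lineDerivOp_apply_eq_fderiv v f x

theorem hasDerivAt_dir (v : E) (f : 𝓢(E, ℂ)) (x : E) :
    HasDerivAt (fun t : ℝ => f (x + t • v)) (dir v f x) 0 := by
  have h : HasLineDerivAt ℝ f (fderiv ℝ f x v) x v :=
    (SchwartzMap.hasFDerivAt f x).hasLineDerivAt v
  rw [dir_apply]
  exact h

theorem dir_comm (v w : E) (f : 𝓢(E, ℂ)) : dir v (dir w f) = dir w (dir v f) := by
  ext x
  have hd : DifferentiableAt ℝ (fderiv ℝ f) x :=
    ((f.smooth 2).fderiv_right (m := 1) (by norm_num)).differentiable (by norm_num) x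
  have h : ∀ v w : E, dir v (dir w f) x = fderiv ℝ (fderiv ℝ f) x v w := fun v w => by
    have : (dir w f : E → ℂ) = fun y => fderiv ℝ f y w := funext fun y => dir_apply w f y
    rw [dir_apply, this, fderiv_clm_apply hd (differentiableAt_const w)]
    simp
  rw [h, h]
  exact ((f.smooth 2).contDiffAt.isSymmSndFDerivAt (by simp)) v w

/-- The translation `f ↦ f(· + v)`. -/
def translate (v : E) : 𝓢(E, ℂ) →L[ℂ] 𝓢(E, ℂ) := SchwartzMap.compSubConstCLM ℂ (-v)

@[simp] theorem translate_apply (v : E) (f : 𝓢(E, ℂ)) (x : E) : translate v f x = f (x + v) := by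
  simp [translate, SchwartzMap.compSubConstCLM_apply]

/-- The remainder involves the second derivative on the segment from x to x + tv. There ‖x‖ ≤ (1 +
‖v‖)(1 + ‖x + sv‖), so the weight can be moved to the point of evaluation; 2^k comes from comparing
(1 + ‖·‖)^k with the seminorms. -/
theorem norm_difference_quotient_le (g : 𝓢(E, ℂ)) (v : E) (k : ℕ) (x : E) {t : ℝ} (ht : |t| ≤ 1)
    (ht0 : t ≠ 0) :
    ‖x‖ ^ k * ‖t⁻¹ • (g (x + t • v) - g x) - dir v g x‖ ≤
      |t| * ((1 + ‖v‖) ^ k * (2 ^ k *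
        (Finset.Iic (k, 0)).sup (fun m => SchwartzMap.seminorm ℝ m.1 m.2) (dir v (dir v g)))) := by
  set q := (Finset.Iic (k, 0)).sup (fun m => SchwartzMap.seminorm ℝ m.1 m.2) (dir v (dir v g))
  rcases eq_or_ne (‖x‖ ^ k) 0 with h0 | h0
  · rw [h0, zero_mul]
    have : 0 ≤ q := apply_nonneg _ _
    positivity
  have hx : 0 < ‖x‖ ^ k := lt_of_le_of_ne (by positivity) h0.symm
  have h1 := norm_line_taylor_le (g := g) (hasDerivAt_dir v g) (hasDerivAt_dir v (dir v g))
    (C := (‖x‖ ^ k)⁻¹ * ((1 + ‖v‖) ^ k * (2 ^ k * q))) x t fun s hs => by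
      rw [← div_eq_inv_mul, le_div_iff₀ hx, mul_comm]
      have h2 : ‖x‖ ≤ (1 + ‖v‖) * (1 + ‖x + s • v‖) := by
        have h3 : ‖x‖ ≤ ‖x + s • v‖ + ‖s • v‖ := by
          simpa using norm_sub_le (x + s • v) (s • v)
        have h4 : ‖s • v‖ ≤ ‖v‖ := by
          rw [norm_smul, Real.norm_eq_abs]
          exact mul_le_of_le_one_left (norm_nonneg _) (hs.trans ht)
        nlinarith [norm_nonneg v, norm_nonneg (x + s • v),
          mul_nonneg (norm_nonneg v) (norm_nonneg (x + s • v))]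
      have h5 := SchwartzMap.one_add_le_sup_seminorm_apply (𝕜 := ℝ) (m := (k, 0)) le_rfl le_rfl
        (dir v (dir v g)) (x + s • v)
      rw [norm_iteratedFDeriv_zero] at h5
      calc _ ≤ ((1 + ‖v‖) * (1 + ‖x + s • v‖)) ^ k * ‖dir v (dir v g) (x + s • v)‖ := by gcongr
        _ = (1 + ‖v‖) ^ k * ((1 + ‖x + s • v‖) ^ k * ‖dir v (dir v g) (x + s • v)‖) := by
          rw [mul_pow, mul_assoc]
        _ ≤ _ := by gcongr
  have htc : (t : ℂ) ≠ 0 := by exact_mod_cast ht0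
  have h6 : t⁻¹ • (g (x + t • v) - g x) - dir v g x
      = (t : ℂ)⁻¹ * (g (x + t • v) - g x - t * dir v g x) := by
    rw [Complex.real_smul]; push_cast; field_simp
  rw [h6, norm_mul, norm_inv, Complex.norm_real, Real.norm_eq_abs]
  have ht' : 0 < |t| := abs_pos.2 ht0
  calc _ ≤ ‖x‖ ^ k * (|t|⁻¹ * ((‖x‖ ^ k)⁻¹ * ((1 + ‖v‖) ^ k * (2 ^ k * q)) * |t| ^ 2)) := by gcongr
    _ = _ := by field_simp

theorem eventually_seminorm_le (k n : ℕ) {ε : ℝ} (hε : 0 < ε) :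
    ∀ᶠ h in 𝓝 (0 : 𝓢(E, ℂ)), SchwartzMap.seminorm ℝ k n h ≤ ε := by
  have h := (schwartz_withSeminorms ℝ E ℂ).continuous_seminorm (k, n)
  have h2 := h.tendsto 0
  rw [map_zero] at h2
  exact (h2.eventually (gt_mem_nhds hε)).mono fun _ h => h.le

/-- The errors of difference quotients form a Schwartz family, since differentiation commutes with
translations and with `dir v`. Only weighted sup norms of these errors remain to be estimated. -/
theorem tendsto_translate [FiniteDimensional ℝ E] (f : 𝓢(E, ℂ)) (v : E) :
    Tendsto (fun t : ℝ => t⁻¹ • (translate (t • v) f - f)) (𝓝[≠] 0) (𝓝 (dir v f)) := by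
  let P : Set (ℝ → E → ℂ) :=
    {G | ∃ g : 𝓢(E, ℂ), G = fun t x => t⁻¹ • (g (x + t • v) - g x) - dir v g x}
  have hP : IsSchwartzFamily (Module.finBasis ℝ E) P := by
    constructor
    · rintro G ⟨g, rfl⟩ i
      refine ⟨_, ⟨dir (Module.finBasis ℝ E i) g, rfl⟩, fun p x => ?_⟩
      have h1 := hasDerivAt_dir (Module.finBasis ℝ E i) g (x + p • v)
      have h2 := hasDerivAt_dir (Module.finBasis ℝ E i) g x
      have h3 := hasDerivAt_dir (Module.finBasis ℝ E i) (dir v g) x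
      rw [dir_comm] at h3
      refine (((h1.sub h2).const_smul p⁻¹).sub h3).congr_of_eventuallyEq
        (Eventually.of_forall fun t => ?_)
      simp [add_right_comm]
    · rintro G ⟨g, rfl⟩ t k
      have h := SchwartzMap.decay (t⁻¹ • (translate (t • v) g - g) - dir v g) k 0
      obtain ⟨C, -, hC⟩ := h
      exact ⟨C, fun x => by simpa using hC x⟩
  have hG : (fun (t : ℝ) x => t⁻¹ • (f (x + t • v) - f x) - dir v f x) ∈ P := ⟨f, rfl⟩
  have h := hP.tendsto_toSchwartz hG (l := 𝓝[≠] 0) ?_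
  · rw [← tendsto_sub_nhds_zero_iff]
    refine h.congr fun t => ?_
    ext x
    simp
  · rintro H ⟨g, rfl⟩ k ε hε
    set C := (1 + ‖v‖) ^ k * (2 ^ k *
        (Finset.Iic (k, 0)).sup (fun m => SchwartzMap.seminorm ℝ m.1 m.2) (dir v (dir v g)))
    have h1 : Tendsto (fun t : ℝ => |t| * C) (𝓝[≠] 0) (𝓝 0) := by
      have : Continuous fun t : ℝ => |t| * C := by fun_prop
      simpa using (this.tendsto 0).mono_left nhdsWithin_le_nhds
    have h2 : ∀ᶠ t : ℝ in 𝓝[≠] 0, |t| ≤ 1 :=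
      nhdsWithin_le_nhds ((continuous_abs.tendsto (0 : ℝ)).eventually (ge_mem_nhds (by simp)))
    filter_upwards [h1.eventually (gt_mem_nhds hε), h2, self_mem_nhdsWithin] with t h3 h4 h5 x
    exact (norm_difference_quotient_le g v k x h4 h5).trans h3.le

/-! ### Slices -/


theorem slice_hasTemperateGrowth (x : E) :
    (fun y : F => ((y, x) : F × E)).HasTemperateGrowth := by
  have : (fun y : F => ((y, x) : F × E))
      = (fun y => ContinuousLinearMap.inl ℝ F E y) + fun _ => ((0, x) : F × E) := by
    ext y <;> simp
  rw [this]
  exact (ContinuousLinearMap.hasTemperateGrowth _).add (Function.HasTemperateGrowth.const _)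

theorem slice_antilipschitz (x : E) : AntilipschitzWith 1 (fun y : F => ((y, x) : F × E)) :=
  AntilipschitzWith.of_le_mul_dist fun y z => by simp [Prod.dist_eq]

/-- The restriction `y ↦ f(y, x)`. -/
def sliceAt (x : E) : 𝓢(F × E, ℂ) →L[ℂ] 𝓢(F, ℂ) :=
  SchwartzMap.compCLMOfAntilipschitz ℂ (slice_hasTemperateGrowth x) (slice_antilipschitz x)

@[simp] theorem sliceAt_apply (x : E) (f : 𝓢(F × E, ℂ)) (y : F) : sliceAt x f y = f (y, x) := rfl

theorem norm_fst_pow_mul_norm_snd_pow_le (y : F) (x : E) (k m : ℕ) :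
    ‖y‖ ^ k * ‖x‖ ^ m ≤ ‖(y, x)‖ ^ (k + m) := by
  rw [pow_add]
  gcongr
  · exact norm_fst_le (y, x)
  · exact norm_snd_le (y, x)

theorem norm_prod_pow_le (z : F × E) (k : ℕ) : ‖z‖ ^ k ≤ ‖z.1‖ ^ k + ‖z.2‖ ^ k := by
  rw [Prod.norm_def]
  rcases max_cases ‖z.1‖ ‖z.2‖ with h | h <;> rw [h.1]
  · exact le_add_of_nonneg_right (by positivity)
  · exact le_add_of_nonneg_left (by positivity)

/-- Rapid decay of the slices, uniformly in the base point: the weight ‖x‖^m is absorbed by a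
seminorm of order k + m of f. Uniformity in x is encoded by the parameter (f, x) along `𝓝 0 ×ˢ ⊤`.
-/
theorem eventually_smul_sliceAt_mem [FiniteDimensional ℝ F] (m : ℕ) {U : Set 𝓢(F, ℂ)} (hU : U ∈ 𝓝 0) :
    ∀ᶠ f in 𝓝 (0 : 𝓢(F × E, ℂ)), ∀ x, (‖x‖ ^ m : ℝ) • sliceAt x f ∈ U := by
  let P : Set (𝓢(F × E, ℂ) × E → F → ℂ) :=
    {G | ∃ D : 𝓢(F × E, ℂ) →L[ℂ] 𝓢(F × E, ℂ), G = fun p y => (‖p.2‖ ^ m : ℝ) • D p.1 (y, p.2)}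
  have key : ∀ (f : 𝓢(F × E, ℂ)) (x : E) (k : ℕ) (y : F), ‖y‖ ^ k * ‖(‖x‖ ^ m : ℝ) • f (y, x)‖
      ≤ SchwartzMap.seminorm ℝ (k + m) 0 f := fun f x k y => by
    rw [norm_smul, norm_pow, norm_norm, ← mul_assoc]
    refine le_trans ?_ (SchwartzMap.norm_pow_mul_le_seminorm ℝ f (k + m) (y, x))
    gcongr
    exact norm_fst_pow_mul_norm_snd_pow_le y x k m
  have hP : IsSchwartzFamily (Module.finBasis ℝ F) P := by
    constructor
    · rintro G ⟨D, rfl⟩ i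
      refine ⟨_, ⟨dir (Module.finBasis ℝ F i, 0) ∘L D, rfl⟩, fun p y => ?_⟩
      have h1 := hasDerivAt_dir (Module.finBasis ℝ F i, (0 : E)) (D p.1) (y, p.2)
      refine (h1.const_smul (‖p.2‖ ^ m : ℝ)).congr_of_eventuallyEq
        (Eventually.of_forall fun t => ?_)
      simp
    · rintro G ⟨D, rfl⟩ p k
      exact ⟨_, fun y => key (D p.1) p.2 k y⟩
  have hG : (fun (p : 𝓢(F × E, ℂ) × E) y => (‖p.2‖ ^ m : ℝ) • p.1 (y, p.2)) ∈ P :=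
    ⟨ContinuousLinearMap.id ℂ _, rfl⟩
  have h := hP.tendsto_toSchwartz hG (l := 𝓝 0 ×ˢ ⊤) ?_
  · have h1 := h hU
    rw [Filter.mem_map, mem_prod_top] at h1
    filter_upwards [h1] with f hf x
    exact hf x
  · rintro H ⟨D, rfl⟩ k ε hε
    have h1 : ∀ᶠ f in 𝓝 (0 : 𝓢(F × E, ℂ)), SchwartzMap.seminorm ℝ (k + m) 0 (D f) ≤ ε :=
      (D.continuous.tendsto' 0 0 (map_zero D)).eventually (eventually_seminorm_le _ _ hε)
    filter_upwards [h1.prod_inl ⊤] with p hp y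
    exact (key (D p.1) p.2 k y).trans hp

/-- Moving the base point of a slice is a translation of f followed by a fixed slice. -/
theorem tendsto_sliceAt [FiniteDimensional ℝ E] [FiniteDimensional ℝ F] (f : 𝓢(F × E, ℂ)) (x v : E) :
    Tendsto (fun t : ℝ => t⁻¹ • (sliceAt (x + t • v) f - sliceAt x f)) (𝓝[≠] 0)
      (𝓝 (sliceAt x (dir (0, v) f))) := by
  have h := ((sliceAt x).continuous.tendsto _).comp (tendsto_translate f ((0, v) : F × E))
  refine h.congr fun t => ?_
  ext y
  simp

end Translations

/-! ### Schwartz functions of two variables from vector-valued Schwartz functions -/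

section VectorValued

variable {E F X ι : Type*} [NormedAddCommGroup E] [NormedSpace ℝ E]
  [NormedAddCommGroup F] [NormedSpace ℝ F]
  [AddCommGroup X] [Module ℂ X] [TopologicalSpace X]

/-- By homogeneity, a bound near 0 gives a bound for every p after scaling p into the neighbourhood.
-/
theorem exists_bound_of_eventually [ContinuousSMul ℂ X] {Y : Type*} {N : X → Y → ℝ}
    (hN : ∀ (c : ℂ) p y, N (c • p) y = ‖c‖ * N p y)
    (h : ∀ᶠ p in 𝓝 (0 : X), ∀ y, N p y ≤ 1) (p : X) : ∃ C, ∀ y, N p y ≤ C := by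
  have h1 : Tendsto (fun c : ℂ => c • p) (𝓝[≠] 0) (𝓝 0) := by
    have : Tendsto (fun c : ℂ => c • p) (𝓝 0) (𝓝 ((0 : ℂ) • p)) :=
      (continuous_id.smul continuous_const).tendsto 0
    rw [zero_smul] at this
    exact this.mono_left nhdsWithin_le_nhds
  obtain ⟨c, hc, hc0⟩ := ((h1.eventually h).and self_mem_nhdsWithin).exists
  refine ⟨‖c‖⁻¹, fun y => ?_⟩
  have := hc y
  have hc' : 0 < ‖c‖ := norm_pos_iff.2 hc0
  rw [hN] at this
  rw [← one_div, le_div_iff₀ hc', mul_comm]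
  exact this

/-- A set of functions on `E` with values in the Schwartz functions on `F`, depending linearly on a
parameter, that is closed under derivatives and decays rapidly. -/
structure IsVectorSchwartzFamily (b : Module.Basis ι ℝ E) (Θ : Set (E → X →ₗ[ℂ] 𝓢(F, ℂ))) :
    Prop where
  deriv : ∀ θ ∈ Θ, ∀ i, ∃ θ' ∈ Θ, ∀ p x,
    Tendsto (fun t : ℝ => t⁻¹ • (θ (x + t • b i) p - θ x p)) (𝓝[≠] 0) (𝓝 (θ' x p))
  small : ∀ θ ∈ Θ, ∀ m : ℕ, ∀ U ∈ 𝓝 (0 : 𝓢(F, ℂ)), ∀ᶠ p in 𝓝 (0 : X), ∀ x,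
    (‖x‖ ^ m : ℝ) • θ x p ∈ U

namespace IsVectorSchwartzFamily

variable {b : Module.Basis ι ℝ E} {Θ : Set (E → X →ₗ[ℂ] 𝓢(F, ℂ))}

/-- The scalar functions of two variables attached to a vector-valued family. -/
def scalar (Θ : Set (E → X →ₗ[ℂ] 𝓢(F, ℂ))) : Set (X → F × E → ℂ) :=
  {G | ∃ θ ∈ Θ, ∃ D : 𝓢(F, ℂ) →L[ℂ] 𝓢(F, ℂ), G = fun p z => D (θ z.2 p) z.1}

theorem eventually_scalar_le (hΘ : IsVectorSchwartzFamily b Θ) {G : X → F × E → ℂ}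
    (hG : G ∈ scalar Θ) (k : ℕ) {ε : ℝ} (hε : 0 < ε) :
    ∀ᶠ p in 𝓝 (0 : X), ∀ z, ‖z‖ ^ k * ‖G p z‖ ≤ ε := by
  obtain ⟨θ, hθ, D, rfl⟩ := hG
  have h : ∀ n, {f : 𝓢(F, ℂ) | SchwartzMap.seminorm ℝ n 0 (D f) ≤ ε / 2} ∈ 𝓝 (0 : 𝓢(F, ℂ)) :=
    fun n => (D.continuous.tendsto' 0 0 (map_zero D)).eventually
      (eventually_seminorm_le n 0 (half_pos hε))
  filter_upwards [hΘ.small θ hθ 0 _ (h k), hΘ.small θ hθ k _ (h 0)] with p h1 h2 z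
  have h3 := h1 z.2
  have h4 := h2 z.2
  simp only [pow_zero, one_smul] at h3
  have h5 := (SchwartzMap.norm_pow_mul_le_seminorm ℝ (D (θ z.2 p)) k z.1).trans h3
  have h6 := (SchwartzMap.norm_le_seminorm ℝ (D ((‖z.2‖ ^ k : ℝ) • θ z.2 p)) z.1).trans h4
  have h7 : D ((‖z.2‖ ^ k : ℝ) • θ z.2 p) = (‖z.2‖ ^ k : ℝ) • D (θ z.2 p) :=
    D.map_smul_of_tower _ _
  rw [h7, smul_apply, norm_smul, norm_pow, norm_norm] at h6
  calc _ ≤ (‖z.1‖ ^ k + ‖z.2‖ ^ k) * ‖D (θ z.2 p) z.1‖ := by gcongr; exact norm_prod_pow_le z k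
    _ ≤ ε := by rw [add_mul]; linarith

/-- Derivatives along F are absorbed by the operator D in `scalar`; those along E come from the
closure of Θ, as D and evaluation are continuous. -/
theorem isSchwartzFamily [FiniteDimensional ℝ F] [ContinuousSMul ℂ X] (hΘ : IsVectorSchwartzFamily b Θ) :
    IsSchwartzFamily ((Module.finBasis ℝ F).prod b) (scalar Θ) := by
  constructor
  · rintro G ⟨θ, hθ, D, rfl⟩ i
    rcases i with i | i
    · refine ⟨_, ⟨θ, hθ, dir (Module.finBasis ℝ F i) ∘L D, rfl⟩, fun p z => ?_⟩
      simpa [Module.Basis.prod_apply] using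
        hasDerivAt_dir (Module.finBasis ℝ F i) (D (θ z.2 p)) z.1
    · obtain ⟨θ', hθ', h⟩ := hΘ.deriv θ hθ i
      refine ⟨_, ⟨θ', hθ', D, rfl⟩, fun p z => ?_⟩
      rw [hasDerivAt_iff_tendsto_slope_zero]
      have h1 := ((BoundedContinuousFunction.evalCLM ℂ z.1).comp
        (SchwartzMap.toBoundedContinuousFunctionCLM ℂ F ℂ) ∘L D).continuous.tendsto (θ' z.2 p)
      refine (h1.comp (h p z.2)).congr fun t => ?_
      have h7 : ∀ f, D (t⁻¹ • f) = t⁻¹ • D f := fun f => D.map_smul_of_tower _ _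
      simp [Module.Basis.prod_apply, h7]
  · intro G hG p k
    refine exists_bound_of_eventually (N := fun p z => ‖z‖ ^ k * ‖G p z‖) ?_
      (hΘ.eventually_scalar_le hG k one_pos) p
    obtain ⟨θ, hθ, D, rfl⟩ := hG
    intro c p y
    simp
    ring

variable [ContinuousSMul ℂ X] [IsTopologicalAddGroup X] [FiniteDimensional ℝ E]
  [FiniteDimensional ℝ F] [Fintype ι]

/-- The function `(y, x) ↦ θ(x)(y)` of two variables, depending linearly and continuously on the
parameter. -/
def uncurryCLM (hΘ : IsVectorSchwartzFamily b Θ) {θ : E → X →ₗ[ℂ] 𝓢(F, ℂ)} (hθ : θ ∈ Θ) :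
    X →L[ℂ] 𝓢(F × E, ℂ) where
  toFun p := hΘ.isSchwartzFamily.toSchwartz ⟨θ, hθ, ContinuousLinearMap.id ℂ _, rfl⟩ p
  map_add' p q := by ext z; simp
  map_smul' c p := by ext z; simp
  cont := by
    let L : X →+ 𝓢(F × E, ℂ) := AddMonoidHom.mk'
      (fun p => hΘ.isSchwartzFamily.toSchwartz ⟨θ, hθ, ContinuousLinearMap.id ℂ _, rfl⟩ p)
      (fun p q => by ext z; simp)
    refine continuous_of_continuousAt_zero L ?_
    rw [ContinuousAt, map_zero]
    exact hΘ.isSchwartzFamily.tendsto_toSchwartz ⟨θ, hθ, ContinuousLinearMap.id ℂ _, rfl⟩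
      fun H hH k ε hε => hΘ.eventually_scalar_le hH k hε

@[simp] theorem uncurryCLM_apply (hΘ : IsVectorSchwartzFamily b Θ) {θ : E → X →ₗ[ℂ] 𝓢(F, ℂ)}
    (hθ : θ ∈ Θ) (p : X) (z : F × E) : hΘ.uncurryCLM hθ p z = θ z.2 p z.1 := rfl

end IsVectorSchwartzFamily

end VectorValued

/-! ### Operators acting on one of two variables -/

section Ampliation

variable {E F F' : Type*} [NormedAddCommGroup E] [NormedSpace ℝ E]
  [NormedAddCommGroup F] [NormedSpace ℝ F] [NormedAddCommGroup F'] [NormedSpace ℝ F']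
  [FiniteDimensional ℝ E] [FiniteDimensional ℝ F] [FiniteDimensional ℝ F']


/-- Being linear and continuous, B commutes with difference quotients in the spectator variable x
and preserves smallness. The free operator D keeps track of the x-derivatives already taken. -/
theorem isVectorSchwartzFamily_ampl (B : 𝓢(F, ℂ) →L[ℂ] 𝓢(F', ℂ)) :
    IsVectorSchwartzFamily (X := 𝓢(F × E, ℂ)) (Module.finBasis ℝ E)
      {θ | ∃ D : 𝓢(F × E, ℂ) →L[ℂ] 𝓢(F × E, ℂ),
        θ = fun x => (B ∘L sliceAt x ∘L D : 𝓢(F × E, ℂ) →L[ℂ] 𝓢(F', ℂ)).toLinearMap} := by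
  constructor
  · rintro θ ⟨D, rfl⟩ i
    refine ⟨_, ⟨dir (0, Module.finBasis ℝ E i) ∘L D, rfl⟩, fun p x => ?_⟩
    refine ((B.continuous.tendsto _).comp
      (tendsto_sliceAt (D p) x (Module.finBasis ℝ E i))).congr fun t => ?_
    have h7 : ∀ f : 𝓢(F, ℂ), B (t⁻¹ • f) = t⁻¹ • B f := fun f => B.map_smul_of_tower _ _
    simp [h7]
  · rintro θ ⟨D, rfl⟩ m U hU
    have h1 : B ⁻¹' U ∈ 𝓝 0 := B.continuous.tendsto' 0 0 (map_zero B) hU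
    have h2 := (D.continuous.tendsto' 0 0 (map_zero D)).eventually
      (eventually_smul_sliceAt_mem m h1)
    filter_upwards [h2] with p hp x
    have h7 : ∀ f : 𝓢(F, ℂ), B ((‖x‖ ^ m : ℝ) • f) = (‖x‖ ^ m : ℝ) • B f := fun f => B.map_smul_of_tower _ _
    have h3 := hp x
    rw [Set.mem_preimage, h7] at h3
    exact h3

/-- The operator `B` acting on the first of two variables. -/
def ampl (B : 𝓢(F, ℂ) →L[ℂ] 𝓢(F', ℂ)) : 𝓢(F × E, ℂ) →L[ℂ] 𝓢(F' × E, ℂ) :=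
  (isVectorSchwartzFamily_ampl B).uncurryCLM ⟨ContinuousLinearMap.id ℂ _, rfl⟩

@[simp] theorem ampl_apply (B : 𝓢(F, ℂ) →L[ℂ] 𝓢(F', ℂ)) (f : 𝓢(F × E, ℂ)) (z : F' × E) :
    ampl B f z = B (sliceAt z.2 f) z.1 := rfl

/-! ### Functionals acting on one of two variables -/

/-- The functions `x ↦ u(D f(·, x))`, with `(f, u)` as a parameter. -/
def partialFamily (E F : Type*) [NormedAddCommGroup E] [NormedSpace ℝ E]
    [NormedAddCommGroup F] [NormedSpace ℝ F] :
    Set (𝓢(F × E, ℂ) × (𝓢(F, ℂ) →L[ℂ] ℂ) → E → ℂ) :=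
  {G | ∃ D : 𝓢(F × E, ℂ) →L[ℂ] 𝓢(F × E, ℂ), G = fun p x => p.2 (sliceAt x (D p.1))}

theorem eventually_partial_le (u : 𝓢(F, ℂ) →L[ℂ] ℂ) (D : 𝓢(F × E, ℂ) →L[ℂ] 𝓢(F × E, ℂ)) (k : ℕ)
    {ε : ℝ} (hε : 0 < ε) :
    ∀ᶠ f in 𝓝 (0 : 𝓢(F × E, ℂ)), ∀ x, ‖x‖ ^ k * ‖u (sliceAt x (D f))‖ ≤ ε := by
  have h1 : {f | ‖u f‖ ≤ ε} ∈ 𝓝 (0 : 𝓢(F, ℂ)) := by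
    have := (u.continuous.norm.tendsto' 0 0 (by simp)).eventually (gt_mem_nhds hε)
    exact this.mono fun _ h => h.le
  filter_upwards [(D.continuous.tendsto' 0 0 (map_zero D)).eventually
    (eventually_smul_sliceAt_mem k h1)] with f hf x
  have h2 := hf x
  have h7 : ∀ f : 𝓢(F, ℂ), u ((‖x‖ ^ k : ℝ) • f) = (‖x‖ ^ k : ℝ) • u f := fun f => u.map_smul_of_tower _ _
  simpa [h7] using h2

theorem isSchwartzFamily_partial : IsSchwartzFamily (Module.finBasis ℝ E) (partialFamily E F) := by
  constructor
  · rintro G ⟨D, rfl⟩ i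
    refine ⟨_, ⟨dir (0, Module.finBasis ℝ E i) ∘L D, rfl⟩, fun p x => ?_⟩
    rw [hasDerivAt_iff_tendsto_slope_zero]
    refine ((p.2.continuous.tendsto _).comp
      (tendsto_sliceAt (D p.1) x (Module.finBasis ℝ E i))).congr fun t => ?_
    have h7 : ∀ f : 𝓢(F, ℂ), p.2 (t⁻¹ • f) = t⁻¹ • p.2 f := fun f => p.2.map_smul_of_tower _ _
    simp [h7]
  · rintro G ⟨D, rfl⟩ ⟨f, u⟩ k
    exact exists_bound_of_eventually (N := fun f x => ‖x‖ ^ k * ‖u (sliceAt x (D f))‖)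
      (fun c p x => by simp; ring) (eventually_partial_le u D k one_pos) f

/-- The function `x ↦ u(f(·, x))`. -/
def partialApply (f : 𝓢(F × E, ℂ)) (u : 𝓢(F, ℂ) →L[ℂ] ℂ) : 𝓢(E, ℂ) :=
  isSchwartzFamily_partial.toSchwartz
    (G := fun p x => p.2 (sliceAt x p.1)) ⟨ContinuousLinearMap.id ℂ _, rfl⟩ (f, u)

@[simp] theorem partialApply_apply (f : 𝓢(F × E, ℂ)) (u : 𝓢(F, ℂ) →L[ℂ] ℂ) (x : E) :
    partialApply f u x = u (sliceAt x f) := rfl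

/-- Both the function and the functional may vary, which covers three cases: u fixed, f fixed, and u
ranging over a bounded set. -/
theorem tendsto_partialApply {Y : Type*} {l : Filter Y} {f : Y → 𝓢(F × E, ℂ)}
    {u : Y → 𝓢(F, ℂ) →L[ℂ] ℂ}
    (h : ∀ (D : 𝓢(F × E, ℂ) →L[ℂ] 𝓢(F × E, ℂ)) (k : ℕ), ∀ ε > 0, ∀ᶠ p in l, ∀ x,
      ‖x‖ ^ k * ‖u p (sliceAt x (D (f p)))‖ ≤ ε) :
    Tendsto (fun p => partialApply (f p) (u p)) l (𝓝 0) := by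
  refine (isSchwartzFamily_partial (E := E) (F := F)).tendsto_toSchwartz
    (G := fun p x => p.2 (sliceAt x p.1)) ⟨ContinuousLinearMap.id ℂ _, rfl⟩
    (l := l.map fun p => (f p, u p)) ?_ |>.comp tendsto_map
  rintro H ⟨D, rfl⟩ k ε hε
  exact h D k ε hε

/-- The function `x ↦ u(f(·, x))`, for a fixed functional `u`. -/
def partialApplyCLM (u : 𝓢(F, ℂ) →L[ℂ] ℂ) : 𝓢(F × E, ℂ) →L[ℂ] 𝓢(E, ℂ) where
  toFun f := partialApply f u
  map_add' f g := by ext x; simp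
  map_smul' c f := by ext x; simp
  cont := by
    let L : 𝓢(F × E, ℂ) →+ 𝓢(E, ℂ) := AddMonoidHom.mk' (fun f => partialApply f u)
      (fun p q => by ext z; simp)
    refine continuous_of_continuousAt_zero L ?_
    rw [ContinuousAt, map_zero]
    exact tendsto_partialApply fun D k ε hε => eventually_partial_le u D k hε

@[simp] theorem partialApplyCLM_apply (u : 𝓢(F, ℂ) →L[ℂ] ℂ) (f : 𝓢(F × E, ℂ)) (x : E) :
    partialApplyCLM u f x = u (sliceAt x f) := rfl

end Ampliation

/-! ### Skew-adjoint operators on the Schwartz space -/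


section Skew

variable {E F : Type*} [NormedAddCommGroup E] [NormedSpace ℝ E] [MeasureSpace E] [BorelSpace E]
  [SecondCountableTopology E]
  [NormedAddCommGroup F] [NormedSpace ℝ F] [MeasureSpace F] [BorelSpace F]
  [SecondCountableTopology F]

/-- The `L²` inner product of Schwartz functions, linear in the second entry. -/
def sip (f g : 𝓢(E, ℂ)) : ℂ := ∫ x, (starRingEnd ℂ) (f x) * g x

/-- Skew-adjoint operators on the Schwartz space. -/
def IsSkew (B : 𝓢(E, ℂ) →L[ℂ] 𝓢(E, ℂ)) : Prop := ∀ f g, sip f (B g) = -sip (B f) g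

theorem integrable_conj_mul [(volume : Measure E).HasTemperateGrowth] (f g : 𝓢(E, ℂ)) :
    Integrable (fun x => (starRingEnd ℂ) (f x) * g x) := by
  obtain ⟨C, hC⟩ : ∃ C, ∀ x, ‖f x‖ ≤ C := ⟨_, fun x => f.norm_le_seminorm ℂ x⟩
  refine (g.integrable (μ := volume)).bdd_mul (c := C) ?_ (Eventually.of_forall fun x => ?_)
  · exact (Complex.continuous_conj.comp f.continuous).aestronglyMeasurable
  · simpa using hC x

theorem sip_conj (f g : 𝓢(E, ℂ)) : (starRingEnd ℂ) (sip f g) = sip g f := by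
  simp only [sip, ← integral_conj]
  congr 1; ext x; simp [mul_comm]

section

variable [(volume : Measure E).HasTemperateGrowth]

theorem sip_add_right (f g h : 𝓢(E, ℂ)) : sip f (g + h) = sip f g + sip f h := by
  simp only [sip, ← integral_add (integrable_conj_mul f g) (integrable_conj_mul f h)]
  congr 1; ext x; simp [mul_add]

theorem sip_add_left (f g h : 𝓢(E, ℂ)) : sip (f + g) h = sip f h + sip g h := by
  rw [← sip_conj, sip_add_right, map_add, sip_conj, sip_conj]

theorem sip_smul_right (c : ℂ) (f g : 𝓢(E, ℂ)) : sip f (c • g) = c * sip f g := by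
  simp only [sip, ← integral_const_mul]
  congr 1; ext x; simp; ring

theorem sip_smul_left (c : ℂ) (f g : 𝓢(E, ℂ)) : sip (c • f) g = (starRingEnd ℂ) c * sip f g := by
  rw [← sip_conj, sip_smul_right, map_mul, sip_conj]

theorem sip_sub_right (f g h : 𝓢(E, ℂ)) : sip f (g - h) = sip f g - sip f h := by
  have := sip_add_right f (g - h) h
  rw [sub_add_cancel] at this
  rw [this, add_sub_cancel_right]

theorem sip_sub_left (f g h : 𝓢(E, ℂ)) : sip (f - g) h = sip f h - sip g h := by
  rw [← sip_conj, sip_sub_right, map_sub, sip_conj, sip_conj]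

theorem sip_sum_right {ι : Type*} (s : Finset ι) (f : 𝓢(E, ℂ)) (g : ι → 𝓢(E, ℂ)) :
    sip f (∑ i ∈ s, g i) = ∑ i ∈ s, sip f (g i) := by
  classical
  induction s using Finset.induction_on with
  | empty => simp [sip]
  | insert a s ha ih => rw [Finset.sum_insert ha, Finset.sum_insert ha, sip_add_right, ih]

/-- A continuous function that vanishes almost everywhere vanishes, since volume charges open sets.
-/
theorem eq_zero_of_sip_self [(volume : Measure E).IsOpenPosMeasure] {f : 𝓢(E, ℂ)}
    (h : sip f f = 0) : f = 0 := by
  have h1 : ∫ x, ‖f x‖ ^ 2 = 0 := by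
    have : sip f f = ((∫ x, ‖f x‖ ^ 2 : ℝ) : ℂ) := by
      rw [← integral_complex_ofReal]
      refine integral_congr_ae (Eventually.of_forall fun x => ?_)
      simp only
      rw [mul_comm, Complex.mul_conj, Complex.normSq_eq_norm_sq]
    rw [h] at this
    exact_mod_cast this.symm
  have hi : Integrable (fun x => ‖f x‖ ^ 2) := by
    refine (integrable_conj_mul f f).norm.congr (Eventually.of_forall fun x => ?_)
    simp [sq]
  have h2 := (integral_eq_zero_iff_of_nonneg (fun x => by positivity) hi).1 h1
  have h3 := (Continuous.ae_eq_iff_eq volume (f.continuous.norm.pow 2) continuous_zero).1 h2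
  ext x
  have := congrFun h3 x
  simpa using this

theorem IsSkew.add {A B : 𝓢(E, ℂ) →L[ℂ] 𝓢(E, ℂ)} (hA : IsSkew A) (hB : IsSkew B) :
    IsSkew (A + B) := fun f g => by
  rw [add_apply, add_apply, sip_add_right, sip_add_left, hA, hB]; ring

theorem IsSkew.smul {A : 𝓢(E, ℂ) →L[ℂ] 𝓢(E, ℂ)} (hA : IsSkew A) (r : ℝ) :
    IsSkew ((r : ℂ) • A) := fun f g => by
  rw [smul_apply, smul_apply, sip_smul_right, sip_smul_left, hA, Complex.conj_ofReal]; ring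

theorem IsSkew.sum {ι : Type*} (s : Finset ι) {A : ι → 𝓢(E, ℂ) →L[ℂ] 𝓢(E, ℂ)}
    (hA : ∀ i ∈ s, IsSkew (A i)) : IsSkew (∑ i ∈ s, A i) := by
  classical
  induction s using Finset.induction_on with
  | empty => intro f g; simp [sip]
  | insert a s ha ih =>
    rw [Finset.sum_insert ha]
    exact (hA a (by simp)).add (ih fun i hi => hA i (by simp [hi]))

theorem IsSkew.commutator {A B : 𝓢(E, ℂ) →L[ℂ] 𝓢(E, ℂ)} (hA : IsSkew A) (hB : IsSkew B) :
    IsSkew (A ∘L B - B ∘L A) := fun f g => by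
  simp only [sub_apply, ContinuousLinearMap.comp_apply, sip_sub_right, sip_sub_left]
  rw [hA, hB, hB f, hA _ g]
  ring

end

/-- By Fubini the inner product is an integral of inner products of slices, and B acts slice by
slice. -/
theorem IsSkew.ampl [FiniteDimensional ℝ E] [FiniteDimensional ℝ F]
    [(volume : Measure (F × E)).HasTemperateGrowth] [SFinite (volume : Measure E)]
    [SFinite (volume : Measure F)] {B : 𝓢(F, ℂ) →L[ℂ] 𝓢(F, ℂ)} (hB : IsSkew B) :
    IsSkew (ampl (E := E) B) := fun f g => by
  have h : ∀ f g : 𝓢(F × E, ℂ), sip f g = ∫ x, sip (sliceAt x f) (sliceAt x g) := fun f g =>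
    integral_prod_symm _ (integrable_conj_mul f g)
  have h' : ∀ (f : 𝓢(F × E, ℂ)) (x : E), sliceAt x (BosonicRDM.ampl B f) = B (sliceAt x f) :=
    fun f x => rfl
  rw [h, h, ← integral_neg]
  simp only [h', hB _ (sliceAt _ g)]

end Skew

/-! ### Configurations -/

section Configurations

variable {d k N : ℕ}

theorem glue_castLE (h : k ≤ N) (z : Conf d k) (y : Conf d (N - k)) (a : Fin k) :
    glue z y (Fin.castLE h a) = z a := by
  simp [glue]

instance instTemperateConfProd (d k l : ℕ) :
    (volume : Measure (Conf d k × Conf d l)).HasTemperateGrowth :=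
  have : (volume : Measure (Conf d k × Conf d l)).IsAddHaarMeasure :=
    Measure.prod.instIsAddHaarMeasure _ _
  Measure.IsAddHaarMeasure.instHasTemperateGrowth

/-- The decomposition of a configuration into the first `k` particles and the others. -/
def splitConf (d : ℕ) {k N : ℕ} (h : k ≤ N) : Conf d N ≃L[ℝ] Conf d k × Conf d (N - k) :=
  LinearEquiv.toContinuousLinearEquiv
    { toFun := fun x => (fun a => x (Fin.castLE h a), fun b => x ⟨k + b.val, by omega⟩)
      invFun := fun p => glue p.1 p.2
      map_add' := fun x y => rfl
      map_smul' := fun c x => rfl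
      left_inv := fun x => by
        funext i
        by_cases hi : i.val < k
        · simp [glue, hi]
        · simp only [glue, hi, dif_neg, not_false_eq_true]
          congr 1
          ext
          simp only
          omega
      right_inv := fun p => by
        ext a : 2
        · simp [glue]
        · simp [glue] }

@[simp] theorem splitConf_fst (h : k ≤ N) (x : Conf d N) :
    (splitConf d h x).1 = fun a => x (Fin.castLE h a) := rfl

@[simp] theorem splitConf_symm_apply (h : k ≤ N) (p : Conf d k × Conf d (N - k)) :
    (splitConf d h).symm p = glue p.1 p.2 := rfl

theorem measurePreserving_splitConf_symm (h : k ≤ N) :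
    MeasurePreserving (splitConf d h).symm volume volume := by
  let e : Fin k ⊕ Fin (N - k) ≃ Fin N := finSumFinEquiv.trans (finCongr (by omega))
  have h1 := (volume_measurePreserving_sumPiEquivProdPi_symm
    (fun _ : Fin k ⊕ Fin (N - k) => EuclideanSpace ℝ (Fin d)))
  have h2 := volume_measurePreserving_piCongrLeft (fun _ : Fin N => EuclideanSpace ℝ (Fin d)) e
  convert h2.comp h1 using 1
  funext p i
  rw [splitConf_symm_apply]
  obtain ⟨a, rfl⟩ := e.surjective i
  rw [Function.comp_apply, MeasurableEquiv.piCongrLeft, MeasurableEquiv.coe_mk]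
  erw [Equiv.piCongrLeft_apply_apply]
  rcases a with a | b
  · simp [glue, e]
    rfl
  · simp [glue, e]
    rfl

theorem integral_glue (h : k ≤ N) (f : Conf d N → ℂ) :
    ∫ x, f x = ∫ p : Conf d k × Conf d (N - k), f (glue p.1 p.2) :=
  ((measurePreserving_splitConf_symm h).integral_comp'
    (f := (splitConf d h).symm.toHomeomorph.toMeasurableEquiv) f).symm

/-- Pulling Schwartz functions back along `glue`. -/
def gluePull (d : ℕ) {k N : ℕ} (h : k ≤ N) :
    𝓢(Conf d N, ℂ) →L[ℂ] 𝓢(Conf d k × Conf d (N - k), ℂ) :=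
  SchwartzMap.compCLMOfContinuousLinearEquiv ℂ (splitConf d h).symm

@[simp] theorem gluePull_apply (h : k ≤ N) (f : 𝓢(Conf d N, ℂ)) (p : Conf d k × Conf d (N - k)) :
    gluePull d h f p = f (glue p.1 p.2) := rfl

/-- Pulling Schwartz functions back along the decomposition of configurations. -/
def splitPull (d : ℕ) {k N : ℕ} (h : k ≤ N) :
    𝓢(Conf d k × Conf d (N - k), ℂ) →L[ℂ] 𝓢(Conf d N, ℂ) :=
  SchwartzMap.compCLMOfContinuousLinearEquiv ℂ (splitConf d h)

@[simp] theorem splitPull_apply (h : k ≤ N) (f : 𝓢(Conf d k × Conf d (N - k), ℂ)) (x : Conf d N) :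
    splitPull d h f x = f (splitConf d h x) := rfl

theorem sip_gluePull (h : k ≤ N) (f g : 𝓢(Conf d N, ℂ)) :
    sip (gluePull d h f) (gluePull d h g) = sip f g :=
  (integral_glue h fun x => (starRingEnd ℂ) (f x) * g x).symm

theorem gluePull_splitPull (h : k ≤ N) (f : 𝓢(Conf d k × Conf d (N - k), ℂ)) :
    gluePull d h (splitPull d h f) = f := by
  ext p
  change f (splitConf d h ((splitConf d h).symm p)) = f p
  rw [ContinuousLinearEquiv.apply_symm_apply]

theorem sip_permSchwartz (π : Equiv.Perm (Fin k)) (f g : 𝓢(Conf d k, ℂ)) :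
    sip (permSchwartz d π f) (permSchwartz d π g) = sip f g :=
  integral_comp_perm d π fun x => (starRingEnd ℂ) (f x) * g x

theorem permSchwartz_inv_cancel (π : Equiv.Perm (Fin k)) (f : 𝓢(Conf d k, ℂ)) :
    permSchwartz d π⁻¹ (permSchwartz d π f) = f := by
  ext x
  simp only [permSchwartz_apply]
  congr 1
  funext i
  simp

theorem exists_perm_extending (j : Fin k ↪ Fin N) :
    ∃ σ : Equiv.Perm (Fin N), ∀ (h : k ≤ N) a, σ (Fin.castLE h a) = j a := by
  have hk : k ≤ N := by simpa using Fintype.card_le_of_embedding j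
  obtain ⟨σ, hσ⟩ := MulAction.isMultiplyPretransitive_iff.1
    (Equiv.Perm.isMultiplyPretransitive (Fin N) k) (Fin.castLEEmb hk) j
  exact ⟨σ, fun _ a => DFunLike.congr_fun hσ a⟩

/-! ### Operators acting on some of the particles -/

theorem le_of_emb (j : Fin k ↪ Fin N) : k ≤ N := by simpa using Fintype.card_le_of_embedding j

/-- A permutation that moves the first `k` particles to the particles `j(1), …, j(k)`. -/
def extPerm (j : Fin k ↪ Fin N) : Equiv.Perm (Fin N) := (exists_perm_extending j).choose

theorem extPerm_castLE (j : Fin k ↪ Fin N) (h : k ≤ N) (a : Fin k) :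
    extPerm j (Fin.castLE h a) = j a := (exists_perm_extending j).choose_spec h a

/-- The restriction of a Schwartz function to the particles `j(1), …, j(k)`. -/
def cslice (j : Fin k ↪ Fin N) (x : Conf d N) : 𝓢(Conf d N, ℂ) →L[ℂ] 𝓢(Conf d k, ℂ) :=
  SchwartzMap.compCLMOfAntilipschitz ℂ (moveTo_hasTemperateGrowth j x) (moveTo_antilipschitz j x)

@[simp] theorem cslice_apply (j : Fin k ↪ Fin N) (x : Conf d N) (f : 𝓢(Conf d N, ℂ))
    (z : Conf d k) : cslice j x f z = f (moveTo j x z) := rfl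

/-- The operator `B` acting on the particles `j(1), …, j(k)`. -/
def lift (j : Fin k ↪ Fin N) (B : 𝓢(Conf d k, ℂ) →L[ℂ] 𝓢(Conf d k, ℂ)) :
    𝓢(Conf d N, ℂ) →L[ℂ] 𝓢(Conf d N, ℂ) :=
  permSchwartz d (extPerm j) ∘L splitPull d (le_of_emb j) ∘L ampl B ∘L gluePull d (le_of_emb j) ∘L
    permSchwartz d (extPerm j)⁻¹

/-- This ties the construction to the slices of `IsEmbedded` and shows that the choice of `extPerm
j` is immaterial. -/
theorem lift_apply (j : Fin k ↪ Fin N) (B : 𝓢(Conf d k, ℂ) →L[ℂ] 𝓢(Conf d k, ℂ))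
    (f : 𝓢(Conf d N, ℂ)) (x : Conf d N) :
    lift j B f x = B (cslice j x f) (fun a => x (j a)) := by
  have h := le_of_emb j
  have h1 : lift j B f x = B (sliceAt (splitConf d h (x ∘ extPerm j)).2
    (gluePull d h (permSchwartz d (extPerm j)⁻¹ f))) (splitConf d h (x ∘ extPerm j)).1 := rfl
  have h2 : (splitConf d h (x ∘ extPerm j)).1 = fun a => x (j a) := by
    funext a
    simp [extPerm_castLE]
  rw [h1, h2]
  congr 2
  ext z
  simp only [sliceAt_apply, gluePull_apply, permSchwartz_apply, cslice_apply]
  congr 1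
  funext i
  obtain ⟨i, rfl⟩ := (extPerm j).surjective i
  simp only [Function.comp_apply, Equiv.Perm.inv_def, Equiv.symm_apply_apply]
  by_cases hi : i.val < k
  · have : i = Fin.castLE h ⟨i.val, hi⟩ := rfl
    rw [this, glue_castLE, extPerm_castLE, moveTo_self]
  · rw [moveTo_of_not]
    · have := congrFun ((splitConf d h).symm_apply_apply (x ∘ extPerm j)) i
      rw [splitConf_symm_apply] at this
      simp only [glue, hi, dif_neg, not_false_eq_true] at this ⊢
      exact this
    · rintro ⟨a, ha⟩
      rw [← extPerm_castLE j h a] at ha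
      have := (extPerm j).injective ha
      rw [← this] at hi
      exact hi a.isLt

/-- `lift j B` is conjugate to `ampl B` by changes of variables that preserve Lebesgue measure. -/
theorem IsSkew.lift (j : Fin k ↪ Fin N) {B : 𝓢(Conf d k, ℂ) →L[ℂ] 𝓢(Conf d k, ℂ)}
    (hB : IsSkew B) : IsSkew (lift j B) := fun f g => by
  have h := le_of_emb j
  have hp : ∀ u v, sip u (permSchwartz d (extPerm j) v) = sip (permSchwartz d (extPerm j)⁻¹ u) v :=
    fun u v => by
      rw [← sip_permSchwartz (extPerm j)⁻¹ u, permSchwartz_inv_cancel]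
  have hs : ∀ u v, sip u (splitPull d h v) = sip (gluePull d h u) v := fun u v => by
    rw [← sip_gluePull h u, gluePull_splitPull]
  have key : ∀ u v, sip u (BosonicRDM.lift j B v)
      = sip (gluePull d h (permSchwartz d (extPerm j)⁻¹ u))
        (BosonicRDM.ampl B (gluePull d h (permSchwartz d (extPerm j)⁻¹ v))) := fun u v => by
    rw [← hs, ← hp]; rfl
  have key' : sip (BosonicRDM.lift j B f) g = (starRingEnd ℂ) (sip g (BosonicRDM.lift j B f)) :=
    (sip_conj _ _).symm
  rw [key', key, key, sip_conj, hB.ampl]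

theorem moveTo_trans {m : ℕ} (γ : Fin k ↪ Fin N) (α : Fin m ↪ Fin k) (x : Conf d N)
    (z : Conf d m) :
    moveTo γ x (moveTo α (fun a => x (γ a)) z) = moveTo (α.trans γ) x z := by
  funext i
  by_cases h : ∃ a, γ a = i
  · obtain ⟨a, rfl⟩ := h
    rw [moveTo_self]
    by_cases h' : ∃ b, α b = a
    · obtain ⟨b, rfl⟩ := h'
      rw [moveTo_self, ← Function.Embedding.trans_apply, moveTo_self]
    · rw [moveTo_of_not _ _ _ _ h', moveTo_of_not]
      rintro ⟨b, hb⟩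
      exact h' ⟨b, γ.injective hb⟩
  · rw [moveTo_of_not _ _ _ _ h, moveTo_of_not]
    rintro ⟨b, hb⟩
    exact h ⟨α b, hb⟩

theorem lift_lift {m : ℕ} (γ : Fin k ↪ Fin N) (α : Fin m ↪ Fin k)
    (A : 𝓢(Conf d m, ℂ) →L[ℂ] 𝓢(Conf d m, ℂ)) : lift γ (lift α A) = lift (α.trans γ) A := by
  ext f x
  rw [lift_apply, lift_apply, lift_apply]
  congr 2
  ext z
  simp [moveTo_trans]

theorem moveTo_moveTo (γ : Fin k ↪ Fin N) (x : Conf d N) (z w : Conf d k) :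
    moveTo γ (moveTo γ x z) w = moveTo γ x w := by
  funext i
  by_cases h : ∃ a, γ a = i
  · obtain ⟨a, rfl⟩ := h
    rw [moveTo_self, moveTo_self]
  · rw [moveTo_of_not _ _ _ _ h, moveTo_of_not _ _ _ _ h, moveTo_of_not _ _ _ _ h]

theorem lift_comp (γ : Fin k ↪ Fin N) (A B : 𝓢(Conf d k, ℂ) →L[ℂ] 𝓢(Conf d k, ℂ)) :
    lift γ (A ∘L B) = lift γ A ∘L lift γ B := by
  ext f x
  rw [ContinuousLinearMap.comp_apply, lift_apply, lift_apply, ContinuousLinearMap.comp_apply]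
  congr 2
  ext z
  rw [cslice_apply, lift_apply]
  congr 1
  · congr 1
    ext w
    simp [moveTo_moveTo]
  · simp [moveTo_self]

theorem lift_sub (γ : Fin k ↪ Fin N) (A B : 𝓢(Conf d k, ℂ) →L[ℂ] 𝓢(Conf d k, ℂ)) :
    lift γ (A - B) = lift γ A - lift γ B := by
  ext f x; simp [lift_apply]

theorem lift_smul (γ : Fin k ↪ Fin N) (c : ℂ) (A : 𝓢(Conf d k, ℂ) →L[ℂ] 𝓢(Conf d k, ℂ)) :
    lift γ (c • A) = c • lift γ A := by
  ext f x; simp [lift_apply]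

theorem lift_sum {ι : Type*} (s : Finset ι) (γ : Fin k ↪ Fin N)
    (A : ι → 𝓢(Conf d k, ℂ) →L[ℂ] 𝓢(Conf d k, ℂ)) :
    lift γ (∑ i ∈ s, A i) = ∑ i ∈ s, lift γ (A i) := by
  ext f x; simp [lift_apply]

end Configurations

/-! ### Symmetrization and the embeddings of observables -/

section Symmetrization

variable {d k N : ℕ}

/-- The projection of the Schwartz space onto the bosonic Schwartz space. -/
def symmetrize (d k : ℕ) : 𝓢(Conf d k, ℂ) →L[ℂ] SymSchwartz d k :=
  ((k.factorial : ℂ)⁻¹ • ∑ π : Equiv.Perm (Fin k), permSchwartz d π).codRestrict (SymSchwartz d k)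
    fun f σ x => by
      have h : ∑ π : Equiv.Perm (Fin k), f ((x ∘ σ) ∘ π)
          = ∑ π : Equiv.Perm (Fin k), f (x ∘ π) :=
        Fintype.sum_equiv (Equiv.mulLeft σ) _ _ (fun π => rfl)
      simp [h]

theorem symmetrize_apply (f : 𝓢(Conf d k, ℂ)) (x : Conf d k) :
    (symmetrize d k f).1 x = (k.factorial : ℂ)⁻¹ * ∑ π : Equiv.Perm (Fin k), f (x ∘ π) := by
  change ((k.factorial : ℂ)⁻¹ • ∑ π : Equiv.Perm (Fin k), permSchwartz d π) f x = _
  simp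

theorem symmetrize_of_mem (f : 𝓢(Conf d k, ℂ))
    (hf : ∀ (π : Equiv.Perm (Fin k)) x, f (x ∘ π) = f x) (x : Conf d k) :
    (symmetrize d k f).1 x = f x := by
  rw [symmetrize_apply]
  simp only [hf, Finset.sum_const, Finset.card_univ, Fintype.card_perm, Fintype.card_fin,
    nsmul_eq_mul]
  rw [inv_mul_cancel_left₀ (by exact_mod_cast k.factorial_ne_zero)]

@[simp] theorem symmetrize_coe (f : SymSchwartz d k) : symmetrize d k f.1 = f := by
  ext x
  exact symmetrize_of_mem f.1 f.2 x

/-- Symmetrization is the orthogonal projection onto bosonic functions, so it is invisible in inner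
products with them. -/
theorem sip_coe (f : 𝓢(Conf d k, ℂ)) (h : SymSchwartz d k) :
    sip f h.1 = ip (symmetrize d k f) h := by
  have h1 : ip (symmetrize d k f) h = sip (symmetrize d k f).1 h.1 := rfl
  have h2 : (symmetrize d k f).1
      = (k.factorial : ℂ)⁻¹ • ∑ π : Equiv.Perm (Fin k), permSchwartz d π f := by
    ext x; rw [symmetrize_apply]; simp
  have h3 : ∀ π : Equiv.Perm (Fin k), sip h.1 (permSchwartz d π f) = sip h.1 f := fun π => by
    rw [← sip_permSchwartz π h.1 f]
    congr 1
    ext x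
    exact (h.2 π x).symm
  rw [h1, ← sip_conj h.1 f, ← sip_conj h.1, h2, sip_smul_right, sip_sum_right]
  simp only [h3, Finset.sum_const, Finset.card_univ, Fintype.card_perm, Fintype.card_fin,
    nsmul_eq_mul]
  rw [inv_mul_cancel_left₀ (by exact_mod_cast k.factorial_ne_zero)]

/-- An operator on bosonic functions, extended to all functions by symmetrizing them. -/
def fullOp (A : SymSchwartz d k →L[ℂ] SymSchwartz d k) : 𝓢(Conf d k, ℂ) →L[ℂ] 𝓢(Conf d k, ℂ) :=
  (SymSchwartz d k).subtypeL ∘L A ∘L symmetrize d k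

theorem fullOp_apply (A : SymSchwartz d k →L[ℂ] SymSchwartz d k) (f : 𝓢(Conf d k, ℂ)) :
    fullOp A f = (A (symmetrize d k f)).1 := rfl

theorem isSkew_fullOp (A : Obs d k) : IsSkew (fullOp A.1) := fun f g => by
  rw [fullOp_apply, fullOp_apply, sip_coe, A.2, ← sip_conj g, sip_coe, ip_conj]

/-- The observable obtained from a skew-adjoint operator by symmetrization. -/
def obsOfSkew (D : 𝓢(Conf d k, ℂ) →L[ℂ] 𝓢(Conf d k, ℂ)) (hD : IsSkew D) : Obs d k :=
  ⟨symmetrize d k ∘L D ∘L (SymSchwartz d k).subtypeL, fun f g => by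
    have h1 := sip_coe (D g.1) f
    have h2 := sip_coe (D f.1) g
    have h3 := hD f.1 g.1
    change ip f (symmetrize d k (D g.1)) = -ip (symmetrize d k (D f.1)) g
    rw [← ip_conj, ← h1, ← h2, sip_conj, h3]⟩

theorem obsOfSkew_apply (D : 𝓢(Conf d k, ℂ) →L[ℂ] 𝓢(Conf d k, ℂ)) (hD : IsSkew D)
    (f : SymSchwartz d k) : (obsOfSkew D hD).1 f = symmetrize d k (D f.1) := rfl

theorem obsOfSkew_fullOp (A : Obs d k) : obsOfSkew (fullOp A.1) (isSkew_fullOp A) = A := by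
  ext f x
  rw [obsOfSkew_apply, fullOp_apply]
  simp

/-- The average of the operators `D_{(j₁, …, j_k)}`. -/
def average (N : ℕ) (D : 𝓢(Conf d k, ℂ) →L[ℂ] 𝓢(Conf d k, ℂ)) :
    𝓢(Conf d N, ℂ) →L[ℂ] 𝓢(Conf d N, ℂ) :=
  ((((N.descFactorial k : ℕ) : ℝ)⁻¹ : ℝ) : ℂ) • ∑ j : Fin k ↪ Fin N, lift j D

theorem IsSkew.average {D : 𝓢(Conf d k, ℂ) →L[ℂ] 𝓢(Conf d k, ℂ)} (hD : IsSkew D) :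
    IsSkew (average N D) :=
  (IsSkew.sum _ fun j _ => hD.lift j).smul _

theorem average_apply (D : 𝓢(Conf d k, ℂ) →L[ℂ] 𝓢(Conf d k, ℂ)) (f : 𝓢(Conf d N, ℂ))
    (x : Conf d N) : average N D f x
      = ((N.descFactorial k : ℕ) : ℂ)⁻¹ * ∑ j : Fin k ↪ Fin N, lift j D f x := by
  simp [average]

/-- For bosonic f, relabelling the tuple amounts to permuting the evaluation point. This makes
averages bosonic and all tuples equivalent under the trace. -/
theorem lift_trans_perm (j : Fin k ↪ Fin N) (π : Equiv.Perm (Fin N))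
    (D : 𝓢(Conf d k, ℂ) →L[ℂ] 𝓢(Conf d k, ℂ)) (f : SymSchwartz d N) (x : Conf d N) :
    lift (j.trans π.toEmbedding) D f.1 x = lift j D f.1 (x ∘ π) := by
  rw [lift_apply, lift_apply]
  congr 2
  ext z
  rw [cslice_apply, cslice_apply, ← f.2 π]
  congr 1
  funext i
  rw [Function.comp_apply]
  by_cases h : ∃ a, j a = i
  · obtain ⟨a, rfl⟩ := h
    rw [moveTo_self]
    exact moveTo_self (j.trans π.toEmbedding) x z a
  · rw [moveTo_of_not _ _ _ _ h, moveTo_of_not]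
    · rfl
    · rintro ⟨a, ha⟩
      exact h ⟨a, π.injective ha⟩

theorem average_comp_perm (D : 𝓢(Conf d k, ℂ) →L[ℂ] 𝓢(Conf d k, ℂ)) (f : SymSchwartz d N)
    (π : Equiv.Perm (Fin N)) (x : Conf d N) : average N D f.1 (x ∘ π) = average N D f.1 x := by
  rw [average_apply, average_apply]
  congr 1
  simp only [← lift_trans_perm]
  exact Fintype.sum_equiv (Equiv.embeddingCongr (Equiv.refl _) π) _ _ fun j => rfl

theorem cslice_perm_trans (j : Fin k ↪ Fin N) (π : Equiv.Perm (Fin k)) (f : SymSchwartz d N)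
    (x : Conf d N) : cslice (π.toEmbedding.trans j) x f.1 = cslice j x f.1 := by
  ext z
  have h1 := (slice j x f).2 π⁻¹ z
  rw [slice_apply, slice_apply] at h1
  rw [cslice_apply, cslice_apply, ← h1]
  congr 1
  funext i
  by_cases h : ∃ a, j a = i
  · obtain ⟨a, rfl⟩ := h
    obtain ⟨a, rfl⟩ := π.surjective a
    rw [moveTo_self]
    refine (moveTo_self (π.toEmbedding.trans j) x z a).trans ?_
    simp
  · rw [moveTo_of_not _ _ _ _ h, moveTo_of_not]
    rintro ⟨a, ha⟩
    exact h ⟨_, ha⟩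

/-- `IsEmbedded` prescribes all values of T, so the choice in `embed` is harmless. -/
theorem IsEmbedded.embed_eq {A : Obs d k} {T : Obs d N} (h : IsEmbedded A T) : embed N A = T := by
  have hex : ∃ T : Obs d N, IsEmbedded A T := ⟨T, h⟩
  have h1 : IsEmbedded A (embed N A) := by
    rw [embed, dif_pos hex]
    exact hex.choose_spec
  ext f x
  rw [h1 f x, h f x]

/-- Reordering a tuple only permutes the terms of the average, so the symmetrization over k
particles is absorbed. Observables may thus be represented by operators that do not preserve bosonic
symmetry, as is needed for commutators. -/
theorem embed_obsOfSkew (D : 𝓢(Conf d k, ℂ) →L[ℂ] 𝓢(Conf d k, ℂ)) (hD : IsSkew D) :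
    embed N (obsOfSkew D hD) = obsOfSkew (average N D) hD.average := by
  refine IsEmbedded.embed_eq fun f x => ?_
  rw [obsOfSkew_apply, symmetrize_of_mem _ (fun π x => average_comp_perm D f π x), average_apply]
  congr 1
  have h1 : ∀ j : Fin k ↪ Fin N, ((obsOfSkew D hD).1 (slice j x f)).1 (fun a => x (j a))
      = (k.factorial : ℂ)⁻¹ * ∑ π : Equiv.Perm (Fin k), lift (π.toEmbedding.trans j) D f.1 x := by
    intro j
    rw [obsOfSkew_apply, symmetrize_apply]
    congr 1
    refine Finset.sum_congr rfl fun π _ => ?_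
    rw [lift_apply, cslice_perm_trans]
    rfl
  simp only [h1]
  rw [← Finset.mul_sum, Finset.sum_comm]
  have h2 : ∀ π : Equiv.Perm (Fin k), ∑ j : Fin k ↪ Fin N, lift (π.toEmbedding.trans j) D f.1 x
      = ∑ j : Fin k ↪ Fin N, lift j D f.1 x := fun π =>
    Fintype.sum_equiv (Equiv.embeddingCongr π.symm (Equiv.refl _)) _ _ fun j => rfl
  simp only [h2, Finset.sum_const, Finset.card_univ, Fintype.card_perm, Fintype.card_fin,
    nsmul_eq_mul]
  rw [inv_mul_cancel_left₀ (by exact_mod_cast k.factorial_ne_zero)]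

theorem embed_eq_obsOfSkew (A : Obs d k) :
    embed N A = obsOfSkew (average N (fullOp A.1)) (isSkew_fullOp A).average := by
  conv_lhs => rw [← obsOfSkew_fullOp A]
  exact embed_obsOfSkew _ _

theorem embed_coe_apply (A : Obs d k) (f : SymSchwartz d N) :
    ((embed N A).1 f).1 = average N (fullOp A.1) f.1 := by
  ext x
  rw [embed_eq_obsOfSkew, obsOfSkew_apply, symmetrize_of_mem _ (fun π x => average_comp_perm _ f π x)]

end Symmetrization

/-! ### Operators acting on disjoint sets of particles commute -/

section Commutation

variable {d m N : ℕ}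

/-- The function `x ↦ ∏ᵢ bᵢ(xᵢ)`. -/
def tensor (b : Fin m → EuclideanSpace ℝ (Fin d) → ℝ) (hb : ∀ i, ContDiff ℝ (⊤ : ℕ∞) (b i))
    (hc : ∀ i, HasCompactSupport (b i)) : 𝓢(Conf d m, ℂ) :=
  HasCompactSupport.toSchwartzMap (f := fun x : Conf d m => ((∏ i, b i (x i) : ℝ) : ℂ))
    (by
      refine HasCompactSupport.of_support_subset_isCompact
        (isCompact_univ_pi fun i => (hc i).isCompact) fun x hx i _ => ?_
      refine subset_tsupport _ fun h => hx ?_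
      simp only
      rw [Finset.prod_eq_zero (Finset.mem_univ i) h, Complex.ofReal_zero])
    (by
      have h : ContDiff ℝ (⊤ : ℕ∞) fun x : Conf d m => ∏ i, b i (x i) :=
        contDiff_prod fun i _ => (hb i).comp (contDiff_apply ℝ _ i)
      exact Complex.ofRealCLM.contDiff.comp h)

@[simp] theorem tensor_apply (b : Fin m → EuclideanSpace ℝ (Fin d) → ℝ)
    (hb : ∀ i, ContDiff ℝ (⊤ : ℕ∞) (b i)) (hc : ∀ i, HasCompactSupport (b i)) (x : Conf d m) :
    tensor b hb hc x = ((∏ i, b i (x i) : ℝ) : ℂ) := rfl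

/-- If h(c) ≠ 0, a product of bumps concentrated near c has a nonzero inner product with h. This
replaces a density theorem for tensor products. -/
theorem eq_zero_of_sip_tensor {h : 𝓢(Conf d m, ℂ)} (H : ∀ b hb hc, sip (tensor b hb hc) h = 0) :
    h = 0 := by
  ext c
  by_contra hne
  rw [zero_apply] at hne
  have hpos : 0 < ‖h c‖ / 2 := half_pos (norm_pos_iff.2 hne)
  obtain ⟨δ, hδ, hclose⟩ := Metric.continuous_iff.1 h.continuous c _ hpos
  -- Distances between configurations are maxima over the particles, so bumps of outer radius δ/2
  -- confine the product to the ball of radius δ about c.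
  let B : (i : Fin m) → ContDiffBump (c i) := fun i => ⟨δ / 4, δ / 2, by positivity, by linarith⟩
  have hb : ∀ i, ContDiff ℝ (⊤ : ℕ∞) (B i) := fun i => (B i).contDiff
  have hc : ∀ i, HasCompactSupport (B i) := fun i => (B i).hasCompactSupport
  set g := tensor (fun i => B i) hb hc
  set G : Conf d m → ℝ := fun x => ∏ i, B i (x i)
  have hgG : ∀ x, g x = (G x : ℂ) := fun x => rfl
  have hG0 : ∀ x, 0 ≤ G x := fun x => Finset.prod_nonneg fun i _ => (B i).nonneg
  have hgi : Integrable g := g.integrable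
  have hGi : Integrable G := by
    refine hgi.norm.congr (Eventually.of_forall fun x => ?_)
    simp [hgG, abs_of_nonneg (hG0 x)]
  have hGc : Continuous G := continuous_finsetProd _ fun i _ =>
    (B i).continuous.comp (continuous_apply i)
  have hGpos : 0 < ∫ x, G x := by
    refine hGc.integral_pos_of_hasCompactSupport_nonneg_nonzero ?_ hG0 (x := c) ?_
    · refine HasCompactSupport.of_support_subset_isCompact
        (isCompact_univ_pi fun i => (hc i).isCompact) fun x hx i _ => ?_
      exact subset_tsupport _ fun h => hx (Finset.prod_eq_zero (Finset.mem_univ i) h)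
    · refine (Finset.prod_pos fun i _ => (B i).pos_of_mem_ball ?_).ne'
      exact Metric.mem_ball_self (by positivity)
  have h1 : ∫ x, (G x : ℂ) * h x = 0 := by
    rw [← H (fun i => B i) hb hc]
    refine integral_congr_ae (Eventually.of_forall fun x => ?_)
    simp [G]
  have h2 : ∫ x, (G x : ℂ) * (h x - h c) = -((∫ x, G x : ℝ) * h c) := by
    have hi1 : Integrable fun x => (G x : ℂ) * h x := by
      refine (integrable_conj_mul g h).congr (Eventually.of_forall fun x => ?_)
      simp [hgG]
    have hi2 : Integrable fun x => (G x : ℂ) * h c := hGi.ofReal.mul_const _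
    simp only [mul_sub]
    rw [integral_sub hi1 hi2, h1, integral_mul_const, zero_sub, integral_complex_ofReal]
  -- On the support of G, h differs from h(c) by at most ‖h c‖/2, while by `h2` this integral has
  -- norm ‖h c‖ ∫ G.
  have h3 : ‖∫ x, (G x : ℂ) * (h x - h c)‖ ≤ ∫ x, G x * (‖h c‖ / 2) := by
    refine norm_integral_le_of_norm_le (hGi.mul_const _) (Eventually.of_forall fun x => ?_)
    rw [norm_mul, Complex.norm_real, Real.norm_of_nonneg (hG0 x)]
    by_cases hx : dist x c < δ
    · have := (hclose x hx).le
      rw [dist_eq_norm] at this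
      exact mul_le_mul_of_nonneg_left this (hG0 x)
    · have : G x = 0 := by
        by_contra hGx
        refine hx ((dist_pi_lt_iff hδ).2 fun i => ?_)
        have : x i ∈ Function.support (B i) := fun h0 =>
          hGx (Finset.prod_eq_zero (Finset.mem_univ i) h0)
        rw [(B i).support_eq, Metric.mem_ball] at this
        exact this.trans (by simp only [B]; linarith)
      simp [this]
  rw [h2, norm_neg, norm_mul, Complex.norm_real, Real.norm_of_nonneg hGpos.le,
    integral_mul_const] at h3
  have := le_of_mul_le_mul_left h3 hGpos
  linarith

variable {k l : ℕ}

theorem lift_apply_of_factor (α : Fin k ↪ Fin N) (A : 𝓢(Conf d k, ℂ) →L[ℂ] 𝓢(Conf d k, ℂ))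
    {f : 𝓢(Conf d N, ℂ)} {x : Conf d N} {c : ℂ} {u : 𝓢(Conf d k, ℂ)}
    (h : ∀ z, f (moveTo α x z) = c * u z) : lift α A f x = c * A u (fun a => x (α a)) := by
  have h1 : cslice α x f = c • u := by
    ext z; rw [cslice_apply, h]; simp
  rw [lift_apply, h1]
  simp

theorem prod_moveTo (b : Fin N → EuclideanSpace ℝ (Fin d) → ℝ) (α : Fin k ↪ Fin N)
    (s : Finset (Fin N)) (hs : Disjoint (Finset.univ.map α) s) (x : Conf d N) (z : Conf d k) :
    ∏ i ∈ sᶜ, b i (moveTo α x z i)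
      = (∏ i ∈ (Finset.univ.map α ∪ s)ᶜ, b i (x i)) * ∏ a, b (α a) (z a) := by
  have h1 : sᶜ = (Finset.univ.map α ∪ s)ᶜ ∪ Finset.univ.map α := by
    ext i
    have h0 := Finset.disjoint_left.1 hs
    have := @h0 i
    simp only [Finset.mem_compl, Finset.mem_union]
    tauto
  have h2 : Disjoint (Finset.univ.map α ∪ s)ᶜ (Finset.univ.map α) := by
    rw [Finset.disjoint_left]
    intro i hi
    simp only [Finset.mem_compl, Finset.mem_union] at hi
    tauto
  rw [h1, Finset.prod_union h2, Finset.prod_map]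
  congr 1
  · refine Finset.prod_congr rfl fun i hi => ?_
    rw [moveTo_of_not]
    rintro ⟨a, rfl⟩
    simp at hi
  · simp [moveTo_self]

/-- On a product each operator sees only its own factors, so the result is symmetric under exchange
of the two disjoint tuples. -/
theorem lift_lift_tensor (b : Fin N → EuclideanSpace ℝ (Fin d) → ℝ)
    (hb : ∀ i, ContDiff ℝ (⊤ : ℕ∞) (b i)) (hc : ∀ i, HasCompactSupport (b i))
    (α : Fin k ↪ Fin N) (β : Fin l ↪ Fin N) (hd : ∀ a c, α a ≠ β c)
    (A : 𝓢(Conf d k, ℂ) →L[ℂ] 𝓢(Conf d k, ℂ)) (B : 𝓢(Conf d l, ℂ) →L[ℂ] 𝓢(Conf d l, ℂ))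
    (x : Conf d N) :
    lift α A (lift β B (tensor b hb hc)) x =
      ((∏ i ∈ (Finset.univ.map α ∪ Finset.univ.map β)ᶜ, b i (x i) : ℝ) : ℂ)
        * B (tensor (fun c => b (β c)) (fun _ => hb _) fun _ => hc _) (fun c => x (β c))
        * A (tensor (fun a => b (α a)) (fun _ => hb _) fun _ => hc _) (fun a => x (α a)) := by
  have h1 : ∀ y, lift β B (tensor b hb hc) y
      = ((∏ i ∈ (Finset.univ.map β)ᶜ, b i (y i) : ℝ) : ℂ)
        * B (tensor (fun c => b (β c)) (fun _ => hb _) fun _ => hc _) (fun c => y (β c)) := by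
    refine fun y => lift_apply_of_factor β B fun z => ?_
    have := prod_moveTo b β ∅ (by simp) y z
    rw [Finset.compl_empty, Finset.union_empty] at this
    rw [tensor_apply, tensor_apply, this, Complex.ofReal_mul]
  refine lift_apply_of_factor α A fun z => ?_
  have hdis : Disjoint (Finset.univ.map α) (Finset.univ.map β) := by
    rw [Finset.disjoint_left]
    intro i hi hi'
    simp only [Finset.mem_map, Finset.mem_univ, true_and] at hi hi'
    obtain ⟨a, rfl⟩ := hi
    obtain ⟨c, h⟩ := hi'
    exact hd a c h.symm
  have h2 : (fun c => moveTo α x z (β c)) = fun c => x (β c) := by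
    funext c
    exact moveTo_of_not _ _ _ _ fun ⟨a, h⟩ => hd a c h
  rw [h1, prod_moveTo b α _ hdis, h2, tensor_apply, Complex.ofReal_mul]
  ring

/-- The commutator kills tensor products. It is also skew-adjoint, so moving it onto a tensor
product shows that its value at any f is orthogonal to all of them. -/
theorem lift_commute (α : Fin k ↪ Fin N) (β : Fin l ↪ Fin N) (hd : ∀ a c, α a ≠ β c)
    {A : 𝓢(Conf d k, ℂ) →L[ℂ] 𝓢(Conf d k, ℂ)} {B : 𝓢(Conf d l, ℂ) →L[ℂ] 𝓢(Conf d l, ℂ)}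
    (hA : IsSkew A) (hB : IsSkew B) :
    lift α A ∘L lift β B - lift β B ∘L lift α A = 0 := by
  ext1 f
  refine eq_zero_of_sip_tensor fun b hb hc => ?_
  rw [(hA.lift α).commutator (hB.lift β)]
  have : (lift α A ∘L lift β B - lift β B ∘L lift α A) (tensor b hb hc) = 0 := by
    ext x
    simp only [sub_apply, ContinuousLinearMap.comp_apply, zero_apply]
    rw [lift_lift_tensor b hb hc α β hd, lift_lift_tensor b hb hc β α fun a c h => hd c a h.symm,
      Finset.union_comm]
    ring
  rw [this]
  simp [sip]

end Commutation

/-! ### Commutators of embedded observables -/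

section Counting

variable {k l m N : ℕ}

/-- Two tuples of particles have a particle in common. -/
def Overlap (p : (Fin l ↪ Fin N) × (Fin m ↪ Fin N)) : Prop := ∃ a c, p.1 a = p.2 c

/-- The `k`-tuples of particles that contain the two given tuples. -/
def Covers (γ : Fin k ↪ Fin N) (p : (Fin l ↪ Fin N) × (Fin m ↪ Fin N)) : Prop :=
  (∀ a, ∃ i, γ i = p.1 a) ∧ ∀ c, ∃ i, γ i = p.2 c

open Classical in
/-- The number of `k`-tuples of particles that contain the two given tuples. -/
def coverCount (k : ℕ) (p : (Fin l ↪ Fin N) × (Fin m ↪ Fin N)) : ℕ :=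
  (Finset.univ.filter fun γ : Fin k ↪ Fin N => Covers γ p).card

/-- The composition of a pair of tuples with an embedding. -/
def pairTrans (p : (Fin l ↪ Fin k) × (Fin m ↪ Fin k)) (γ : Fin k ↪ Fin N) :
    (Fin l ↪ Fin N) × (Fin m ↪ Fin N) := (p.1.trans γ, p.2.trans γ)

theorem coverCount_perm (p : (Fin l ↪ Fin N) × (Fin m ↪ Fin N)) (π : Equiv.Perm (Fin N)) :
    coverCount k (pairTrans p π.toEmbedding) = coverCount k p := by
  classical
  refine (Finset.card_bij (fun γ _ => γ.trans π.toEmbedding) ?_ ?_ ?_).symm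
  · intro γ hγ
    simp only [Finset.mem_filter, Finset.mem_univ, true_and] at hγ ⊢
    refine ⟨fun a => ?_, fun c => ?_⟩
    · obtain ⟨i, hi⟩ := hγ.1 a
      exact ⟨i, congrArg π hi⟩
    · obtain ⟨i, hi⟩ := hγ.2 c
      exact ⟨i, congrArg π hi⟩
  · intro γ _ γ' _ h
    ext i
    have := DFunLike.congr_fun h i
    simpa using congrArg Fin.val (π.injective this)
  · intro γ hγ
    simp only [Finset.mem_filter, Finset.mem_univ, true_and] at hγ
    refine ⟨γ.trans π.symm.toEmbedding, ?_, by ext i; simp⟩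
    simp only [Finset.mem_filter, Finset.mem_univ, true_and]
    refine ⟨fun a => ?_, fun c => ?_⟩
    · obtain ⟨i, hi⟩ := hγ.1 a
      exact ⟨i, (Equiv.symm_apply_eq π).2 hi⟩
    · obtain ⟨i, hi⟩ := hγ.2 c
      exact ⟨i, (Equiv.symm_apply_eq π).2 hi⟩

/-- The symmetric group acts transitively on k-tuples, so the count depends only on the pair inside
`Fin k`. The weights can therefore be built into a k-particle operator. -/
theorem coverCount_pairTrans (p : (Fin l ↪ Fin k) × (Fin m ↪ Fin k)) (γ γ' : Fin k ↪ Fin N) :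
    coverCount k (pairTrans p γ) = coverCount k (pairTrans p γ') := by
  obtain ⟨π, hπ⟩ := MulAction.isMultiplyPretransitive_iff.1
    (Equiv.Perm.isMultiplyPretransitive (Fin N) k) γ' γ
  rw [← coverCount_perm (pairTrans p γ') π]
  congr 1
  rw [← hπ]
  rfl

/-- Overlapping tuples occupy at most l + m - 1 particles, and never more than N, so some set of k
particles contains them. -/
theorem coverCount_pos (hk : k = min (l + m - 1) N) {p : (Fin l ↪ Fin N) × (Fin m ↪ Fin N)}
    (hp : Overlap p) : 0 < coverCount k p := by
  classical
  set U := Finset.univ.map p.1 ∪ Finset.univ.map p.2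
  have h1 : U.card + (Finset.univ.map p.1 ∩ Finset.univ.map p.2).card = l + m := by
    rw [Finset.card_union_add_card_inter]
    simp
  have h2 : 0 < (Finset.univ.map p.1 ∩ Finset.univ.map p.2).card := by
    obtain ⟨a, c, h⟩ := hp
    exact Finset.card_pos.2 ⟨p.1 a, Finset.mem_inter.2 ⟨by simp, by rw [h]; simp⟩⟩
  have h3 : U.card ≤ N := by simpa using Finset.card_le_univ U
  obtain ⟨V, hUV, hV⟩ := Finset.exists_superset_card_eq (s := U) (n := k) (by omega)
    (by rw [Fintype.card_fin]; omega)
  refine Finset.card_pos.2 ⟨(V.orderEmbOfFin hV).toEmbedding, ?_⟩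
  simp only [Finset.mem_filter, Finset.mem_univ, true_and]
  have h4 : ∀ i ∈ U, ∃ a, V.orderEmbOfFin hV a = i := fun i hi => by
    have : i ∈ Set.range (V.orderEmbOfFin hV) := by
      rw [Finset.range_orderEmbOfFin]
      exact hUV hi
    exact this
  exact ⟨fun a => h4 _ (by simp [U]), fun c => h4 _ (by simp [U])⟩

open Classical in
-- Double counting: a k-tuple γ and a pair inside `Fin k` amount to a pair covered by γ. Every
-- overlapping pair arises `coverCount` times, which the weight compensates.
theorem sum_overlap_eq {M : Type*} [AddCommGroup M] [Module ℝ M] (hk : k = min (l + m - 1) N)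
    (φ : (Fin l ↪ Fin N) × (Fin m ↪ Fin N) → M) (γ₀ : Fin k ↪ Fin N) :
    ∑ γ : Fin k ↪ Fin N, ∑ p : (Fin l ↪ Fin k) × (Fin m ↪ Fin k) with Overlap p,
        (coverCount k (pairTrans p γ₀) : ℝ)⁻¹ • φ (pairTrans p γ)
      = ∑ p : (Fin l ↪ Fin N) × (Fin m ↪ Fin N) with Overlap p, φ p := by
  have h1 : ∀ γ : Fin k ↪ Fin N, ∑ p : (Fin l ↪ Fin k) × (Fin m ↪ Fin k) with Overlap p,
        (coverCount k (pairTrans p γ₀) : ℝ)⁻¹ • φ (pairTrans p γ)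
      = ∑ q : (Fin l ↪ Fin N) × (Fin m ↪ Fin N) with Overlap q,
        if Covers γ q then (coverCount k q : ℝ)⁻¹ • φ q else 0 := by
    intro γ
    rw [← Finset.sum_filter]
    refine Finset.sum_nbij (fun p => pairTrans p γ) ?_ ?_ ?_ ?_
    · intro p hp
      simp only [Finset.mem_filter, Finset.mem_univ, true_and] at hp ⊢
      obtain ⟨a, c, h⟩ := hp
      exact ⟨⟨a, c, congrArg γ h⟩, fun a => ⟨_, rfl⟩, fun c => ⟨_, rfl⟩⟩
    · intro p _ q _ h
      have h' := Prod.ext_iff.1 h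
      refine Prod.ext (DFunLike.ext _ _ fun a => ?_) (DFunLike.ext _ _ fun a => ?_)
      · exact γ.injective (DFunLike.congr_fun h'.1 a)
      · exact γ.injective (DFunLike.congr_fun h'.2 a)
    · intro q hq
      simp only [Finset.coe_filter, Finset.mem_filter, Finset.mem_univ, true_and,
        Set.mem_ofPred_eq] at hq
      obtain ⟨⟨a, c, hac⟩, h, h'⟩ := hq
      choose α hα using h
      choose β hβ using h'
      refine ⟨(⟨α, fun a b hab => q.1.injective ?_⟩, ⟨β, fun a b hab => q.2.injective ?_⟩), ?_, ?_⟩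
      · rw [← hα, ← hα, hab]
      · rw [← hβ, ← hβ, hab]
      · simp only [Finset.coe_filter, Finset.mem_univ, true_and, Set.mem_ofPred_eq]
        exact ⟨a, c, γ.injective ((hα a).trans (hac.trans (hβ c).symm))⟩
      · exact Prod.ext (DFunLike.ext _ _ fun a => hα a) (DFunLike.ext _ _ fun a => hβ a)
    · intro p _
      rw [coverCount_pairTrans p γ₀ γ]
  simp only [h1]
  rw [Finset.sum_comm]
  refine Finset.sum_congr rfl fun q hq => ?_
  simp only [Finset.mem_filter, Finset.mem_univ, true_and] at hq
  rw [← Finset.sum_filter, Finset.sum_const, ← Nat.cast_smul_eq_nsmul ℝ, smul_smul]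
  have := coverCount_pos hk hq
  change ((coverCount k q : ℝ) * _) • _ = _
  rw [mul_inv_cancel₀ (by positivity), one_smul]

end Counting

/-! ### Commutators of embedded observables as embedded observables -/

section Bracket

variable {d k l m N : ℕ}

/-- The commutator of two operators acting on tuples of particles. -/
def liftCommutator (A : 𝓢(Conf d l, ℂ) →L[ℂ] 𝓢(Conf d l, ℂ))
    (B : 𝓢(Conf d m, ℂ) →L[ℂ] 𝓢(Conf d m, ℂ)) (p : (Fin l ↪ Fin N) × (Fin m ↪ Fin N)) :
    𝓢(Conf d N, ℂ) →L[ℂ] 𝓢(Conf d N, ℂ) :=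
  lift p.1 A ∘L lift p.2 B - lift p.2 B ∘L lift p.1 A

theorem lift_liftCommutator (A : 𝓢(Conf d l, ℂ) →L[ℂ] 𝓢(Conf d l, ℂ))
    (B : 𝓢(Conf d m, ℂ) →L[ℂ] 𝓢(Conf d m, ℂ)) (p : (Fin l ↪ Fin k) × (Fin m ↪ Fin k))
    (γ : Fin k ↪ Fin N) : lift γ (liftCommutator A B p) = liftCommutator A B (pairTrans p γ) := by
  rw [liftCommutator, lift_sub, lift_comp, lift_comp, lift_lift, lift_lift]
  rfl

open Classical in
/-- The commutator of two embedded observables comes from an observable of fewer particles. -/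
theorem exists_embed_eq_obsBracket (hk : k = min (l + m - 1) N) (A : Obs d l) (B : Obs d m) :
    ∃ C : Obs d k, embed N C = obsBracket (embed N A) (embed N B) := by
  have hkN : k ≤ N := hk ▸ min_le_right _ _
  set A' := fullOp A.1
  set B' := fullOp B.1
  have hA : IsSkew A' := isSkew_fullOp A
  have hB : IsSkew B' := isSkew_fullOp B
  set γ₀ : Fin k ↪ Fin N := Fin.castLEEmb hkN
  -- N comes from the bracket of 𝔤_N and the two inverse factors from the embeddings of A and B; the
  -- last factor cancels the normalization of the average over k-tuples.
  set c : ℝ := N * (N.descFactorial l : ℝ)⁻¹ * (N.descFactorial m : ℝ)⁻¹ * N.descFactorial k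
  set D : 𝓢(Conf d k, ℂ) →L[ℂ] 𝓢(Conf d k, ℂ) :=
    ∑ p : (Fin l ↪ Fin k) × (Fin m ↪ Fin k) with Overlap p,
      ((c * (coverCount k (pairTrans p γ₀) : ℝ)⁻¹ : ℝ) : ℂ) • liftCommutator A' B' p
  have hD : IsSkew D := IsSkew.sum _ fun p _ =>
    ((hA.lift p.1).commutator (hB.lift p.2)).smul _
  refine ⟨obsOfSkew D hD, ?_⟩
  rw [embed_obsOfSkew]
  ext f x
  rw [obsOfSkew_apply, symmetrize_of_mem _ (fun π x => average_comp_perm _ f π x), average_apply]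
  have h1 : ∑ γ : Fin k ↪ Fin N, lift γ D f.1 x
      = c * ∑ p : (Fin l ↪ Fin N) × (Fin m ↪ Fin N), liftCommutator A' B' p f.1 x := by
    have h2 : ∀ γ : Fin k ↪ Fin N, lift γ D f.1 x
        = c * ∑ p : (Fin l ↪ Fin k) × (Fin m ↪ Fin k) with Overlap p,
          (coverCount k (pairTrans p γ₀) : ℝ)⁻¹ • liftCommutator A' B' (pairTrans p γ) f.1 x := by
      intro γ
      simp only [D, lift_sum, lift_smul, lift_liftCommutator, Finset.mul_sum,
        _root_.sum_apply, smul_apply]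
      refine Finset.sum_congr rfl fun p _ => ?_
      simp [mul_assoc]
    simp only [h2]
    rw [← Finset.mul_sum,
      sum_overlap_eq hk (fun q => liftCommutator A' B' q f.1 x) γ₀, Finset.sum_filter]
    congr 1
    refine Finset.sum_congr rfl fun p _ => ?_
    -- The sum extends from overlapping pairs to all pairs because disjoint pairs commute.
    split_ifs with h
    · rfl
    · have : liftCommutator A' B' p = 0 :=
        lift_commute p.1 p.2 (fun a c hac => h ⟨a, c, hac⟩) hA hB
      rw [this]; rfl
  have h3 : ((obsBracket (embed N A) (embed N B)).1 f).1 x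
      = N * (average N A' (average N B' f.1) x - average N B' (average N A' f.1) x) := by
    have : ((obsBracket (embed N A) (embed N B)).1 f).1 x
        = ((N : ℝ) : ℂ) * ((((embed N A).1 ((embed N B).1 f)).1 x
          - ((embed N B).1 ((embed N A).1 f)).1 x)) := rfl
    rw [this, embed_coe_apply, embed_coe_apply, embed_coe_apply, embed_coe_apply]
    simp [A', B']
  have h4 : ∀ (a b : ℕ) (P : 𝓢(Conf d a, ℂ) →L[ℂ] 𝓢(Conf d a, ℂ))
      (Q : 𝓢(Conf d b, ℂ) →L[ℂ] 𝓢(Conf d b, ℂ)),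
      average N P (average N Q f.1) x = ((N.descFactorial a : ℕ) : ℂ)⁻¹ *
        ((N.descFactorial b : ℕ) : ℂ)⁻¹ * ∑ α : Fin a ↪ Fin N, ∑ β : Fin b ↪ Fin N,
          lift α P (lift β Q f.1) x := by
    intro a b P Q
    simp only [average, smul_apply, _root_.sum_apply, map_smul, map_sum, Finset.smul_sum,
      Finset.mul_sum, smul_eq_mul]
    push_cast
    simp only [mul_assoc]
    rw [Finset.sum_comm]
    simp only [mul_left_comm]
  rw [h3, h4, h4, h1]
  have h5 : ∑ p : (Fin l ↪ Fin N) × (Fin m ↪ Fin N), liftCommutator A' B' p f.1 x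
      = (∑ α : Fin l ↪ Fin N, ∑ β : Fin m ↪ Fin N, lift α A' (lift β B' f.1) x)
        - ∑ β : Fin m ↪ Fin N, ∑ α : Fin l ↪ Fin N, lift β B' (lift α A' f.1) x := by
    rw [Finset.sum_comm (f := fun (β : Fin m ↪ Fin N) (α : Fin l ↪ Fin N) =>
      lift β B' (lift α A' f.1) x), ← Finset.sum_sub_distrib, Fintype.sum_prod_type]
    refine Finset.sum_congr rfl fun α _ => ?_
    rw [← Finset.sum_sub_distrib]
    rfl
  rw [h5]
  have hk0 : ((N.descFactorial k : ℕ) : ℂ) ≠ 0 := by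
    have := Nat.descFactorial_pos.2 hkN
    exact_mod_cast this.ne'
  simp only [c]
  push_cast
  field_simp

end Bracket

/-! ### The strong dual of the Schwartz space -/

section StrongDual

variable {E : Type*} [NormedAddCommGroup E] [NormedSpace ℝ E]

theorem tendsto_strong_zero {Y : Type*} {l : Filter Y} {S : Y → 𝓢(E, ℂ) →L[ℂ] ℂ}
    (h : ∀ B, Bornology.IsVonNBounded ℂ B → ∀ ε > 0, ∀ᶠ p in l, ∀ f ∈ B, ‖S p f‖ ≤ ε) :
    Tendsto S l (𝓝 0) := by
  rw [(ContinuousLinearMap.hasBasis_nhds_zero_of_basis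
    (Metric.nhds_basis_closedBall (x := (0 : ℂ)))).tendsto_right_iff]
  rintro ⟨B, ε⟩ ⟨hB, hε⟩
  filter_upwards [h B hB ε hε] with p hp f hf
  simpa using hp f hf

theorem isVonNBounded_strong {S : Set (𝓢(E, ℂ) →L[ℂ] ℂ)}
    (h : ∀ B, Bornology.IsVonNBounded ℂ B → ∃ C, ∀ u ∈ S, ∀ f ∈ B, ‖u f‖ ≤ C) :
    Bornology.IsVonNBounded ℂ S := by
  rw [ContinuousLinearMap.isVonNBounded_iff]
  intro B hB
  obtain ⟨C, hC⟩ := h B hB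
  rw [NormedSpace.isVonNBounded_iff, isBounded_iff_forall_norm_le]
  refine ⟨C, ?_⟩
  rintro _ ⟨u, hu, f, hf, rfl⟩
  exact hC u hu f hf

theorem exists_bound_of_isVonNBounded {S : Set (𝓢(E, ℂ) →L[ℂ] ℂ)} {B : Set 𝓢(E, ℂ)}
    (hS : Bornology.IsVonNBounded ℂ S) (hB : Bornology.IsVonNBounded ℂ B) :
    ∃ C, ∀ u ∈ S, ∀ f ∈ B, ‖u f‖ ≤ C := by
  have h := ContinuousLinearMap.isVonNBounded_iff.1 hS B hB
  rw [NormedSpace.isVonNBounded_iff, isBounded_iff_forall_norm_le] at h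
  obtain ⟨C, hC⟩ := h
  exact ⟨C, fun u hu f hf => hC _ ⟨u, hu, f, hf, rfl⟩⟩

theorem exists_seminorm_bound {B : Set 𝓢(E, ℂ)} (hB : Bornology.IsVonNBounded ℂ B) (k n : ℕ) :
    ∃ C, ∀ f ∈ B, SchwartzMap.seminorm ℂ k n f ≤ C := by
  obtain ⟨C, -, hC⟩ :=
    (schwartz_withSeminorms ℂ E ℂ).isVonNBounded_iff_seminorm_bounded.1 hB (k, n)
  exact ⟨C, fun f hf => (hC f hf).le⟩

theorem isVonNBounded_schwartz {B : Set 𝓢(E, ℂ)}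
    (h : ∀ k n, ∃ C, ∀ f ∈ B, SchwartzMap.seminorm ℂ k n f ≤ C) : Bornology.IsVonNBounded ℂ B := by
  rw [(schwartz_withSeminorms ℂ E ℂ).isVonNBounded_iff_seminorm_bounded]
  rintro ⟨k, n⟩
  obtain ⟨C, hC⟩ := h k n
  exact ⟨max C 0 + 1, by positivity, fun f hf =>
    lt_of_le_of_lt ((hC f hf).trans (le_max_left _ _)) (lt_add_one _)⟩

/-- Strongly bounded sets of tempered distributions are equicontinuous. -/
theorem equicontinuous_of_isVonNBounded {S : Set (𝓢(E, ℂ) →L[ℂ] ℂ)}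
    (hS : Bornology.IsVonNBounded ℂ S) {ε : ℝ} (hε : 0 < ε) :
    ∀ᶠ f in 𝓝 (0 : 𝓢(E, ℂ)), ∀ u ∈ S, ‖u f‖ ≤ ε := by
  by_contra hcon
  obtain ⟨V, hV⟩ := (𝓝 (0 : 𝓢(E, ℂ))).exists_antitone_basis
  -- A uniform boundedness argument: were equicontinuity to fail, there would be fₙ with (n+1)fₙ → 0
  -- and functionals uₙ in S with ‖uₙ fₙ‖ > ε. The sequence (n+1)fₙ is bounded, yet uₙ is larger
  -- than (n+1)ε on it.
  have h1 : ∀ n : ℕ, ∃ f : 𝓢(E, ℂ), ((n + 1 : ℕ) : ℂ) • f ∈ V n ∧ ∃ u ∈ S, ε < ‖u f‖ := by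
    intro n
    have hc : Tendsto (fun f : 𝓢(E, ℂ) => ((n + 1 : ℕ) : ℂ) • f) (𝓝 0) (𝓝 0) :=
      (continuous_const_smul _).tendsto' _ _ (smul_zero _)
    obtain ⟨f, hf, hf'⟩ :=
      ((not_eventually.1 hcon).and_eventually (hc.eventually (hV.mem n))).exists
    push Not at hf
    exact ⟨f, hf', hf⟩
  choose f hf u hu hlt using h1
  have h2 : Tendsto (fun n : ℕ => ((n + 1 : ℕ) : ℂ) • f n) atTop (𝓝 0) :=
    hV.tendsto hf
  obtain ⟨C, hC⟩ := exists_bound_of_isVonNBounded hS (h2.isVonNBounded_range ℂ)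
  obtain ⟨n, hn⟩ := exists_nat_gt (C / ε)
  have h3 := hC (u n) (hu n) _ ⟨n, rfl⟩
  rw [map_smul, norm_smul, Complex.norm_natCast] at h3
  rw [div_lt_iff₀ hε] at hn
  have h4 : (n : ℝ) * ε ≤ ((n + 1 : ℕ) : ℝ) * ‖u n (f n)‖ := by
    have := (hlt n).le
    gcongr
    simp
  linarith

end StrongDual

/-! ### Dirac masses and their symmetrization -/

section Delta

variable {d k : ℕ}

/-- Convergence in the strong dual: the Taylor remainder is uniform over a bounded set of f, on
which the second directional derivative is uniformly bounded. -/
theorem tendsto_evalAt (x v : Conf d k) :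
    Tendsto (fun t : ℝ => t⁻¹ • (evalAt (x + t • v) - evalAt x)) (𝓝[≠] 0)
      (𝓝 ((evalAt x).comp (dir v))) := by
  rw [← tendsto_sub_nhds_zero_iff]
  refine tendsto_strong_zero fun B hB ε hε => ?_
  obtain ⟨C, hC⟩ := exists_seminorm_bound
    (hB.image (σ := RingHom.id ℂ) ((dir v).comp (dir v))) 0 0
  have h1 : Tendsto (fun t : ℝ => |t| * C) (𝓝[≠] 0) (𝓝 0) := by
    have : Continuous fun t : ℝ => |t| * C := by fun_prop
    simpa using (this.tendsto 0).mono_left nhdsWithin_le_nhds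
  filter_upwards [h1.eventually (gt_mem_nhds hε), self_mem_nhdsWithin] with t h2 h3 f hf
  have h4 := norm_line_taylor_le (g := f) (hasDerivAt_dir v f) (hasDerivAt_dir v (dir v f))
    (C := C) x t fun s _ =>
      (SchwartzMap.norm_le_seminorm ℂ _ _).trans (hC _ ⟨f, hf, rfl⟩)
  have htc : (t : ℂ) ≠ 0 := by
    have : t ≠ 0 := h3
    exact_mod_cast this
  have h5 : (t⁻¹ • (evalAt (x + t • v) - evalAt x) - (evalAt x).comp (dir v)) f
      = (t : ℂ)⁻¹ * (f (x + t • v) - f x - t * dir v f x) := by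
    simp only [sub_apply, smul_apply, evalAt_apply, ContinuousLinearMap.comp_apply]
    rw [Complex.real_smul]; push_cast; field_simp
  have ht' : 0 < |t| := abs_pos.2 h3
  rw [h5, norm_mul, norm_inv, Complex.norm_real, Real.norm_eq_abs]
  calc _ ≤ |t|⁻¹ * (C * |t| ^ 2) := by gcongr
    _ = |t| * C := by field_simp
    _ ≤ ε := h2.le

/-- Symmetrization of tempered distributions. -/
def symFunctional (d k : ℕ) : (𝓢(Conf d k, ℂ) →L[ℂ] ℂ) →L[ℂ] SymTempered d k :=
  (ContinuousLinearMap.precomp ℂ ((SymSchwartz d k).subtypeL ∘L symmetrize d k)).codRestrict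
    (SymTempered d k) fun u π f => by
      have h : symmetrize d k (permSchwartz d π f) = symmetrize d k f := by
        ext x
        rw [symmetrize_apply, symmetrize_apply]
        congr 1
        exact Fintype.sum_equiv (Equiv.mulRight π) _ _ (fun σ => rfl)
      change u (symmetrize d k (permSchwartz d π f)).1 = u (symmetrize d k f).1
      rw [h]

theorem symFunctional_apply (u : 𝓢(Conf d k, ℂ) →L[ℂ] ℂ) (f : 𝓢(Conf d k, ℂ)) :
    (symFunctional d k u).1 f = u (symmetrize d k f).1 := rfl

theorem symFunctional_evalAt (x : Conf d k) : symFunctional d k (evalAt x) = symDelta x := by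
  ext f
  rw [symFunctional_apply, evalAt_apply, symmetrize_apply]
  simp [symDelta]

theorem symDelta_apply (x : Conf d k) (f : 𝓢(Conf d k, ℂ)) :
    (symDelta x).1 f = (symmetrize d k f).1 x := by
  rw [← symFunctional_evalAt, symFunctional_apply, evalAt_apply]

theorem symDelta_comp_perm (π : Equiv.Perm (Fin k)) (x : Conf d k) :
    symDelta (x ∘ π) = symDelta x := by
  ext f
  rw [symDelta_apply, symDelta_apply, (symmetrize d k f).2]

/-! ### Schwartz kernels -/

/-- Evaluation of continuous linear maps at a vector. -/
def evalLM {V W : Type*} [AddCommGroup V] [Module ℂ V] [TopologicalSpace V]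
    [AddCommGroup W] [Module ℂ W] [TopologicalSpace W] [IsTopologicalAddGroup W]
    [ContinuousSMul ℂ W] (v : V) : (V →L[ℂ] W) →ₗ[ℂ] W where
  toFun T := T v
  map_add' _ _ := rfl
  map_smul' _ _ := rfl

/-- The derivative of x ↦ δ_x along v is δ_x ∘ ∂_v, so precomposing Dirac masses with operators D
gives a class closed under derivatives. -/
theorem isVectorSchwartzFamily_kernel (d k : ℕ) :
    IsVectorSchwartzFamily (X := SymTempered d k →L[ℂ] 𝓢(Conf d k, ℂ))
      (Module.finBasis ℝ (Conf d k))
      {θ | ∃ D : 𝓢(Conf d k, ℂ) →L[ℂ] 𝓢(Conf d k, ℂ),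
        θ = fun x => evalLM (symFunctional d k ((evalAt x).comp D))} := by
  constructor
  · rintro θ ⟨D, rfl⟩ i
    set v := Module.finBasis ℝ (Conf d k) i
    refine ⟨_, ⟨dir v ∘L D, rfl⟩, fun T x => ?_⟩
    let L : (𝓢(Conf d k, ℂ) →L[ℂ] ℂ) →L[ℂ] 𝓢(Conf d k, ℂ) :=
      T ∘L symFunctional d k ∘L ContinuousLinearMap.precomp ℂ D
    refine ((L.continuous.tendsto _).comp (tendsto_evalAt x v)).congr fun t => ?_
    have h7 : ∀ u, L (t⁻¹ • u) = t⁻¹ • L u := fun f => L.map_smul_of_tower _ _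
    rw [Function.comp_apply, h7, map_sub]
    rfl
  · rintro θ ⟨D, rfl⟩ m U hU
    -- The weighted Dirac masses are strongly bounded, so operators small for bounded convergence
    -- send them all into U.
    have hB : Bornology.IsVonNBounded ℂ
        (Set.range fun x : Conf d k => ((‖x‖ ^ m : ℝ) : ℂ) • (evalAt x).comp D) := by
      refine isVonNBounded_strong fun B hB => ?_
      obtain ⟨C, hC⟩ := exists_seminorm_bound (hB.image (σ := RingHom.id ℂ) D) m 0
      refine ⟨C, ?_⟩
      rintro _ ⟨x, rfl⟩ f hf
      refine le_trans (le_of_eq ?_)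
        ((SchwartzMap.norm_pow_mul_le_seminorm ℂ (D f) m x).trans (hC _ ⟨f, hf, rfl⟩))
      simp
    have hB' := hB.image (σ := RingHom.id ℂ) (symFunctional d k)
    filter_upwards [ContinuousLinearMap.eventually_nhds_zero_mapsTo hB' hU] with T hT x
    have h1 := hT ⟨_, ⟨x, rfl⟩, rfl⟩
    rw [map_smul, map_smul] at h1
    exact h1

/-- The Schwartz kernel of an operator from distributions to functions, as a Schwartz function. -/
def kernelCLM (d k : ℕ) :
    (SymTempered d k →L[ℂ] 𝓢(Conf d k, ℂ)) →L[ℂ] 𝓢(Conf d k × Conf d k, ℂ) :=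
  (isVectorSchwartzFamily_kernel d k).uncurryCLM ⟨ContinuousLinearMap.id ℂ _, rfl⟩

theorem kernelCLM_apply (T : SymTempered d k →L[ℂ] 𝓢(Conf d k, ℂ)) (x x' : Conf d k) :
    kernelCLM d k T (x, x') = T (symDelta x') x := by
  rw [← symFunctional_evalAt]
  rfl

/-- The kernel of a density matrix, as a Schwartz function. -/
def dmKernel (Ψ : SymTempered d k →L[ℂ] SymSchwartz d k) : 𝓢(Conf d k × Conf d k, ℂ) :=
  kernelCLM d k ((SymSchwartz d k).subtypeL ∘L Ψ)

theorem dmKernel_apply (Ψ : SymTempered d k →L[ℂ] SymSchwartz d k) (x x' : Conf d k) :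
    dmKernel Ψ (x, x') = kernel Ψ x x' := kernelCLM_apply _ x x'

/-- The operator with a given kernel applied to a distribution. -/
def applyKernel (K : 𝓢(Conf d k × Conf d k, ℂ)) (u : 𝓢(Conf d k, ℂ) →L[ℂ] ℂ) : 𝓢(Conf d k, ℂ) :=
  partialApply (SchwartzMap.compCLMOfContinuousLinearEquiv ℂ
    (ContinuousLinearEquiv.prodComm ℝ (Conf d k) (Conf d k)) K) u

/-- The function `K(x; ·)`. -/
def kernelRow (K : 𝓢(Conf d k × Conf d k, ℂ)) (x : Conf d k) : 𝓢(Conf d k, ℂ) :=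
  sliceAt x (SchwartzMap.compCLMOfContinuousLinearEquiv ℂ
    (ContinuousLinearEquiv.prodComm ℝ (Conf d k) (Conf d k)) K)

@[simp] theorem kernelRow_apply (K : 𝓢(Conf d k × Conf d k, ℂ)) (x x' : Conf d k) :
    kernelRow K x x' = K (x, x') := rfl

theorem applyKernel_apply (K : 𝓢(Conf d k × Conf d k, ℂ)) (u : 𝓢(Conf d k, ℂ) →L[ℂ] ℂ)
    (x : Conf d k) : applyKernel K u x = u (kernelRow K x) := rfl

/-- The weighted rows of a fixed kernel form a bounded set, on which a strongly small functional is
uniformly small. -/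
theorem tendsto_applyKernel_right (K : 𝓢(Conf d k × Conf d k, ℂ)) :
    Tendsto (applyKernel K) (𝓝 0) (𝓝 0) := by
  refine tendsto_partialApply fun D m ε hε => ?_
  set f := D (SchwartzMap.compCLMOfContinuousLinearEquiv ℂ
    (ContinuousLinearEquiv.prodComm ℝ (Conf d k) (Conf d k)) K)
  have hB : Bornology.IsVonNBounded ℂ
      (Set.range fun x : Conf d k => (‖x‖ ^ m : ℝ) • sliceAt x f) := by
    refine isVonNBounded_schwartz fun a b => ?_
    have h1 : ∀ᶠ g in 𝓝 (0 : 𝓢(Conf d k × Conf d k, ℂ)), ∀ x : Conf d k,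
        SchwartzMap.seminorm ℝ a b ((‖x‖ ^ m : ℝ) • sliceAt x g) ≤ 1 :=
      eventually_smul_sliceAt_mem m (eventually_seminorm_le a b one_pos)
    obtain ⟨C, hC⟩ := exists_bound_of_eventually
      (N := fun g (x : Conf d k) => SchwartzMap.seminorm ℝ a b ((‖x‖ ^ m : ℝ) • sliceAt x g))
      (fun c g x => by
        have h : (‖x‖ ^ m : ℝ) • sliceAt x (c • g) = c • ((‖x‖ ^ m : ℝ) • sliceAt x g) := by
          rw [(sliceAt x).map_smul, smul_comm]
        rw [h]
        exact map_smul_eq_mul (SchwartzMap.seminorm ℂ a b) c _) h1 f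
    refine ⟨C, ?_⟩
    rintro _ ⟨x, rfl⟩
    exact hC x
  have := ContinuousLinearMap.eventually_nhds_zero_mapsTo (𝕜₁ := ℂ) (𝕜₂ := ℂ)
    (σ := RingHom.id ℂ) (F := ℂ) hB (Metric.closedBall_mem_nhds (0 : ℂ) hε)
  filter_upwards [this] with u hu x
  have h2 := hu ⟨x, rfl⟩
  have h7 : ∀ f : 𝓢(Conf d k, ℂ), u ((‖x‖ ^ m : ℝ) • f) = (‖x‖ ^ m : ℝ) • u f :=
    fun f => u.map_smul_of_tower _ _
  rw [mem_closedBall_zero_iff, h7, norm_smul, norm_pow, norm_norm] at h2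
  exact h2

/-- Strongly bounded sets are equicontinuous, so small rows give small values uniformly over B. This
is continuity of K ↦ `ofKernel K` for bounded convergence. -/
theorem tendsto_applyKernel {B : Set (𝓢(Conf d k, ℂ) →L[ℂ] ℂ)} (hB : Bornology.IsVonNBounded ℂ B) :
    Tendsto (fun p : 𝓢(Conf d k × Conf d k, ℂ) × (𝓢(Conf d k, ℂ) →L[ℂ] ℂ) => applyKernel p.1 p.2)
      (𝓝 0 ×ˢ 𝓟 B) (𝓝 0) := by
  refine tendsto_partialApply fun D m ε hε => ?_
  have h1 := eventually_smul_sliceAt_mem (E := Conf d k) m (equicontinuous_of_isVonNBounded hB hε)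
  let L := D ∘L (SchwartzMap.compCLMOfContinuousLinearEquiv (F := ℂ) ℂ
    (ContinuousLinearEquiv.prodComm ℝ (Conf d k) (Conf d k)))
  have h2 := (L.continuous.tendsto' 0 0 (map_zero L)).eventually h1
  filter_upwards [h2.prod_mk (mem_principal_self B)] with p hp x
  have h3 := hp.1 x p.2 hp.2
  have h7 : ∀ f : 𝓢(Conf d k, ℂ), p.2 ((‖x‖ ^ m : ℝ) • f) = (‖x‖ ^ m : ℝ) • p.2 f :=
    fun f => p.2.map_smul_of_tower _ _
  rw [h7, norm_smul, norm_pow, norm_norm] at h3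
  exact h3

/-- The operator with a given kernel. -/
def ofKernel (K : 𝓢(Conf d k × Conf d k, ℂ)) : SymTempered d k →L[ℂ] SymSchwartz d k :=
  symmetrize d k ∘L
    ({ toFun := applyKernel K
       map_add' := fun u v => by ext x; simp [applyKernel_apply]
       map_smul' := fun c u => by ext x; simp [applyKernel_apply]
       cont := by
        let L : (𝓢(Conf d k, ℂ) →L[ℂ] ℂ) →+ 𝓢(Conf d k, ℂ) := AddMonoidHom.mk' (applyKernel K)
          fun u v => by ext x; simp [applyKernel_apply]
        refine continuous_of_continuousAt_zero L ?_
        rw [ContinuousAt, map_zero]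
        exact tendsto_applyKernel_right K } : (𝓢(Conf d k, ℂ) →L[ℂ] ℂ) →L[ℂ] 𝓢(Conf d k, ℂ)) ∘L
    (SymTempered d k).subtypeL

theorem ofKernel_apply (K : 𝓢(Conf d k × Conf d k, ℂ)) (u : SymTempered d k) :
    ofKernel K u = symmetrize d k (applyKernel K u.1) := rfl

/-- The operator with a given kernel depends continuously on the kernel. -/
def ofKernelCLM (d k : ℕ) :
    𝓢(Conf d k × Conf d k, ℂ) →L[ℂ] SymTempered d k →L[ℂ] SymSchwartz d k where
  toFun := ofKernel
  map_add' K K' := by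
    ext1 u
    rw [add_apply, ofKernel_apply, ofKernel_apply, ofKernel_apply, ← map_add]
    congr 1
    ext x
    have : kernelRow (K + K') x = kernelRow K x + kernelRow K' x := by ext; simp
    simp [applyKernel_apply, this]
  map_smul' c K := by
    ext1 u
    rw [smul_apply, ofKernel_apply, ofKernel_apply, RingHom.id_apply, ← map_smul]
    congr 1
    ext x
    have : kernelRow (c • K) x = c • kernelRow K x := by ext; simp
    simp [applyKernel_apply, this]
  cont := by
    let L : 𝓢(Conf d k × Conf d k, ℂ) →+ (SymTempered d k →L[ℂ] SymSchwartz d k) :=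
      AddMonoidHom.mk' ofKernel fun K K' => by
        ext1 u
        rw [add_apply, ofKernel_apply, ofKernel_apply, ofKernel_apply, ← map_add]
        congr 1
        ext x
        have : kernelRow (K + K') x = kernelRow K x + kernelRow K' x := by ext; simp
        simp [applyKernel_apply, this]
    refine continuous_of_continuousAt_zero L ?_
    rw [ContinuousAt, map_zero, ContinuousLinearMap.hasBasis_nhds_zero.tendsto_right_iff]
    rintro ⟨B, U⟩ ⟨hB, hU⟩
    have h1 := tendsto_applyKernel (hB.image (σ := RingHom.id ℂ) (SymTempered d k).subtypeL)
    have h2 := ((symmetrize d k).continuous.tendsto' 0 0 (map_zero _)).comp h1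
    have h3 := h2 hU
    rw [Filter.mem_map, mem_prod_principal] at h3
    filter_upwards [h3] with K hK u hu
    exact hK u.1 ⟨u, hu, rfl⟩

/-- The symmetrization in `ofKernel` does nothing when K is symmetric in its first variable. -/
theorem hasKernel_ofKernel {K : 𝓢(Conf d k × Conf d k, ℂ)}
    (hK : ∀ (π : Equiv.Perm (Fin k)) x x', K (x ∘ π, x') = K (x, x')) :
    HasKernel (ofKernel K) fun x x' => K (x, x') := fun x =>
  ⟨kernelRow K x, fun x' => rfl, fun u => by
    rw [ofKernel_apply, symmetrize_of_mem]
    · rfl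
    · intro π y
      rw [applyKernel_apply, applyKernel_apply]
      congr 1
      ext x'
      exact hK π y x'⟩

theorem HasKernel.unique {γ γ' : SymTempered d k →L[ℂ] SymSchwartz d k}
    {K : Conf d k → Conf d k → ℂ} (h : HasKernel γ K) (h' : HasKernel γ' K) : γ = γ' := by
  ext u x
  obtain ⟨κ, hκ, hu⟩ := h x
  obtain ⟨κ', hκ', hu'⟩ := h' x
  have : κ = κ' := by ext x'; rw [hκ, hκ']
  rw [hu, hu', this]

/-- `kernel` tests against symmetrized Dirac masses, so it recovers K only if K is symmetric in its
second variable. -/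
theorem HasKernel.kernel_eq {γ : SymTempered d k →L[ℂ] SymSchwartz d k}
    {K : Conf d k → Conf d k → ℂ} (h : HasKernel γ K)
    (hK : ∀ (π : Equiv.Perm (Fin k)) x x', K x (x' ∘ π) = K x x') (x x' : Conf d k) :
    kernel γ x x' = K x x' := by
  obtain ⟨κ, hκ, hu⟩ := h x
  rw [kernel, hu, symDelta_apply, symmetrize_of_mem, hκ]
  intro π y
  rw [hκ, hκ, hK]

/-- Fubini applies because K is integrable and f and g are bounded. -/
theorem HasKernel.mem_DM {K : 𝓢(Conf d k × Conf d k, ℂ)}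
    {γ : SymTempered d k →L[ℂ] SymSchwartz d k} (h : HasKernel γ fun x x' => K (x, x'))
    (hK : ∀ x x', K (x, x') = (starRingEnd ℂ) (K (x', x))) : γ ∈ DM d k := by
  have h1 : ∀ (g : SymSchwartz d k) x, (γ (toTempered g)).1 x = ∫ x', g.1 x' * K (x, x') :=
    fun g x => by
      obtain ⟨κ, hκ, hu⟩ := h x
      rw [hu, toTempered_apply]
      simp only [hκ]
  intro f g
  have hi : Integrable (fun p : Conf d k × Conf d k =>
      (starRingEnd ℂ) (f.1 p.1) * (g.1 p.2 * K (p.1, p.2))) := by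
    obtain ⟨C, hC⟩ : ∃ C, ∀ x, ‖f.1 x‖ ≤ C := ⟨_, fun x => f.1.norm_le_seminorm ℂ x⟩
    obtain ⟨C', hC'⟩ : ∃ C, ∀ x, ‖g.1 x‖ ≤ C := ⟨_, fun x => g.1.norm_le_seminorm ℂ x⟩
    refine Integrable.bdd_mul (c := C) (Integrable.bdd_mul (c := C') (K.integrable (μ := volume))
      ?_ (Eventually.of_forall fun x => hC' _)) ?_ (Eventually.of_forall fun x => ?_)
    · exact (g.1.continuous.comp continuous_snd).aestronglyMeasurable
    · exact (Complex.continuous_conj.comp (f.1.continuous.comp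
        continuous_fst)).aestronglyMeasurable
    · simpa using hC x.1
  have h2 : ip f (γ (toTempered g))
      = ∫ x, ∫ x', (starRingEnd ℂ) (f.1 x) * (g.1 x' * K (x, x')) := by
    simp only [ip, h1, integral_const_mul]
  have h3 : ip (γ (toTempered f)) g
      = ∫ x, ∫ x', (starRingEnd ℂ) (f.1 x') * (g.1 x * K (x', x)) := by
    simp only [ip, h1, ← integral_conj, ← integral_mul_const, map_mul, ← hK]
    congr 1; ext x; congr 1; ext x'; ring
  rw [h2, h3]
  exact integral_integral_swap hi

end Delta

section Hermitian

variable {d k : ℕ}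

/-! ### Approximation of Dirac masses -/

/-- The functional `φ ↦ ∫ b φ` attached to a Schwartz function `b`. -/
def integrateAgainst (b : 𝓢(Conf d k, ℂ)) : 𝓢(Conf d k, ℂ) →L[ℂ] ℂ :=
  (SchwartzMap.integralCLM ℂ (volume : Measure (Conf d k))) ∘L
    (SchwartzMap.smulLeftCLM ℂ (fun x => b x))

theorem integrateAgainst_apply (b φ : 𝓢(Conf d k, ℂ)) :
    integrateAgainst b φ = ∫ x, b x * φ x := by
  simp [integrateAgainst, SchwartzMap.integralCLM_apply,
    SchwartzMap.smulLeftCLM_apply_apply b.hasTemperateGrowth]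

theorem toTempered_symmetrize (b : 𝓢(Conf d k, ℂ)) :
    toTempered (symmetrize d k b) = symFunctional d k (integrateAgainst b) := by
  ext φ
  rw [toTempered_apply, symFunctional_apply, integrateAgainst_apply]
  have hi : ∀ f g : 𝓢(Conf d k, ℂ), Integrable fun x => f x * g x := fun f g => by
    obtain ⟨C, hC⟩ : ∃ C, ∀ x, ‖f x‖ ≤ C := ⟨_, fun x => f.norm_le_seminorm ℂ x⟩
    exact (g.integrable (μ := volume)).bdd_mul (c := C) f.continuous.aestronglyMeasurable
      (Eventually.of_forall hC)
  simp only [symmetrize_apply, mul_assoc, mul_left_comm (b _), integral_const_mul,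
    Finset.sum_mul]
  congr 1
  simp only [Finset.mul_sum]
  have h1 := integral_finsetSum (μ := (volume : Measure (Conf d k))) Finset.univ
    fun (π : Equiv.Perm (Fin k)) _ => hi (permSchwartz d π b) φ
  have h2 := integral_finsetSum (μ := (volume : Measure (Conf d k))) Finset.univ
    fun (π : Equiv.Perm (Fin k)) _ => hi b (permSchwartz d π φ)
  simp only [permSchwartz_apply] at h1 h2
  rw [h1, h2]
  refine Fintype.sum_equiv (Equiv.inv _) _ _ fun π => ?_
  rw [← integral_comp_perm d π⁻¹]
  congr 1
  ext x
  congr 2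
  funext i
  simp

/-- Normalized bumps of radius 1/(n+1) converge strongly because a bounded set of Schwartz functions
has a common Lipschitz constant. They are real, so that pairing with them coincides with the
sesquilinear inner product. -/
theorem exists_tendsto_evalAt (x : Conf d k) :
    ∃ b : ℕ → 𝓢(Conf d k, ℂ), (∀ n y, (starRingEnd ℂ) (b n y) = b n y) ∧
      Tendsto (fun n => integrateAgainst (b n)) atTop (𝓝 (evalAt x)) := by
  let β : ℕ → ContDiffBump x := fun n => ⟨1 / (2 * (n + 1)), 1 / (n + 1), by positivity, by
    apply one_div_lt_one_div_of_lt <;> linarith [(n.cast_nonneg : (0 : ℝ) ≤ n)]⟩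
  have hsm : ∀ n, ContDiff ℝ ((⊤ : ℕ∞) : WithTop ℕ∞)
      fun y => (((β n).normed volume y : ℝ) : ℂ) := fun n =>
    Complex.ofRealCLM.contDiff.comp (β n).contDiff_normed
  have hcs : ∀ n, HasCompactSupport fun y => (((β n).normed volume y : ℝ) : ℂ) := fun n =>
    (β n).hasCompactSupport_normed.comp_left (g := ((↑) : ℝ → ℂ)) Complex.ofReal_zero
  let b : ℕ → 𝓢(Conf d k, ℂ) := fun n => (hcs n).toSchwartzMap (hsm n)
  have hb : ∀ n y, b n y = (((β n).normed volume y : ℝ) : ℂ) := fun n y => rfl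
  refine ⟨b, fun n y => by rw [hb, Complex.conj_ofReal], ?_⟩
  rw [← tendsto_sub_nhds_zero_iff]
  refine tendsto_strong_zero fun B hB ε hε => ?_
  obtain ⟨C, hC⟩ := exists_seminorm_bound hB 0 1
  have h1 : Tendsto (fun n : ℕ => C * (1 / ((n : ℝ) + 1))) atTop (𝓝 0) := by
    simpa using tendsto_one_div_add_atTop_nhds_zero_nat.const_mul C
  filter_upwards [h1.eventually (gt_mem_nhds hε)] with n hn f hf
  have hd : ∀ y, ‖fderiv ℝ f y‖ ≤ C := fun y => by
    have := SchwartzMap.norm_iteratedFDeriv_le_seminorm ℂ f 1 y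
    rw [norm_iteratedFDeriv_one] at this
    exact this.trans (hC f hf)
  have hl : ∀ y, ‖f y - f x‖ ≤ C * ‖y - x‖ := fun y =>
    convex_univ.norm_image_sub_le_of_norm_fderiv_le (fun y _ => f.differentiableAt)
      (fun y _ => hd y) (Set.mem_univ x) (Set.mem_univ y)
  have hC0 : 0 ≤ C := (norm_nonneg _).trans (hd x)
  have hint : Integrable (fun y => ((β n).normed volume y : ℝ)) (volume : Measure (Conf d k)) :=
    (β n).integrable_normed
  have hint' : Integrable (fun y => b n y * f y) := by
    obtain ⟨C', hC'⟩ : ∃ C, ∀ x, ‖f x‖ ≤ C := ⟨_, fun x => f.norm_le_seminorm ℂ x⟩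
    exact ((b n).integrable (μ := volume)).mul_bdd (c := C') f.continuous.aestronglyMeasurable
      (Eventually.of_forall hC')
  have h2 : (integrateAgainst (b n) - evalAt x) f = ∫ y, b n y * (f y - f x) := by
    rw [sub_apply, evalAt_apply, integrateAgainst_apply]
    simp only [mul_sub]
    rw [integral_sub hint' (((b n).integrable (μ := volume)).mul_const _), integral_mul_const]
    simp only [hb]
    rw [integral_complex_ofReal, (β n).integral_normed]
    simp
  rw [h2]
  refine (norm_integral_le_of_norm_le (hint.mul_const (C * (1 / ((n : ℝ) + 1))))
    (Eventually.of_forall fun y => ?_)).trans ?_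
  · rw [norm_mul, hb, Complex.norm_real, Real.norm_of_nonneg ((β n).nonneg_normed y)]
    by_cases hy : y ∈ Metric.ball x (β n).rOut
    · refine mul_le_mul_of_nonneg_left ((hl y).trans ?_) ((β n).nonneg_normed y)
      rw [mem_ball_iff_norm] at hy
      exact mul_le_mul_of_nonneg_left hy.le hC0
    · rw [← (β n).support_normed_eq (μ := volume), Function.notMem_support] at hy
      rw [hy, zero_mul, zero_mul]
  · rw [integral_mul_const, (β n).integral_normed, one_mul]
    exact hn.le

theorem exists_tendsto_symDelta (x : Conf d k) :
    ∃ s : ℕ → SymSchwartz d k, (∀ n y, (starRingEnd ℂ) ((s n).1 y) = (s n).1 y) ∧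
      Tendsto (fun n => toTempered (s n)) atTop (𝓝 (symDelta x)) := by
  obtain ⟨b, hb, hlim⟩ := exists_tendsto_evalAt x
  refine ⟨fun n => symmetrize d k (b n), fun n y => ?_, ?_⟩
  · rw [symmetrize_apply]
    simp [hb]
  · simp only [toTempered_symmetrize, ← symFunctional_evalAt]
    exact ((symFunctional d k).continuous.tendsto _).comp hlim

theorem continuous_apply_fun (f : 𝓢(Conf d k, ℂ)) :
    Continuous fun u : SymTempered d k => u.1 f :=
  (continuous_eval_const f).comp continuous_subtype_val

/-- The kernel of a self-adjoint operator is hermitian. -/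
theorem kernel_conj (Ψ : DM d k) (x x' : Conf d k) :
    kernel Ψ.1 x x' = (starRingEnd ℂ) (kernel Ψ.1 x' x) := by
  obtain ⟨s, hs, hslim⟩ := exists_tendsto_symDelta x
  obtain ⟨t, ht, htlim⟩ := exists_tendsto_symDelta x'
  have hip : ∀ (f : SymSchwartz d k), (∀ y, (starRingEnd ℂ) (f.1 y) = f.1 y) →
      ∀ g : SymSchwartz d k, ip f g = (toTempered f).1 g.1 := fun f hf g => by
    rw [toTempered_apply]
    simp only [ip, hf]
  have h1 : ∀ m n, (toTempered (s m)).1 (Ψ.1 (toTempered (t n))).1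
      = (starRingEnd ℂ) ((toTempered (t n)).1 (Ψ.1 (toTempered (s m))).1) := fun m n => by
    rw [← hip _ (hs m), ← hip _ (ht n), ip_conj]
    exact Ψ.2 _ _
  -- Self-adjointness is known only on functions. The Dirac masses are reached one variable at a
  -- time, so separate continuity suffices.
  have h2 : ∀ m, (toTempered (s m)).1 (Ψ.1 (symDelta x')).1
      = (starRingEnd ℂ) ((symDelta x').1 (Ψ.1 (toTempered (s m))).1) := fun m => by
    have hl : Continuous fun u : SymTempered d k => (toTempered (s m)).1 (Ψ.1 u).1 :=
      (toTempered (s m)).1.continuous.comp (continuous_subtype_val.comp Ψ.1.continuous)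
    have hr : Continuous fun u : SymTempered d k =>
        (starRingEnd ℂ) (u.1 (Ψ.1 (toTempered (s m))).1) :=
      Complex.continuous_conj.comp (continuous_apply_fun _)
    refine tendsto_nhds_unique ((hl.tendsto _).comp htlim) ?_
    refine ((hr.tendsto _).comp htlim).congr fun n => ?_
    exact (h1 m n).symm
  have h3 : (symDelta x).1 (Ψ.1 (symDelta x')).1
      = (starRingEnd ℂ) ((symDelta x').1 (Ψ.1 (symDelta x)).1) := by
    have hr : Continuous fun u : SymTempered d k =>
        (starRingEnd ℂ) ((symDelta x').1 (Ψ.1 u).1) :=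
      Complex.continuous_conj.comp ((symDelta x').1.continuous.comp
        (continuous_subtype_val.comp Ψ.1.continuous))
    refine tendsto_nhds_unique (((continuous_apply_fun _).tendsto _).comp hslim) ?_
    refine ((hr.tendsto _).comp hslim).congr fun n => ?_
    exact (h2 n).symm
  rw [symDelta_apply, symDelta_apply, symmetrize_coe, symmetrize_coe] at h3
  exact h3

theorem kernel_comp_perm_left (Ψ : SymTempered d k →L[ℂ] SymSchwartz d k) (π : Equiv.Perm (Fin k))
    (x x' : Conf d k) : kernel Ψ (x ∘ π) x' = kernel Ψ x x' := (Ψ (symDelta x')).2 π x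

theorem kernel_comp_perm_right (Ψ : SymTempered d k →L[ℂ] SymSchwartz d k)
    (π : Equiv.Perm (Fin k)) (x x' : Conf d k) : kernel Ψ x (x' ∘ π) = kernel Ψ x x' := by
  rw [kernel, kernel, symDelta_comp_perm]

end Hermitian

/-! ### Partial traces -/

section PartialTrace

variable {d k N : ℕ}

/-- The map `(y, (z, z')) ↦ ((z, y), (z', y))`. -/
def glueDiag (d : ℕ) {k N : ℕ} (h : k ≤ N) :
    Conf d (N - k) × (Conf d k × Conf d k) →L[ℝ] Conf d N × Conf d N :=
  ((splitConf d h).symm.toContinuousLinearMap.comp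
    (((ContinuousLinearMap.fst ℝ _ _).comp (ContinuousLinearMap.snd ℝ _ _)).prod
      (ContinuousLinearMap.fst ℝ _ _))).prod
  ((splitConf d h).symm.toContinuousLinearMap.comp
    (((ContinuousLinearMap.snd ℝ _ _).comp (ContinuousLinearMap.snd ℝ _ _)).prod
      (ContinuousLinearMap.fst ℝ _ _)))

/-- An injective linear map in finite dimensions is bounded below, so pulling back along it
preserves Schwartz decay. -/
theorem exists_antilipschitz_glueDiag (d : ℕ) {k N : ℕ} (h : k ≤ N) :
    ∃ K, AntilipschitzWith K (glueDiag d h) := by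
  obtain ⟨K, -, hK⟩ := LinearMap.exists_antilipschitzWith (glueDiag d h).toLinearMap (by
    rw [LinearMap.ker_eq_bot]
    intro p q hpq
    have h1 : (splitConf d h).symm (p.2.1, p.1) = (splitConf d h).symm (q.2.1, q.1) :=
      congrArg Prod.fst hpq
    have h2 : (splitConf d h).symm (p.2.2, p.1) = (splitConf d h).symm (q.2.2, q.1) :=
      congrArg Prod.snd hpq
    have h3 := (splitConf d h).symm.injective h1
    have h4 := (splitConf d h).symm.injective h2
    rw [Prod.mk.injEq] at h3 h4
    exact Prod.ext h3.2 (Prod.ext h3.1 h4.1))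
  exact ⟨K, hK⟩

/-- The partial trace of Schwartz kernels. -/
def ptrace (d : ℕ) {k N : ℕ} (h : k ≤ N) :
    𝓢(Conf d N × Conf d N, ℂ) →L[ℂ] 𝓢(Conf d k × Conf d k, ℂ) :=
  partialApplyCLM (SchwartzMap.integralCLM ℂ (volume : Measure (Conf d (N - k)))) ∘L
    SchwartzMap.compCLMOfAntilipschitz ℂ (glueDiag d h).hasTemperateGrowth
      (exists_antilipschitz_glueDiag d h).choose_spec

theorem ptrace_apply (h : k ≤ N) (K : 𝓢(Conf d N × Conf d N, ℂ)) (z z' : Conf d k) :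
    ptrace d h K (z, z') = ∫ y, K (glue z y, glue z' y) := by
  rw [ptrace, ContinuousLinearMap.comp_apply, partialApplyCLM_apply, SchwartzMap.integralCLM_apply]
  rfl

theorem ptrace_dmKernel_apply (h : k ≤ N) (Ψ : SymTempered d N →L[ℂ] SymSchwartz d N)
    (z z' : Conf d k) : ptrace d h (dmKernel Ψ) (z, z') = partialTraceKernel k Ψ z z' := by
  rw [ptrace_apply]
  simp only [dmKernel_apply]
  rfl

/-- σ is π on the first k particles and the identity on the others. -/
theorem glue_comp_perm (h : k ≤ N) (π : Equiv.Perm (Fin k)) :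
    ∃ σ : Equiv.Perm (Fin N), ∀ (z : Conf d k) (y : Conf d (N - k)),
      glue (z ∘ π) y = glue z y ∘ σ := by
  refine ⟨π.viaFintypeEmbedding (Fin.castLEEmb h), fun z y => ?_⟩
  funext i
  by_cases hi : i.val < k
  · have : i = Fin.castLEEmb h ⟨i.val, hi⟩ := rfl
    rw [this, Function.comp_apply, Equiv.Perm.viaFintypeEmbedding_apply_image]
    exact (glue_castLE h _ _ _).trans (glue_castLE h z y (π ⟨i.val, hi⟩)).symm
  · rw [Function.comp_apply, Equiv.Perm.viaFintypeEmbedding_apply_notMem_range]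
    · simp [glue, hi]
    · rintro ⟨a, rfl⟩
      exact hi a.isLt

theorem partialTraceKernel_comp_perm_left (h : k ≤ N) (Ψ : SymTempered d N →L[ℂ] SymSchwartz d N)
    (π : Equiv.Perm (Fin k)) (z z' : Conf d k) :
    partialTraceKernel k Ψ (z ∘ π) z' = partialTraceKernel k Ψ z z' := by
  obtain ⟨σ, hσ⟩ := glue_comp_perm (d := d) h π
  simp only [partialTraceKernel, hσ, kernel_comp_perm_left]

theorem partialTraceKernel_comp_perm_right (h : k ≤ N) (Ψ : SymTempered d N →L[ℂ] SymSchwartz d N)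
    (π : Equiv.Perm (Fin k)) (z z' : Conf d k) :
    partialTraceKernel k Ψ z (z' ∘ π) = partialTraceKernel k Ψ z z' := by
  obtain ⟨σ, hσ⟩ := glue_comp_perm (d := d) h π
  simp only [partialTraceKernel, hσ, kernel_comp_perm_right]

/-- The reduced operator as a continuous linear function of the operator. -/
def reduceCLM (d : ℕ) {k N : ℕ} (h : k ≤ N) :
    (SymTempered d N →L[ℂ] SymSchwartz d N) →L[ℂ] SymTempered d k →L[ℂ] SymSchwartz d k :=
  ofKernelCLM d k ∘L ptrace d h ∘L kernelCLM d N ∘L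
    ContinuousLinearMap.postcomp (SymTempered d N) (SymSchwartz d N).subtypeL

theorem reduceCLM_apply (h : k ≤ N) (Ψ : SymTempered d N →L[ℂ] SymSchwartz d N) :
    reduceCLM d h Ψ = ofKernel (ptrace d h (dmKernel Ψ)) := rfl

theorem hasKernel_reduceCLM (h : k ≤ N) (Ψ : SymTempered d N →L[ℂ] SymSchwartz d N) :
    HasKernel (reduceCLM d h Ψ) (partialTraceKernel k Ψ) := by
  have h1 : (fun x x' => ptrace d h (dmKernel Ψ) (x, x')) = partialTraceKernel k Ψ := by
    funext x x'; exact ptrace_dmKernel_apply h Ψ x x'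
  rw [reduceCLM_apply, ← h1]
  refine hasKernel_ofKernel fun π x x' => ?_
  rw [ptrace_dmKernel_apply, ptrace_dmKernel_apply, partialTraceKernel_comp_perm_left h]

theorem reduceCLM_mem_DM (h : k ≤ N) (Ψ : DM d N) : reduceCLM d h Ψ.1 ∈ DM d k := by
  have h1 : (fun x x' => ptrace d h (dmKernel Ψ.1) (x, x')) = partialTraceKernel k Ψ.1 := by
    funext x x'; exact ptrace_dmKernel_apply h Ψ.1 x x'
  have h2 := hasKernel_reduceCLM h Ψ.1
  rw [← h1] at h2
  refine h2.mem_DM fun x x' => ?_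
  rw [ptrace_apply, ptrace_apply, ← integral_conj]
  congr 1
  ext y
  rw [dmKernel_apply, dmKernel_apply, kernel_conj Ψ]

theorem kernel_reduceCLM (h : k ≤ N) (Ψ : SymTempered d N →L[ℂ] SymSchwartz d N)
    (z z' : Conf d k) : kernel (reduceCLM d h Ψ) z z' = ptrace d h (dmKernel Ψ) (z, z') := by
  rw [(hasKernel_reduceCLM h Ψ).kernel_eq
    (fun π => partialTraceKernel_comp_perm_right h Ψ π), ptrace_dmKernel_apply]

/-- The reduced density matrix map. -/
def rdmMap (d N : ℕ) : DM d N →ₗ[ℝ] DMHier d N where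
  toFun Ψ k := ⟨reduceCLM d (Nat.succ_le_of_lt k.isLt) Ψ.1, reduceCLM_mem_DM _ Ψ⟩
  map_add' Ψ Φ := by
    funext k
    exact Subtype.ext ((reduceCLM d _).map_add Ψ.1 Φ.1)
  map_smul' c Ψ := by
    funext k
    exact Subtype.ext ((reduceCLM d _).map_smul_of_tower c Ψ.1)

theorem continuous_rdmMap (d N : ℕ) : Continuous ⇑(rdmMap d N) :=
  continuous_pi fun _ => ((reduceCLM d _).continuous.comp continuous_subtype_val).subtype_mk _

theorem isRDMMap_rdmMap (d N : ℕ) : IsRDMMap ⇑(rdmMap d N) := fun Ψ _ =>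
  hasKernel_reduceCLM _ Ψ.1

theorem IsRDMMap.eq_rdmMap {ι : DM d N → DMHier d N} (h : IsRDMMap ι) : ι = ⇑(rdmMap d N) := by
  funext Ψ k
  exact Subtype.ext ((h Ψ k).unique (isRDMMap_rdmMap d N Ψ k))

end PartialTrace

section Trace

variable {d k N : ℕ}

/-! ### Traces -/

/-- Restriction of Schwartz kernels to the diagonal. -/
def diagCLM (d k : ℕ) : 𝓢(Conf d k × Conf d k, ℂ) →L[ℂ] 𝓢(Conf d k, ℂ) :=
  SchwartzMap.compCLMOfAntilipschitz ℂ (K := 1)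
    (g := (ContinuousLinearMap.id ℝ (Conf d k)).prod (ContinuousLinearMap.id ℝ (Conf d k)))
    (ContinuousLinearMap.hasTemperateGrowth _)
    (AntilipschitzWith.of_le_mul_dist fun x y => by
      rw [NNReal.coe_one, one_mul]
      exact le_max_left (dist x y) (dist x y))

@[simp] theorem diagCLM_apply (K : 𝓢(Conf d k × Conf d k, ℂ)) (x : Conf d k) :
    diagCLM d k K x = K (x, x) := rfl

theorem integrable_diag (K : 𝓢(Conf d k × Conf d k, ℂ)) : Integrable fun x => K (x, x) :=
  (diagCLM d k K).integrable (μ := volume)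

/-- The trace as a continuous linear functional. -/
def traceCLM (d k : ℕ) : (SymTempered d k →L[ℂ] SymSchwartz d k) →L[ℂ] ℂ :=
  SchwartzMap.integralCLM ℂ (volume : Measure (Conf d k)) ∘L diagCLM d k ∘L kernelCLM d k ∘L
    ContinuousLinearMap.postcomp (SymTempered d k) (SymSchwartz d k).subtypeL

theorem traceCLM_apply (T : SymTempered d k →L[ℂ] SymSchwartz d k) : traceCLM d k T = trace T := by
  have h : traceCLM d k T = ∫ x, diagCLM d k (dmKernel T) x := by
    rw [traceCLM, ContinuousLinearMap.comp_apply, SchwartzMap.integralCLM_apply]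
    rfl
  rw [h]
  simp only [diagCLM_apply, dmKernel_apply]
  rfl

theorem integral_ptrace_diag (h : k ≤ N) (K : 𝓢(Conf d N × Conf d N, ℂ)) :
    ∫ z, ptrace d h K (z, z) = ∫ x, K (x, x) := by
  rw [integral_glue h fun x => K (x, x)]
  have hi : Integrable fun p : Conf d k × Conf d (N - k) => K (glue p.1 p.2, glue p.1 p.2) :=
    (gluePull d h (diagCLM d N K)).integrable (μ := volume)
  rw [Measure.volume_eq_prod, integral_prod _ hi]
  simp only [ptrace_apply]

/-! ### Partial traces and operators acting on the remaining particles -/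

/-- The function `(w, y) ↦ K(w, y; z, y)`. -/
def blockSlice (h : k ≤ N) (z : Conf d k) (K : 𝓢(Conf d N × Conf d N, ℂ)) :
    𝓢(Conf d k × Conf d (N - k), ℂ) :=
  sliceAt z (SchwartzMap.compCLMOfContinuousLinearEquiv ℂ
    (((ContinuousLinearEquiv.prodComm ℝ (Conf d k) (Conf d (N - k))).prodCongr
      (ContinuousLinearEquiv.refl ℝ (Conf d k))).trans
        (ContinuousLinearEquiv.prodAssoc ℝ (Conf d (N - k)) (Conf d k) (Conf d k)))
    (SchwartzMap.compCLMOfAntilipschitz ℂ (glueDiag d h).hasTemperateGrowth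
      (exists_antilipschitz_glueDiag d h).choose_spec K))

theorem blockSlice_apply (h : k ≤ N) (z : Conf d k) (K : 𝓢(Conf d N × Conf d N, ℂ))
    (p : Conf d k × Conf d (N - k)) : blockSlice h z K p = K (glue p.1 p.2, glue z p.2) := rfl

theorem sip_slice_ptrace (h : k ≤ N) (z : Conf d k) (K : 𝓢(Conf d N × Conf d N, ℂ))
    (g : 𝓢(Conf d k, ℂ)) :
    sip g (sliceAt z (ptrace d h K)) = ∫ y, sip g (sliceAt y (blockSlice h z K)) := by
  have hi : Integrable (fun p : Conf d k × Conf d (N - k) =>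
      (starRingEnd ℂ) (g p.1) * blockSlice h z K p) := by
    obtain ⟨C, hC⟩ : ∃ C, ∀ x, ‖g x‖ ≤ C := ⟨_, fun x => g.norm_le_seminorm ℂ x⟩
    refine Integrable.bdd_mul (c := C) ((blockSlice h z K).integrable (μ := volume)) ?_
      (Eventually.of_forall fun x => ?_)
    · exact (Complex.continuous_conj.comp (g.continuous.comp
        continuous_fst)).aestronglyMeasurable
    · simpa using hC x.1
  have h1 : sip g (sliceAt z (ptrace d h K))
      = ∫ w, ∫ y, (starRingEnd ℂ) (g w) * blockSlice h z K (w, y) := by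
    rw [sip]
    congr 1
    ext w
    rw [sliceAt_apply, ptrace_apply, integral_const_mul]
    rfl
  rw [h1]
  exact integral_integral_swap hi

/-- Operators acting on the first particles commute with the partial trace over the others. -/
theorem slice_ptrace_lift (h : k ≤ N) {D : 𝓢(Conf d k, ℂ) →L[ℂ] 𝓢(Conf d k, ℂ)} (hD : IsSkew D)
    (Ψ : SymTempered d N →L[ℂ] 𝓢(Conf d N, ℂ)) (z : Conf d k) :
    sliceAt z (ptrace d h (kernelCLM d N (lift (Fin.castLEEmb h) D ∘L Ψ)))
      = D (sliceAt z (ptrace d h (kernelCLM d N Ψ))) := by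
  have h1 : ∀ y, sliceAt y (blockSlice h z (kernelCLM d N (lift (Fin.castLEEmb h) D ∘L Ψ)))
      = D (sliceAt y (blockSlice h z (kernelCLM d N Ψ))) := fun y => by
    ext w
    rw [sliceAt_apply, blockSlice_apply, kernelCLM_apply, ContinuousLinearMap.comp_apply,
      lift_apply]
    have hw : (fun a => glue w y (Fin.castLEEmb h a)) = w := funext fun a => glue_castLE h w y a
    simp only [hw]
    congr 2
    ext v
    rw [cslice_apply, sliceAt_apply, blockSlice_apply, kernelCLM_apply]
    congr 1
    funext i
    by_cases hi : i.val < k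
    · have : i = Fin.castLEEmb h ⟨i.val, hi⟩ := rfl
      rw [this, moveTo_self]
      exact (glue_castLE h v y _).symm
    · rw [moveTo_of_not]
      · simp [glue, hi]
      · rintro ⟨a, rfl⟩
        exact hi a.isLt
  -- Moving D through the integral over y is justified weakly: skew-adjointness shifts D onto the
  -- test function g, Fubini is applied, and D is shifted back inside the integral.
  rw [← sub_eq_zero]
  refine eq_zero_of_sip_self ?_
  set g := sliceAt z (ptrace d h (kernelCLM d N (lift (Fin.castLEEmb h) D ∘L Ψ)))
      - D (sliceAt z (ptrace d h (kernelCLM d N Ψ)))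
  have h2 : ∀ g, sip g (sliceAt z (ptrace d h (kernelCLM d N (lift (Fin.castLEEmb h) D ∘L Ψ))))
      = sip g (D (sliceAt z (ptrace d h (kernelCLM d N Ψ)))) := fun g => by
    rw [sip_slice_ptrace, hD, sip_slice_ptrace, ← integral_neg]
    simp only [h1, hD _ (sliceAt _ _)]
  rw [sip_sub_right, h2, sub_self]

/-- Permuting the integration variable reduces every tuple to the first k particles, and the number
of tuples cancels the normalization. On the first k particles the operator passes through the
partial trace. -/
theorem trace_embed_comp (h : k ≤ N) (A : Obs d k) (Ψ : SymTempered d N →L[ℂ] SymSchwartz d N) :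
    trace ((embed N A).1 ∘L Ψ) = trace (A.1 ∘L reduceCLM d h Ψ) := by
  set Φ := (SymSchwartz d N).subtypeL ∘L Ψ
  have hK : ∀ (j : Fin k ↪ Fin N) x, kernelCLM d N (lift j (fullOp A.1) ∘L Φ) (x, x)
      = lift j (fullOp A.1) (Ψ (symDelta x)).1 x := fun j x => kernelCLM_apply _ _ _
  have h1 : trace ((embed N A).1 ∘L Ψ) = ∫ x, ((N.descFactorial k : ℕ) : ℂ)⁻¹ *
      ∑ j : Fin k ↪ Fin N, kernelCLM d N (lift j (fullOp A.1) ∘L Φ) (x, x) := by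
    rw [trace]
    congr 1
    ext x
    rw [kernel, ContinuousLinearMap.comp_apply, embed_coe_apply, average_apply]
    simp only [hK]
  have h2 : ∀ j : Fin k ↪ Fin N, ∫ x, kernelCLM d N (lift j (fullOp A.1) ∘L Φ) (x, x)
      = ∫ x, kernelCLM d N (lift (Fin.castLEEmb h) (fullOp A.1) ∘L Φ) (x, x) := fun j => by
    have hj : j = (Fin.castLEEmb h).trans (extPerm j).toEmbedding := by
      ext a
      have := extPerm_castLE j h a
      simp [this]
    rw [← integral_comp_perm d (extPerm j)
      fun x => kernelCLM d N (lift (Fin.castLEEmb h) (fullOp A.1) ∘L Φ) (x, x)]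
    congr 1
    ext x
    rw [hK, hK, symDelta_comp_perm, ← lift_trans_perm, ← hj]
  have h3 : (trace (A.1 ∘L reduceCLM d h Ψ)) = ∫ z, sliceAt z
      (ptrace d h (kernelCLM d N (lift (Fin.castLEEmb h) (fullOp A.1) ∘L Φ))) z := by
    rw [trace]
    congr 1
    ext z
    have h4 : (reduceCLM d h Ψ (symDelta z)).1 = sliceAt z (ptrace d h (kernelCLM d N Φ)) := by
      ext w
      exact kernel_reduceCLM h Ψ w z
    rw [slice_ptrace_lift h (isSkew_fullOp A), fullOp_apply, ← h4, symmetrize_coe]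
    rfl
  rw [h1, integral_const_mul, integral_finsetSum _ fun j _ => integrable_diag _]
  simp only [h2, Finset.sum_const, Finset.card_univ, Fintype.card_embedding_eq, Fintype.card_fin,
    nsmul_eq_mul]
  rw [inv_mul_cancel_left₀, h3, ← integral_ptrace_diag h]
  · rfl
  · exact_mod_cast (Nat.descFactorial_eq_zero_iff_lt.not.2 h.not_gt)

/-! ### The pairings -/

/-- The pairing with a fixed observable, as a continuous linear functional. -/
def pairingCLM (A : Obs d k) : DM d k →L[ℝ] ℝ where
  toFun Ψ := obsPairing A Ψ
  map_add' Ψ Φ := by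
    simp [obsPairing, ← traceCLM_apply, ContinuousLinearMap.comp_add, mul_add]
  map_smul' r Ψ := by
    have h1 : A.1 ∘L (r • Ψ).1 = (r : ℂ) • (A.1 ∘L Ψ.1) := by
      ext1 u
      change A.1 ((r : ℂ) • Ψ.1 u) = (r : ℂ) • A.1 (Ψ.1 u)
      rw [map_smul]
    simp only [obsPairing, ← traceCLM_apply, h1, map_smul, smul_eq_mul, RingHom.id_apply]
    rw [mul_left_comm, Complex.re_ofReal_mul]
  cont := by
    simp only [obsPairing, ← traceCLM_apply]
    exact Complex.continuous_re.comp (continuous_const.mul ((traceCLM d k).continuous.comp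
      ((ContinuousLinearMap.postcomp (SymTempered d k) A.1).continuous.comp
        continuous_subtype_val)))

theorem obsPairing_add (A B : Obs d k) (Ψ : DM d k) :
    obsPairing (A + B) Ψ = obsPairing A Ψ + obsPairing B Ψ := by
  simp [obsPairing, ← traceCLM_apply, ContinuousLinearMap.add_comp, mul_add]

theorem obsPairing_smul (r : ℝ) (A : Obs d k) (Ψ : DM d k) :
    obsPairing (r • A) Ψ = r * obsPairing A Ψ := by
  have h1 : (r • A).1 ∘L Ψ.1 = (r : ℂ) • (A.1 ∘L Ψ.1) := rfl
  simp only [obsPairing, ← traceCLM_apply, h1, map_smul, smul_eq_mul]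
  rw [mul_left_comm, Complex.re_ofReal_mul]

theorem obsPairing_embed (h : k ≤ N) (A : Obs d k) (Ψ : DM d N) :
    obsPairing (embed N A) Ψ = obsPairing A ⟨reduceCLM d h Ψ.1, reduceCLM_mem_DM h Ψ⟩ := by
  rw [obsPairing, trace_embed_comp h]
  rfl

theorem obsPairing_sumEmbed (A : ObsHier d N) (Ψ : DM d N) :
    obsPairing (sumEmbed A) Ψ = hierPairing A (rdmMap d N Ψ) := by
  have h1 : ∀ s : Finset (Fin N), obsPairing (∑ k ∈ s, embed N (A k)) Ψ
      = ∑ k ∈ s, obsPairing (embed N (A k)) Ψ := fun s => by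
    induction s using Finset.induction_on with
    | empty =>
      have := obsPairing_smul 0 (0 : Obs d N) Ψ
      simpa using this
    | insert a s ha ih => rw [Finset.sum_insert ha, Finset.sum_insert ha, obsPairing_add, ih]
  rw [sumEmbed, h1, hierPairing]
  exact Finset.sum_congr rfl fun k _ => obsPairing_embed _ _ _

/-! ### Nondegeneracy -/

/-- The complex conjugate of a Schwartz function. -/
def conjSchwartz (f : 𝓢(Conf d k, ℂ)) : 𝓢(Conf d k, ℂ) :=
  SchwartzMap.postcompCLM (𝕜 := ℝ) Complex.conjCLE.toContinuousLinearMap f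

theorem conjSchwartz_apply (f : 𝓢(Conf d k, ℂ)) (x : Conf d k) :
    conjSchwartz f x = (starRingEnd ℂ) (f x) := rfl

/-- Evaluation of bosonic tempered distributions at a Schwartz function. -/
def evalTempered (f : 𝓢(Conf d k, ℂ)) : SymTempered d k →L[ℂ] ℂ where
  toFun u := u.1 f
  map_add' _ _ := rfl
  map_smul' _ _ := rfl
  cont := continuous_apply_fun f

/-- The rank one density matrix `|f⟩⟨f|`. -/
def rankOne (f : SymSchwartz d k) : DM d k :=
  ⟨(evalTempered (conjSchwartz f.1)).smulRight f, fun g h => by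
    have h1 : ∀ g : SymSchwartz d k, (toTempered g).1 (conjSchwartz f.1) = ip f g := fun g => by
      rw [toTempered_apply, ip]
      simp only [conjSchwartz_apply, mul_comm]
    change sip g.1 ((toTempered h).1 (conjSchwartz f.1) • f.1)
      = sip ((toTempered g).1 (conjSchwartz f.1) • f.1) h.1
    rw [h1, h1, sip_smul_right, sip_smul_left, ip_conj, mul_comm]
    rfl⟩

theorem rankOne_apply (f : SymSchwartz d k) (u : SymTempered d k) :
    (rankOne f).1 u = u.1 (conjSchwartz f.1) • f := rfl

theorem trace_comp_rankOne (A : SymSchwartz d k →L[ℂ] SymSchwartz d k) (f : SymSchwartz d k) :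
    trace (A ∘L (rankOne f).1) = ip f (A f) := by
  rw [trace, ip]
  congr 1
  ext x
  rw [kernel, ContinuousLinearMap.comp_apply, rankOne_apply, map_smul, symDelta_apply,
    symmetrize_of_mem]
  · rfl
  · intro π y
    rw [conjSchwartz_apply, conjSchwartz_apply, f.2]

/-- Pairing with |f⟩⟨f| shows that the imaginary part of ⟨f, Af⟩ vanishes; the real part vanishes by
skew-adjointness. Polarization then gives A = 0. -/
theorem eq_zero_of_obsPairing {A : Obs d k} (h : ∀ Ψ, obsPairing A Ψ = 0) : A = 0 := by
  have h1 : ∀ f, sip f.1 (A.1 f).1 = 0 := fun f => by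
    have h2 := h (rankOne f)
    rw [obsPairing, trace_comp_rankOne, Complex.I_mul_re, neg_eq_zero] at h2
    have h3 := congrArg Complex.re (ip_conj f (A.1 f))
    have h4 := congrArg Complex.re (A.2 f f)
    rw [Complex.conj_re] at h3
    rw [Complex.neg_re] at h4
    exact Complex.ext (by change (ip f (A.1 f)).re = 0; linarith) h2
  have h5 : ∀ g, A.1 g = 0 := fun g => by
    -- For f = Ag + ig the cross terms of ⟨f, Af⟩ add up to 2i‖Ag‖², because ⟨g, A²g⟩ = -‖Ag‖².
    have h6 := h1 (A.1 g + Complex.I • g)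
    have h7 : sip (A.1 g + Complex.I • g).1 (A.1 (A.1 g + Complex.I • g)).1
        = sip ((A.1 g).1 + Complex.I • g.1) ((A.1 (A.1 g)).1 + Complex.I • (A.1 g).1) := by
      rw [map_add, map_smul]; rfl
    have h8 : sip g.1 (A.1 (A.1 g)).1 = -sip (A.1 g).1 (A.1 g).1 := A.2 g (A.1 g)
    rw [h7, sip_add_right, sip_add_left, sip_add_left, sip_smul_right, sip_smul_right,
      sip_smul_left, sip_smul_left, h1, h1, h8] at h6
    simp only [Complex.conj_I, mul_zero, zero_add, add_zero, neg_mul_neg] at h6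
    have h9 : sip (A.1 g).1 (A.1 g).1 = 0 := by
      have : 2 * Complex.I * sip (A.1 g).1 (A.1 g).1 = 0 := by linear_combination h6
      simpa using this
    exact Subtype.ext (eq_zero_of_sip_self h9)
  ext1
  ext1 g
  exact h5 g

theorem obsPairing_injective {A B : Obs d k} (h : ∀ Ψ, obsPairing A Ψ = obsPairing B Ψ) :
    A = B := by
  rw [← sub_eq_zero]
  refine eq_zero_of_obsPairing fun Ψ => ?_
  have h1 := obsPairing_add (A - B) B Ψ
  have h2 : A - B + B = A := sub_add_cancel A B
  rw [h2, h] at h1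
  linarith

end Trace

/-! ### Gâteaux calculus of linear maps and algebraic operations -/

section Gateaux

variable {X Y : Type*} [AddCommGroup X] [Module ℝ X] [TopologicalSpace X]
  [AddCommGroup Y] [Module ℝ Y] [TopologicalSpace Y]

theorem hasGateauxDerivAt_linear (L : X →ₗ[ℝ] Y) (x v : X) :
    HasGateauxDerivAt (fun x => L x) x v (L v) := by
  refine tendsto_const_nhds.congr' ?_
  filter_upwards [self_mem_nhdsWithin] with t ht
  have ht' : t ≠ 0 := ht
  rw [← map_sub, add_sub_cancel_left, map_smul, smul_smul, inv_mul_cancel₀ ht', one_smul]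

theorem hasGateauxDerivAt_const (c : Y) (x v : X) :
    HasGateauxDerivAt (fun _ : X => c) x v 0 := by
  simpa [HasGateauxDerivAt] using tendsto_const_nhds

theorem gateauxSmooth_linear (L : X →ₗ[ℝ] Y) (hL : Continuous fun x => L x) :
    GateauxSmooth fun x => L x := by
  -- The first derivative of L is L at the direction, independently of the base point; all higher
  -- ones vanish.
  refine ⟨fun r => match r with
    | 0 => fun x _ => L x
    | 1 => fun _ v => L (v 0)
    | _ + 2 => fun _ _ => 0, fun x v => rfl, fun r => ?_, fun r x v w => ?_⟩
  · match r with
    | 0 => exact hL.comp continuous_fst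
    | 1 => exact hL.comp ((continuous_apply 0).comp continuous_snd)
    | _ + 2 => exact continuous_const
  · match r with
    | 0 =>
      have h : (Fin.snoc v w : Fin (0 + 1) → X) 0 = w := Fin.snoc_last (α := fun _ => X) w v
      change HasGateauxDerivAt (fun y => L y) x w (L ((Fin.snoc v w : Fin (0 + 1) → X) 0))
      rw [h]
      exact hasGateauxDerivAt_linear L x w
    | 1 => exact hasGateauxDerivAt_const _ x w
    | _ + 2 => exact hasGateauxDerivAt_const _ x w

theorem gateauxSmooth_of_linear {f : X → Y} (hadd : ∀ x y, f (x + y) = f x + f y)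
    (hsmul : ∀ (c : ℝ) x, f (c • x) = c • f x) (hf : Continuous f) : GateauxSmooth f :=
  gateauxSmooth_linear ⟨⟨f, hadd⟩, hsmul⟩ hf

theorem HasGateauxDerivAt.add {F G : X → ℝ} {x v : X} {a b : ℝ} (hF : HasGateauxDerivAt F x v a)
    (hG : HasGateauxDerivAt G x v b) : HasGateauxDerivAt (F + G) x v (a + b) := by
  refine (Tendsto.add hF hG).congr fun t => ?_
  simp only [Pi.add_apply, smul_eq_mul]
  ring

theorem HasGateauxDerivAt.tendsto {F : X → ℝ} {x v : X} {a : ℝ} (hF : HasGateauxDerivAt F x v a) :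
    Tendsto (fun t : ℝ => F (x + t • v)) (𝓝[≠] 0) (𝓝 (F x)) := by
  have h1 : Tendsto (fun t : ℝ => t) (𝓝[≠] 0) (𝓝 0) := nhdsWithin_le_nhds
  have h2 := (h1.mul hF).add_const (F x)
  rw [zero_mul, zero_add] at h2
  refine h2.congr' ?_
  filter_upwards [self_mem_nhdsWithin] with t ht
  have ht' : t ≠ 0 := ht
  rw [smul_eq_mul, mul_inv_cancel_left₀ ht', sub_add_cancel]

theorem HasGateauxDerivAt.mul {F G : X → ℝ} {x v : X} {a b : ℝ} (hF : HasGateauxDerivAt F x v a)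
    (hG : HasGateauxDerivAt G x v b) :
    HasGateauxDerivAt (F * G) x v (G x * a + F x * b) := by
  have h1 := (hG.tendsto.mul hF).add (hG.const_mul (F x))
  refine h1.congr fun t => ?_
  simp only [Pi.mul_apply, smul_eq_mul]
  ring

end Gateaux

/-! ### Poisson maps between Lie-Poisson structures -/

section LiePoisson

variable {L₁ M₁ L₂ M₂ : Type*} [Zero L₁] [AddCommGroup M₁] [Module ℝ M₁] [TopologicalSpace M₁]
  [Zero L₂] [AddCommGroup M₂] [Module ℝ M₂] [TopologicalSpace M₂]

/-- A pairing that is linear in the second entry, and whose functionals form a vector space. -/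
structure IsLinearPairing (pair : L₂ → M₂ → ℝ) : Prop where
  map_add : ∀ A m m', pair A (m + m') = pair A m + pair A m'
  map_smul : ∀ A (c : ℝ) m, pair A (c • m) = c * pair A m
  exists_zero : ∃ C, ∀ m, pair C m = 0
  exists_comb : ∀ (a b : ℝ) A B, ∃ C, ∀ m, pair C m = a * pair A m + b * pair B m

/-- Generators are linear or constant, and the sum and Leibniz rules stay within L: at m, a product
FG has derivative G(m) dF + F(m) dG. -/
theorem IsLinearPairing.exists_isFunctionalDeriv {pair : L₂ → M₂ → ℝ} (hp : IsLinearPairing pair)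
    (br : L₂ → L₂ → L₂) {F : M₂ → ℝ} (hF : F ∈ (liePoisson pair br).functionals) (m : M₂) :
    ∃ A, IsFunctionalDeriv pair F m A := by
  have hconst : ∀ c : ℝ, ∃ A, IsFunctionalDeriv pair (fun _ => c) m A := fun c => by
    obtain ⟨C, hC⟩ := hp.exists_zero
    refine ⟨C, fun v => ?_⟩
    rw [hC]
    exact hasGateauxDerivAt_const c m v
  induction hF using Algebra.adjoin_induction with
  | mem F hF =>
    rcases hF with ⟨-, A, hA⟩ | ⟨c, hc⟩
    · obtain rfl : F = fun m => pair A m := funext hA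
      exact ⟨A, fun v => hasGateauxDerivAt_linear
        (⟨⟨pair A, hp.map_add A⟩, hp.map_smul A⟩ : M₂ →ₗ[ℝ] ℝ) m v⟩
    · obtain rfl : F = fun _ => c := funext hc
      exact hconst c
  | algebraMap r => exact hconst r
  | add F G _ _ hF hG =>
    obtain ⟨A, hA⟩ := hF
    obtain ⟨B, hB⟩ := hG
    obtain ⟨C, hC⟩ := hp.exists_comb 1 1 A B
    refine ⟨C, fun v => ?_⟩
    rw [hC, one_mul, one_mul]
    exact (hA v).add (hB v)
  | mul F G _ _ hF hG =>
    obtain ⟨A, hA⟩ := hF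
    obtain ⟨B, hB⟩ := hG
    obtain ⟨C, hC⟩ := hp.exists_comb (G m) (F m) A B
    refine ⟨C, fun v => ?_⟩
    rw [hC]
    exact (hA v).mul (hB v)

theorem functionalDeriv_spec {pair : L₁ → M₁ → ℝ} {F : M₁ → ℝ} {m : M₁}
    (h : ∃ A, IsFunctionalDeriv pair F m A) :
    IsFunctionalDeriv pair F m (functionalDeriv pair F m) := by
  rw [functionalDeriv, dif_pos h]
  exact h.choose_spec

theorem IsFunctionalDeriv.functionalDeriv_eq {pair : L₁ → M₁ → ℝ}
    (hnd : ∀ A B, (∀ m, pair A m = pair B m) → A = B) {F : M₁ → ℝ} {m : M₁} {A : L₁}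
    (h : IsFunctionalDeriv pair F m A) : functionalDeriv pair F m = A :=
  hnd _ _ fun v => tendsto_nhds_unique (functionalDeriv_spec ⟨A, h⟩ v) (h v)

/-- The adjoint of a bracket preserving map is a Poisson map. -/
theorem isPoissonMap_of_dual {pair₁ : L₁ → M₁ → ℝ} {br₁ : L₁ → L₁ → L₁}
    {pair₂ : L₂ → M₂ → ℝ} (hp : IsLinearPairing pair₂) {br₂ : L₂ → L₂ → L₂} {ι : M₁ → M₂}
    (hadd : ∀ x y, ι (x + y) = ι x + ι y) (hsmul : ∀ (c : ℝ) x, ι (c • x) = c • ι x)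
    (hι : Continuous ι) (ε : L₂ → L₁)
    (hnd : ∀ A B, (∀ m, pair₁ A m = pair₁ B m) → A = B)
    (hdual : ∀ A m, pair₁ (ε A) m = pair₂ A (ι m))
    (hsmooth : ∀ A, GateauxSmooth fun m => pair₁ A m)
    (hbr : ∀ A B, ε (br₂ A B) = br₁ (ε A) (ε B)) :
    IsPoissonMap (liePoisson pair₁ br₁) (liePoisson pair₂ br₂) ι := by
  refine ⟨gateauxSmooth_of_linear hadd hsmul hι, fun F hF => ?_, fun F hF G hG => ?_⟩
  · let R : (M₂ → ℝ) →ₐ[ℝ] (M₁ → ℝ) :=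
      { toFun := fun F m => F (ι m)
        map_one' := rfl
        map_mul' := fun _ _ => rfl
        map_zero' := rfl
        map_add' := fun _ _ => rfl
        commutes' := fun _ => rfl }
    -- Pullback along ι is an algebra morphism, so admissibility need only be checked on generators.
    have h1 : (liePoisson pair₂ br₂).functionals
        ≤ (liePoisson pair₁ br₁).functionals.comap R := by
      refine Algebra.adjoin_le ?_
      rintro F (⟨-, A, hA⟩ | ⟨c, hc⟩)
      · have h2 : R F = fun m => pair₁ (ε A) m := funext fun m => (hA _).trans (hdual A m).symm
        change R F ∈ (liePoisson pair₁ br₁).functionals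
        rw [h2]
        exact Algebra.subset_adjoin (Or.inl ⟨hsmooth _, ε A, fun m => rfl⟩)
      · exact Algebra.subset_adjoin (Or.inr ⟨c, fun m => hc _⟩)
    exact h1 hF
  · funext m
    -- The chain rule is exact at the level of difference quotients because ι is linear; duality
    -- then moves ι to the other side as ε.
    have key : ∀ F ∈ (liePoisson pair₂ br₂).functionals,
        functionalDeriv pair₁ (F ∘ ι) m
          = ε (functionalDeriv pair₂ F (ι m)) := fun F hF => by
      refine IsFunctionalDeriv.functionalDeriv_eq hnd fun v => ?_
      have h1 := functionalDeriv_spec (hp.exists_isFunctionalDeriv br₂ hF (ι m)) (ι v)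
      rw [hdual]
      refine h1.congr fun t => ?_
      simp only [Function.comp_apply, hadd, hsmul]
    change pair₂ (br₂ _ _) (ι m) = pair₁ (br₁ _ _) m
    rw [key F hF, key G hG, ← hbr, hdual]

end LiePoisson

/-! ### Sums of additive maps -/

section Sums

variable {ι : Type*} [Fintype ι]

theorem biadditive_sum_sum {G : Type*} [AddCommGroup G] {b : G → G → G}
    (h₁ : ∀ x x' y, b (x + x') y = b x y + b x' y) (h₂ : ∀ x y y', b x (y + y') = b x y + b x y')
    (f g : ι → G) : b (∑ i, f i) (∑ i, g i) = ∑ p : ι × ι, b (f p.1) (g p.2) := by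
  let B : G →+ G →+ G := AddMonoidHom.mk' (fun x => AddMonoidHom.mk' (b x) (h₂ x))
    fun x x' => AddMonoidHom.ext fun y => h₁ x x' y
  change B (∑ i, f i) (∑ i, g i) = ∑ p : ι × ι, B (f p.1) (g p.2)
  rw [map_sum B, AddMonoidHom.finsetSum_apply, Fintype.sum_prod_type]
  simp only [map_sum]

theorem additive_sum {G H κ : Type*} [AddCommGroup G] [AddCommGroup H] {e : G → H}
    (h : ∀ x y, e (x + y) = e x + e y) (s : Finset κ) (f : κ → G) :
    e (∑ i ∈ s, f i) = ∑ i ∈ s, e (f i) :=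
  map_sum (AddMonoidHom.mk' e h) f s

end Sums

/-! ### The sum of the embeddings preserves brackets -/

section Bracket

variable {d k N : ℕ}

local instance instAddCommGroupObs (d k : ℕ) : AddCommGroup (Obs d k) := Submodule.addCommGroup _

local instance instAddCommMonoidObs (d k : ℕ) : AddCommMonoid (Obs d k) :=
  (instAddCommGroupObs d k).toAddCommMonoid

theorem embed_add (A B : Obs d k) : embed N (A + B) = embed N A + embed N B := by
  have h1 : fullOp (A + B).1 = fullOp A.1 + fullOp B.1 := rfl
  refine Subtype.ext (ContinuousLinearMap.ext fun f => Subtype.ext ?_)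
  change ((embed N (A + B)).1 f).1 = ((embed N A).1 f).1 + ((embed N B).1 f).1
  rw [embed_coe_apply, embed_coe_apply, embed_coe_apply, h1]
  ext x
  rw [add_apply, average_apply, average_apply, average_apply, ← mul_add,
    ← Finset.sum_add_distrib]
  simp only [lift_apply]
  rfl

theorem obsBracket_add_left (A A' B : Obs d k) :
    obsBracket (A + A') B = obsBracket A B + obsBracket A' B := by
  refine Subtype.ext ?_
  change (k : ℝ) • ((A.1 + A'.1) ∘L B.1 - B.1 ∘L (A.1 + A'.1))
    = (k : ℝ) • (A.1 ∘L B.1 - B.1 ∘L A.1) + (k : ℝ) • (A'.1 ∘L B.1 - B.1 ∘L A'.1)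
  rw [ContinuousLinearMap.add_comp, ContinuousLinearMap.comp_add, add_sub_add_comm]
  exact smul_add _ _ _

theorem obsBracket_add_right (A B B' : Obs d k) :
    obsBracket A (B + B') = obsBracket A B + obsBracket A B' := by
  refine Subtype.ext ?_
  change (k : ℝ) • (A.1 ∘L (B.1 + B'.1) - (B.1 + B'.1) ∘L A.1)
    = (k : ℝ) • (A.1 ∘L B.1 - B.1 ∘L A.1) + (k : ℝ) • (A.1 ∘L B'.1 - B'.1 ∘L A.1)
  rw [ContinuousLinearMap.add_comp, ContinuousLinearMap.comp_add, add_sub_add_comm]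
  exact smul_add _ _ _

/-- Only the fact that the commutator lies in the range of the embedding matters here; injectivity
plays no role. -/
theorem embed_invFun {p : Fin N × Fin N} {k : Fin N}
    (hk : min ((p.1.val + 1) + (p.2.val + 1) - 1) N = k.val + 1) (A B : ObsHier d N) :
    embed N (Function.invFun (embed (d := d) (k := k.val + 1) N)
      (obsBracket (embed N (A p.1)) (embed N (B p.2))))
        = obsBracket (embed N (A p.1)) (embed N (B p.2)) :=
  Function.invFun_eq (exists_embed_eq_obsBracket hk.symm (A p.1) (B p.2))

/-- By biadditivity the bracket is a sum over pairs of components, and each pair feeds exactly one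
component of the hierarchy bracket. -/
theorem sumEmbed_hierBracket (A B : ObsHier d N) :
    sumEmbed (hierBracket A B) = obsBracket (sumEmbed A) (sumEmbed B) := by
  have h1 : obsBracket (sumEmbed A) (sumEmbed B)
      = ∑ p : Fin N × Fin N, obsBracket (embed N (A p.1)) (embed N (B p.2)) :=
    biadditive_sum_sum obsBracket_add_left obsBracket_add_right _ _
  -- The final - 1 converts a number of particles into an index, as index k stands for k + 1
  -- particles.
  let κ : Fin N × Fin N → Fin N := fun p =>
    ⟨min ((p.1.val + 1) + (p.2.val + 1) - 1) N - 1, by have := p.1.isLt; omega⟩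
  have hκ : ∀ p k, min ((p.1.val + 1) + (p.2.val + 1) - 1) N = k.val + 1 ↔ κ p = k := fun p k => by
    have := p.1.isLt
    simp only [κ, Fin.ext_iff]
    omega
  rw [h1, sumEmbed, ← Finset.sum_fiberwise Finset.univ κ]
  refine Finset.sum_congr rfl fun k _ => ?_
  rw [hierBracket, additive_sum embed_add]
  refine Finset.sum_congr (Finset.filter_congr fun p _ => hκ p k) fun p hp => ?_
  rw [Finset.mem_filter] at hp
  exact embed_invFun ((hκ p k).2 hp.2) A B

end Bracket

theorem isLinearPairing_hierPairing (d N : ℕ) : IsLinearPairing (hierPairing (d := d) (N := N)) where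
  map_add A Γ Γ' := by
    rw [hierPairing, hierPairing, hierPairing, ← Finset.sum_add_distrib]
    exact Finset.sum_congr rfl fun k _ => (pairingCLM (A k)).map_add (Γ k) (Γ' k)
  map_smul A c Γ := by
    rw [hierPairing, hierPairing, Finset.mul_sum]
    exact Finset.sum_congr rfl fun k _ => (pairingCLM (A k)).map_smul c (Γ k)
  exists_zero := by
    refine ⟨fun k => (0 : ℝ) • (0 : Obs d (k.val + 1)), fun Γ => ?_⟩
    simp only [hierPairing, obsPairing_smul, zero_mul, Finset.sum_const_zero]
  exists_comb a b A B := by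
    refine ⟨fun k => a • A k + b • B k, fun Γ => ?_⟩
    simp only [hierPairing, obsPairing_add, obsPairing_smul, Finset.sum_add_distrib,
      Finset.mul_sum]

theorem isPoissonMap_rdmMap (d N : ℕ) :
    IsPoissonMap (dmPoisson d N) (hierPoisson d N) ⇑(rdmMap d N) := by
  refine isPoissonMap_of_dual (isLinearPairing_hierPairing d N) ?_ ?_ ?_ sumEmbed ?_ ?_ ?_ ?_
  · exact (rdmMap d N).map_add
  · exact (rdmMap d N).map_smul
  · exact continuous_rdmMap d N
  · exact fun _ _ => obsPairing_injective
  · exact obsPairing_sumEmbed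
  · exact fun A => gateauxSmooth_of_linear (pairingCLM A).map_add (pairingCLM A).map_smul
      (pairingCLM A).continuous
  · exact sumEmbed_hierBracket

end

end BosonicRDM

theorem proposition4p7 (d N : ℕ) (hd : 1 ≤ d) (hN : 1 ≤ N) :
    (∃! ι : DM d N → DMHier d N, IsRDMMap ι) ∧
    ∀ ι : DM d N → DMHier d N, IsRDMMap ι →
      IsPoissonMap (dmPoisson d N) (hierPoisson d N) ι ∧
      ∀ (A : ObsHier d N) (Ψ : DM d N),
        obsPairing (sumEmbed A) Ψ = hierPairing A (ι Ψ) := by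
  refine ⟨⟨_, isRDMMap_rdmMap d N, fun ι h => h.eq_rdmMap⟩, fun ι h => ?_⟩
  obtain rfl := h.eq_rdmMap
  exact ⟨isPoissonMap_rdmMap d N, obsPairing_sumEmbed⟩
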